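/- Let $m>0$ and consider the Schwarzschild spacetime $$ds^2=-\Big(1-\frac{2m}{r}\Big)dt^2+\Big(1-\frac{2m}{r}\Big)^{-1}dr^2+r^2\tilde\sigma,\qquad r>2m,$$ where $\tilde\sigma$ is the round metric of the unit sphere. Write $x=(x^1,x^2,x^3)=r\tilde x$ with $|\tilde x|=1$, $r=|x|$. For a function $f$ of $x$, let $g$ be the metric induced on the graph $t=f(x)$, let $k(X,Y)=-\langle\nu,\nabla_XY\rangle$ be its second fundamental form with respect to the future unit normal $\nu$, both written in the coordinates $x^i$, and let $\pi=k-(\mathrm{tr}_gk)\,g$. The end $\{|x|>R\}$ with data $(g,k)$ is called *asymptotically flat* if $g$ is a smooth Riemannian metric, $k$ is smooth and symmetric, and for some $q>\frac12$, $p>\frac32$, $\varepsilon>0$ one has $g_{ij}-\delta_{ij}=O_2(r^{-q})$, $k_{ij}=O_1(r^{-p})$, $\mu=O(r^{-3-\varepsilon})$ and $|J|=O(r^{-3-\varepsilon})$ as $r\to\infty$, where $\mu=\frac12(R_g-|k|_g^2+(\mathrm{tr}_gk)^2)$, $J=\mathrm{div}_gk-d(\mathrm{tr}_gk)$, and $O_l$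 means that each derivative up to order $l$ gains one power of $r^{-1}$. With $d\sigma_0$ the area measure of the round sphere of radius $r$, put $$E=\tfrac1{16\pi}\lim_{r\to\infty}\int_{|x|=r}\sum_{j,k}(\partial_kg_{jk}-\partial_jg_{kk})\tfrac{x^j}{|x|}\,d\sigma_0,\qquad P_i=\tfrac1{8\pi}\lim_{r\to\infty}\int_{|x|=r}\sum_k\pi_{ik}\tfrac{x^k}{|x|}\,d\sigma_0,$$ $$C^i=\tfrac1{16\pi}\lim_{r\to\infty}\int_{|x|=r}\Big[x^i\sum_{j,k}(\partial_kg_{jk}-\partial_jg_{kk})\tfrac{x^j}{|x|}-\sum_k\Big((g_{ki}-\delta_{ki})\tfrac{x^k}{|x|}-(g_{kk}-\delta_{kk})\tfrac{x^i}{|x|}\Big)\Big]d\sigma_0,$$ $$J(Y)=\tfrac1{8\pi}\lim_{r\to\infty}\int_{|x|=r}\sum_{j,k}\pi_{jk}Y^j\tfrac{x^k}{|x|}\,d\sigma_0 .$$ **Theorem.** Let $f=r^{1/3}\,\tilde x^1(\tilde x^2)^3$. (1) There is $R\ge 2m$ such that the graph of $f$ over $\{|x|>R\}$ is spacelike, and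 for every such $R$ this graph is an asymptotically flat end. All the following limits exist: $E=m$, $P_1=P_2=P_3=0$, $C^1=C^2=C^3=0$; $J(Y)$ is finite for each rotation field $Y=\frac{\partial}{\partial x^i}\times\vec x$, $i=1,2,3$; and $$J\Big(x^1\frac{\partial}{\partial x^2}-x^2\frac{\partial}{\partial x^1}\Big)=\frac{2}{3\cdot7\cdot11}.$$ (2) For every $\lambda>0$ the graph of $\lambda f$ is spacelike over $\{|x|>R\}$ for some $R\ge 2m$, is an asymptotically flat end for every such $R$, and has $E=m$, $P=0$ and finite $J(Y)$ for each of the three rotation fields. (3) The angular momentum $J(x^1\partial_2-x^2\partial_1)$ of the graph of $\lambda f$ is arbitrarily large for suitable $\lambda>0$: for every $c\in\mathbb R$ (in particular $c=m$) there is $\lambda>0$ for which it is finite and greater than $c$. -/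

import Mathlib

open Filter Topology MeasureTheory Asymptotics
open scoped Matrix ContDiff

noncomputable section

namespace SchwarzschildGraph

/-- Coordinate space `ℝⁿ` with its Euclidean norm. -/
abbrev Pt (n : ℕ) : Type := EuclideanSpace ℝ (Fin n)

/-- A field of `(0,2)`-tensors on (a part of) `ℝⁿ`, given by its components in the
coordinate frame. -/
abbrev TensorField (n : ℕ) : Type := Pt n → Matrix (Fin n) (Fin n) ℝ

/-- The partial derivative `∂F/∂xⁱ`. -/
def pd {n : ℕ} (i : Fin n) (F : Pt n → ℝ) (x : Pt n) : ℝ :=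
  fderiv ℝ F x (EuclideanSpace.single i 1)

/-! ### Pseudo-Riemannian geometry in a coordinate chart -/

/-- The Christoffel symbol `Γᵏᵢⱼ` of the metric `g`, at the point `x`. -/
def christoffel {n : ℕ} (g : TensorField n) (k i j : Fin n) (x : Pt n) : ℝ :=
  (1 / 2) * ∑ l, (g x)⁻¹ k l *
    (pd i (fun y => g y j l) x + pd j (fun y => g y i l) x - pd l (fun y => g y i j) x)

/-- The Ricci tensor
`Rᵢⱼ = ∂ₖΓᵏᵢⱼ - ∂ⱼΓᵏᵢₖ + Γᵏₖₗ Γˡᵢⱼ - Γᵏⱼₗ Γˡᵢₖ`. -/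
def ricci {n : ℕ} (g : TensorField n) (i j : Fin n) (x : Pt n) : ℝ :=
  ∑ k, (pd k (christoffel g k i j) x - pd j (christoffel g k i k) x
    + ∑ l, (christoffel g k k l x * christoffel g l i j x
      - christoffel g k j l x * christoffel g l i k x))

/-- The scalar curvature `R_g`. -/
def scalarCurvature {n : ℕ} (g : TensorField n) (x : Pt n) : ℝ :=
  ∑ i, ∑ j, (g x)⁻¹ i j * ricci g i j x

/-- The trace `tr_g k = gⁱʲ kᵢⱼ`. -/
def trace {n : ℕ} (g k : TensorField n) (x : Pt n) : ℝ :=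
  ∑ i, ∑ j, (g x)⁻¹ i j * k x i j

/-- `|k|²_g = gⁱᵃ gʲᵇ kᵢⱼ kₐᵦ`. -/
def normSq {n : ℕ} (g k : TensorField n) (x : Pt n) : ℝ :=
  ∑ i, ∑ j, ∑ a, ∑ b, (g x)⁻¹ i a * (g x)⁻¹ j b * k x i j * k x a b

/-- The component `(∇ₗ k)ᵢⱼ` of the Levi-Civita covariant derivative of `k`. -/
def covDeriv {n : ℕ} (g k : TensorField n) (l i j : Fin n) (x : Pt n) : ℝ :=
  pd l (fun y => k y i j) x
    - ∑ a, (christoffel g a l i x * k x a j + christoffel g a l j x * k x i a)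

/-- The divergence `(div_g k)ⱼ = gˡⁱ (∇ₗ k)ᵢⱼ`. -/
def divergence {n : ℕ} (g k : TensorField n) (j : Fin n) (x : Pt n) : ℝ :=
  ∑ l, ∑ i, (g x)⁻¹ l i * covDeriv g k l i j x

/-! ### Initial data sets and asymptotic flatness -/

/-- The mass density `μ = ½ (R_g - |k|²_g + (tr_g k)²)`. -/
def massDensity (g k : TensorField 3) (x : Pt 3) : ℝ :=
  (1 / 2) * (scalarCurvature g x - normSq g k x + trace g k x ^ 2)

/-- The current density `J = div_g k - d (tr_g k)`. -/
def currentDensity (g k : TensorField 3) (j : Fin 3) (x : Pt 3) : ℝ :=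
  divergence g k j x - pd j (trace g k) x

/-- The length `|J|_g` of the current density. -/
def currentNorm (g k : TensorField 3) (x : Pt 3) : ℝ :=
  √(∑ i, ∑ j, (g x)⁻¹ i j * currentDensity g k i x * currentDensity g k j x)

/-- The conjugate momentum `π = k - (tr_g k) g`. -/
def conjMomentum (g k : TensorField 3) : TensorField 3 :=
  fun x => k x - trace g k x • g x

/-- `F = O(r^a)` as `r = |x| → ∞` in `ℝ³`. -/
def IsBigOPow (F : Pt 3 → ℝ) (a : ℝ) : Prop :=
  F =O[Bornology.cobounded (Pt 3)] fun x => ‖x‖ ^ a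

/-- `F = O₁(r^a)`: also the first derivatives decay, one order faster. -/
def IsBigOPow₁ (F : Pt 3 → ℝ) (a : ℝ) : Prop :=
  IsBigOPow F a ∧ ∀ i, IsBigOPow (pd i F) (a - 1)

/-- `F = O₂(r^a)`: derivatives up to order two decay, each one order faster. -/
def IsBigOPow₂ (F : Pt 3 → ℝ) (a : ℝ) : Prop :=
  IsBigOPow F a ∧ (∀ i, IsBigOPow (pd i F) (a - 1)) ∧
    ∀ i j, IsBigOPow (pd i (pd j F)) (a - 2)

/-- The exterior region `{x ∈ ℝ³ : |x| > R}`. -/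
def exterior (R : ℝ) : Set (Pt 3) := {x | R < ‖x‖}

/-- `(g, k)` is an asymptotically flat initial data set on the end `{|x| > R}`, and the
coordinates `x` are asymptotically flat coordinates: `g` is a smooth Riemannian metric,
`k` is a smooth symmetric `(0,2)`-tensor, and for some `q > 1/2`, `p > 3/2`, `ε > 0`
`gᵢⱼ - δᵢⱼ = O₂(r^{-q})`, `kᵢⱼ = O₁(r^{-p})`, `μ = O(r^{-3-ε})`, `|J| = O(r^{-3-ε})`. -/
structure IsAsymptoticallyFlatEnd (R : ℝ) (g k : TensorField 3) : Prop where
  smooth_g : ∀ i j, ContDiffOn ℝ ∞ (fun x => g x i j) (exterior R)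
  smooth_k : ∀ i j, ContDiffOn ℝ ∞ (fun x => k x i j) (exterior R)
  posDef_g : ∀ x ∈ exterior R, (g x).PosDef
  symm_k : ∀ x ∈ exterior R, (k x).IsSymm
  decay : ∃ q p ε : ℝ, 1 / 2 < q ∧ 3 / 2 < p ∧ 0 < ε ∧
    (∀ i j, IsBigOPow₂ (fun x => g x i j - (1 : Matrix (Fin 3) (Fin 3) ℝ) i j) (-q)) ∧
    (∀ i j, IsBigOPow₁ (fun x => k x i j) (-p)) ∧
    IsBigOPow (massDensity g k) (-3 - ε) ∧
    IsBigOPow (currentNorm g k) (-3 - ε)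

/-! ### Total conserved quantities as limits of integrals over coordinate spheres -/

/-- `∫_{|x| = r} F dσ₀`, where `dσ₀` is the area measure of the round sphere of radius `r`
(`r²` times the area measure of the unit sphere). -/
def sphereIntegral (F : Pt 3 → ℝ) (r : ℝ) : ℝ :=
  r ^ 2 * ∫ u : Metric.sphere (0 : Pt 3) 1, F (r • (u : Pt 3))
    ∂(volume : Measure (Pt 3)).toSphere

/-- `lim_{r → ∞} ∫_{|x| = r} F dσ₀ = L`; the integrals exist for large `r`, the limit exists
and is finite. -/
def HasSphereLimit (F : Pt 3 → ℝ) (L : ℝ) : Prop :=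
  (∀ᶠ r : ℝ in atTop, Integrable
    (fun u : Metric.sphere (0 : Pt 3) 1 => F (r • (u : Pt 3)))
    (volume : Measure (Pt 3)).toSphere) ∧
  Tendsto (sphereIntegral F) atTop (𝓝 L)

/-- The ADM energy exists and
`E = (1/16π) lim ∫_{|x|=r} ∑ⱼₖ (∂ₖ gⱼₖ - ∂ⱼ gₖₖ) xʲ/|x| dσ₀`. -/
def HasADMEnergy (g : TensorField 3) (E : ℝ) : Prop :=
  HasSphereLimit
    (fun x => ∑ j, ∑ k, (pd k (fun y => g y j k) x - pd j (fun y => g y k k) x) * (x j / ‖x‖))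
    (16 * Real.pi * E)

/-- The `i`-th component of the ADM linear momentum exists and
`Pᵢ = (1/8π) lim ∫_{|x|=r} ∑ₖ πᵢₖ xᵏ/|x| dσ₀`. -/
def HasADMMomentum (g k : TensorField 3) (i : Fin 3) (P : ℝ) : Prop :=
  HasSphereLimit (fun x => ∑ l, conjMomentum g k x i l * (x l / ‖x‖)) (8 * Real.pi * P)

/-- The `i`-th component of the (Beig–Ó Murchadha–Regge–Teitelboim) center of mass integral
exists and
`Cⁱ = (1/16π) lim ∫_{|x|=r} [xⁱ ∑ⱼₖ (∂ₖ gⱼₖ - ∂ⱼ gₖₖ) xʲ/|x|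
  - ∑ₖ ((gₖᵢ - δₖᵢ) xᵏ/|x| - (gₖₖ - δₖₖ) xⁱ/|x|)] dσ₀`. -/
def HasCenterOfMass (g : TensorField 3) (i : Fin 3) (C : ℝ) : Prop :=
  HasSphereLimit
    (fun x =>
      x i * (∑ j, ∑ k, (pd k (fun y => g y j k) x - pd j (fun y => g y k k) x) * (x j / ‖x‖))
      - ∑ k, ((g x k i - (1 : Matrix (Fin 3) (Fin 3) ℝ) k i) * (x k / ‖x‖)
          - (g x k k - (1 : Matrix (Fin 3) (Fin 3) ℝ) k k) * (x i / ‖x‖)))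
    (16 * Real.pi * C)

/-- The ADM angular momentum with respect to the vector field `Y` exists (is finite) and
`J(Y) = (1/8π) lim ∫_{|x|=r} ∑ⱼₖ πⱼₖ Yʲ xᵏ/|x| dσ₀`. -/
def HasAngularMomentum (g k : TensorField 3) (Y : Pt 3 → Fin 3 → ℝ) (J : ℝ) : Prop :=
  HasSphereLimit (fun x => ∑ j, ∑ l, conjMomentum g k x j l * Y x j * (x l / ‖x‖))
    (8 * Real.pi * J)

/-- The rotation vector field `∂/∂xⁱ × x`. -/
def rotationField (i : Fin 3) (x : Pt 3) : Fin 3 → ℝ :=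
  crossProduct (Pi.single i 1) (fun j => x j)

/-! ### Graphs in the Schwarzschild spacetime

Spacetime points are `(t, x¹, x², x³)`, with time coordinate at index `0`; the spatial
coordinates `xⁱ = r x̃ⁱ` are the Cartesian coordinates of the spherical coordinates `(r, uᵃ)`. -/

/-- The spatial coordinates of a spacetime point. -/
def spatial (p : Pt 4) : Pt 3 := WithLp.toLp 2 fun i => p i.succ

/-- The Schwarzschild metric
`ds² = -(1 - 2m/r) dt² + (1 - 2m/r)⁻¹ dr² + r² σ̃`, where `dr = ∑ᵢ (xⁱ/r) dxⁱ` and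
`r² σ̃ = ∑ᵢ (dxⁱ)² - dr²`. -/
def schwarzschild (m : ℝ) : TensorField 4 := fun p =>
  let r : ℝ := ‖spatial p‖
  let dt : Fin 4 → ℝ := Pi.single 0 1
  let dr : Fin 4 → ℝ := Fin.cons 0 fun i => spatial p i / r
  let euclid : Matrix (Fin 4) (Fin 4) ℝ := Matrix.diagonal (Fin.cons 0 fun _ => 1);
  (-(1 - 2 * m / r)) • Matrix.vecMulVec dt dt
    + (1 - 2 * m / r)⁻¹ • Matrix.vecMulVec dr dr
    + (euclid - Matrix.vecMulVec dr dr)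

/-- The parametrization `x ↦ (f(x), x)` of the graph `t = f(x)`. -/
def graphMap (f : Pt 3 → ℝ) (x : Pt 3) : Pt 4 :=
  WithLp.toLp 2 (Fin.cons (f x) fun i => x i)

/-- The tangent vector `eᵢ = ∂ᵢ + (∂ᵢ f) ∂ₜ` of the graph. -/
def graphTangent (f : Pt 3 → ℝ) (i : Fin 3) (x : Pt 3) : Fin 4 → ℝ :=
  fun α => pd i (fun y => graphMap f y α) x

/-- The metric that a spacetime metric `G` induces on the graph of `f`. -/
def inducedMetric (G : TensorField 4) (f : Pt 3 → ℝ) : TensorField 3 := fun x =>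
  Matrix.of fun i j => graphTangent f i x ⬝ᵥ (G (graphMap f x) *ᵥ graphTangent f j x)

/-- The differential of the function `t - f(x)`, which vanishes on the graph. -/
def graphConormal (f : Pt 3 → ℝ) (x : Pt 3) : Fin 4 → ℝ :=
  Fin.cons 1 fun i => -pd i f x

/-- The future-directed timelike unit normal
`ν = -grad (t - f) / √(-⟨grad (t - f), grad (t - f)⟩)` of a spacelike graph. -/
def unitNormal (G : TensorField 4) (f : Pt 3 → ℝ) (x : Pt 3) : Fin 4 → ℝ :=
  let grad : Fin 4 → ℝ := (G (graphMap f x))⁻¹ *ᵥ graphConormal f x;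
  (-(√(-(graphConormal f x ⬝ᵥ grad)))⁻¹) • grad

/-- The spacetime vector `∇_{eᵢ} eⱼ`, with the Levi-Civita connection of `G`. -/
def graphAccel (G : TensorField 4) (f : Pt 3 → ℝ) (i j : Fin 3) (x : Pt 3) : Fin 4 → ℝ :=
  fun α => pd i (fun y => graphTangent f j y α) x
    + ∑ β, ∑ γ, christoffel G α β γ (graphMap f x) *
        graphTangent f i x β * graphTangent f j x γ

/-- The second fundamental form `kᵢⱼ = -⟨ν, ∇_{eᵢ} eⱼ⟩` of the graph of `f`. -/
def secondFundamentalForm (G : TensorField 4) (f : Pt 3 → ℝ) : TensorField 3 := fun x =>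
  Matrix.of fun i j => -(unitNormal G f x ⬝ᵥ (G (graphMap f x) *ᵥ graphAccel G f i j x))

/-- The metric induced on the graph `t = f` in the Schwarzschild spacetime of mass `m`. -/
def schwMetric (m : ℝ) (f : Pt 3 → ℝ) : TensorField 3 := inducedMetric (schwarzschild m) f

/-- The second fundamental form of the graph `t = f` in the Schwarzschild spacetime of
mass `m`. -/
def schwSFF (m : ℝ) (f : Pt 3 → ℝ) : TensorField 3 := secondFundamentalForm (schwarzschild m) f

/-- The graph `t = f(x)`, `|x| > R`, in the Schwarzschild spacetime of mass `m` is spacelike: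
the induced metric is positive definite. -/
def IsSpacelikeGraph (m : ℝ) (f : Pt 3 → ℝ) (R : ℝ) : Prop :=
  ∀ x ∈ exterior R, (schwMetric m f x).PosDef

/-- The function `f = r^{1/3} x̃¹ (x̃²)³`, where `x̃ⁱ = xⁱ / r`. The coordinates `x¹, x², x³`
are `x 0, x 1, x 2`. -/
def profile (x : Pt 3) : ℝ :=
  ‖x‖ ^ (1 / 3 : ℝ) * ((x 0 / ‖x‖) * (x 1 / ‖x‖) ^ 3)

end SchwarzschildGraph

end

/-! The estimates use only that f is smooth and homogeneous of degree 1/3 away from the origin, and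
for P and C also that f is even. They therefore apply to λf as well as to f. Write V = 1 - 2m/r.

Decay: the graph adds -V df⊗df to the metric, so g = δ + 2m xᵢxⱼ/r³ + O(r^{-4/3}), and k = ∂²f +
O(r^{-8/3}) with ∂²f = O(r^{-5/3}). Terms quadratic in k have size r^{-10/3}, which μ tolerates. The
1/r part of g is scalar flat to first order (`sum_pd_schwLeadChristoffel`), and div - d tr
annihilates a Euclidean Hessian, so μ and J decay fast enough. The 1/r part alone produces E = m.
For even f both g and k are even in x, so the integrands of P and C are odd and integrate to zero on
each large sphere.

Angular momentum: size alone would allow growth like r^{4/3}. The exact formula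
`sum_conjMomentum_rotationField` shows that the density is a multiple of Yf and that its part linear
in f is a radial function times Yf. That part has integral zero on every sphere, because rotations
preserve area (`integral_rotationField_deriv`). The next part is cubic, Yf (f Δf - |df|²)/(3r); the
exponent 1/3 is the one that makes it homogeneous of degree -2, so its sphere integral does not
depend on r. The remainder is O(r^{-3}). Hence J(Y) is 1/8π times an integral over the unit sphere
(`hasAngularMomentum_rotationField`).

For the given profile and the third axis this integrand is a polynomial on the sphere, and its
moments follow from recursions that again express invariance under rotations
(`integral_cubicDensity_profile`). Being cubic in f, the angular momentum scales like λ³ while E = m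
stays fixed. -/

namespace SchwarzschildGraph

open Bornology

/-! ### Partial derivatives -/

section PartialDerivatives

variable {n : ℕ} {i : Fin n} {F G : Pt n → ℝ} {x : Pt n}

theorem pd_congr (h : F =ᶠ[𝓝 x] G) : pd i F x = pd i G x := by
  simp only [pd, h.fderiv_eq]

theorem pd_const (c : ℝ) : pd i (fun _ => c) x = 0 := by
  simp [pd]

theorem pd_add (hF : DifferentiableAt ℝ F x) (hG : DifferentiableAt ℝ G x) :
    pd i (fun y => F y + G y) x = pd i F x + pd i G x := by
  simp [pd, fderiv_fun_add hF hG]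

theorem pd_sub (hF : DifferentiableAt ℝ F x) (hG : DifferentiableAt ℝ G x) :
    pd i (fun y => F y - G y) x = pd i F x - pd i G x := by
  simp [pd, fderiv_fun_sub hF hG]

theorem pd_neg : pd i (fun y => -F y) x = -pd i F x := by
  simp [pd, fderiv_fun_neg]

theorem pd_sub_const (c : ℝ) : pd i (fun y => F y - c) x = pd i F x := by
  simp [pd, fderiv_sub_const]

theorem pd_const_add (c : ℝ) : pd i (fun y => c + F y) x = pd i F x := by
  simp [pd, fderiv_const_add]

theorem pd_const_mul (c : ℝ) : pd i (fun y => c * F y) x = c * pd i F x := by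
  have h : fderiv ℝ (fun y => c * F y) = c • fderiv ℝ F :=
    fderiv_const_smul_field (𝕜 := ℝ) (f := F) c
  simp [pd, h]

theorem pd_mul (hF : DifferentiableAt ℝ F x) (hG : DifferentiableAt ℝ G x) :
    pd i (fun y => F y * G y) x = F x * pd i G x + G x * pd i F x := by
  simp [pd, fderiv_fun_mul hF hG]

theorem pd_sum {ι : Type*} {s : Finset ι} {F : ι → Pt n → ℝ}
    (hF : ∀ l ∈ s, DifferentiableAt ℝ (F l) x) :
    pd i (fun y => ∑ l ∈ s, F l y) x = ∑ l ∈ s, pd i (F l) x := by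
  simp [pd, fderiv_fun_sum hF]

theorem pd_coord (j : Fin n) : pd i (fun y : Pt n => y j) x = if j = i then 1 else 0 := by
  have h : (fun y : Pt n => y j) = EuclideanSpace.proj (𝕜 := ℝ) j := rfl
  rw [pd, h, ContinuousLinearMap.fderiv]
  simp

theorem pd_comp {φ : ℝ → ℝ} {φ' : ℝ} (hφ : HasDerivAt φ φ' (F x))
    (hF : DifferentiableAt ℝ F x) : pd i (fun y => φ (F y)) x = φ' * pd i F x := by
  have := (hφ.comp_hasFDerivAt x hF.hasFDerivAt).fderiv
  rw [pd, show (fun y => φ (F y)) = φ ∘ F from rfl, this]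
  simp [pd]

theorem fderiv_eq_sum_pd (v : Pt n) : fderiv ℝ F x v = ∑ j, v j * pd j F x := by
  have hv : v = ∑ j, v j • EuclideanSpace.single j (1 : ℝ) := by
    ext k
    simp [Pi.single_apply]
  conv_lhs => rw [hv]
  simp [pd]

theorem pd_comm (hF : ContDiffAt ℝ 2 F x) (i j : Fin n) :
    pd i (pd j F) x = pd j (pd i F) x := by
  have key : ∀ a b : Fin n, pd a (pd b F) x =
      fderiv ℝ (fderiv ℝ F) x (EuclideanSpace.single a 1) (EuclideanSpace.single b 1) := by
    intro a b
    have hd : DifferentiableAt ℝ (fderiv ℝ F) x :=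
      (hF.fderiv_right (m := 1) (by norm_num)).differentiableAt (by norm_num)
    have := fderiv_clm_apply (𝕜 := ℝ) hd
      (differentiableAt_const (EuclideanSpace.single b (1 : ℝ)))
    change fderiv ℝ (fun y => fderiv ℝ F y (EuclideanSpace.single b 1)) x _ = _
    rw [this]
    simp
  rw [key, key]
  exact (hF.isSymmSndFDerivAt (by simp)).eq _ _

theorem pd_of_even (hF : ∀ y, F (-y) = F y) (x : Pt n) : pd i F (-x) = -pd i F x := by
  have h := fderiv_comp_smul (𝕜 := ℝ) (f := F) (x := x) (-1)
  simp only [neg_smul, one_smul, hF] at h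
  simp only [pd]
  rw [h]
  simp

theorem _root_.ContDiffAt.pd (hF : ContDiffAt ℝ ∞ F x) (i : Fin n) :
    ContDiffAt ℝ ∞ (SchwarzschildGraph.pd i F) x :=
  (hF.fderiv_right (m := ∞) (by simp)).clm_apply contDiffAt_const

theorem _root_.ContDiffAt.differentiableAt_infty (hF : ContDiffAt ℝ ∞ F x) :
    DifferentiableAt ℝ F x :=
  hF.differentiableAt (by simp)

end PartialDerivatives

/-! ### The filter of neighbourhoods of infinity -/

theorem eventually_cobounded_iff {p : Pt 3 → Prop} :
    (∀ᶠ x in cobounded (Pt 3), p x) ↔ ∃ R, ∀ x ∈ exterior R, p x := by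
  rw [(Metric.hasBasis_cobounded_compl_closedBall (0 : Pt 3)).eventually_iff]
  simp [exterior]

theorem isOpen_exterior (R : ℝ) : IsOpen (exterior R) :=
  isOpen_lt continuous_const continuous_norm

theorem eventually_mem_exterior (R : ℝ) : ∀ᶠ x in cobounded (Pt 3), x ∈ exterior R :=
  eventually_cobounded_iff.2 ⟨R, fun _ h => h⟩

theorem eventually_cobounded_ne_zero : ∀ᶠ x in cobounded (Pt 3), x ≠ 0 := by
  filter_upwards [eventually_mem_exterior 0] with x hx
  exact norm_pos_iff.1 hx

/-- Exterior regions are open. This is what permits differentiating identities that hold only near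
infinity. -/
theorem eventually_cobounded_nhds {p : Pt 3 → Prop} (h : ∀ᶠ x in cobounded (Pt 3), p x) :
    ∀ᶠ x in cobounded (Pt 3), ∀ᶠ y in 𝓝 x, p y := by
  obtain ⟨R, hR⟩ := eventually_cobounded_iff.1 h
  refine eventually_cobounded_iff.2 ⟨R, fun x hx => ?_⟩
  filter_upwards [(isOpen_exterior R).mem_nhds hx] with y hy using hR y hy

theorem pd_eventuallyEq {F G : Pt 3 → ℝ} (h : F =ᶠ[cobounded (Pt 3)] G) (i : Fin 3) :
    pd i F =ᶠ[cobounded (Pt 3)] pd i G := by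
  filter_upwards [eventually_cobounded_nhds h] with x hx using pd_congr hx

/-! ### Order bounds -/

theorem IsBigOPow.congr {F G : Pt 3 → ℝ} {a : ℝ} (hF : IsBigOPow F a)
    (h : F =ᶠ[cobounded (Pt 3)] G) : IsBigOPow G a :=
  IsBigO.congr' hF h EventuallyEq.rfl

theorem IsBigOPow.mono {F : Pt 3 → ℝ} {a b : ℝ} (hF : IsBigOPow F a) (hab : a ≤ b) :
    IsBigOPow F b := by
  refine IsBigO.trans hF (IsBigO.of_bound 1 ?_)
  filter_upwards [eventually_mem_exterior 1] with x hx
  have hx : 1 < ‖x‖ := hx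
  rw [Real.norm_of_nonneg (by positivity), Real.norm_of_nonneg (by positivity), one_mul]
  exact Real.rpow_le_rpow_of_exponent_le hx.le hab

theorem IsBigOPow.add {F G : Pt 3 → ℝ} {a : ℝ} (hF : IsBigOPow F a) (hG : IsBigOPow G a) :
    IsBigOPow (fun x => F x + G x) a :=
  IsBigO.add hF hG

theorem IsBigOPow.mul {F G : Pt 3 → ℝ} {a b : ℝ} (hF : IsBigOPow F a) (hG : IsBigOPow G b) :
    IsBigOPow (fun x => F x * G x) (a + b) := by
  refine (IsBigO.mul hF hG).congr' EventuallyEq.rfl ?_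
  filter_upwards [eventually_mem_exterior 0] with x hx
  exact (Real.rpow_add hx a b).symm

theorem tendsto_norm_rpow_cobounded {a : ℝ} (ha : a < 0) :
    Tendsto (fun x : Pt 3 => ‖x‖ ^ a) (cobounded (Pt 3)) (𝓝 0) := by
  have := (tendsto_rpow_neg_atTop (y := -a) (by linarith)).comp
    (tendsto_norm_cobounded_atTop (E := Pt 3))
  simpa [Function.comp_def] using this

theorem IsBigOPow.tendsto_zero {F : Pt 3 → ℝ} {a : ℝ} (hF : IsBigOPow F a) (ha : a < 0) :
    Tendsto F (cobounded (Pt 3)) (𝓝 0) :=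
  IsBigO.trans_tendsto hF (tendsto_norm_rpow_cobounded ha)

/-! ### Symbols: smooth functions whose derivatives gain powers of `r⁻¹` -/

/-- `F` is smooth near infinity. -/
def SmoothAtInfinity (F : Pt 3 → ℝ) : Prop :=
  ∀ᶠ x in cobounded (Pt 3), ContDiffAt ℝ ∞ F x

theorem SmoothAtInfinity.congr {F G : Pt 3 → ℝ} (hF : SmoothAtInfinity F)
    (h : F =ᶠ[cobounded (Pt 3)] G) : SmoothAtInfinity G := by
  filter_upwards [hF, eventually_cobounded_nhds h] with x hx hx'
  exact hx.congr_of_eventuallyEq (EventuallyEq.symm hx')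

theorem SmoothAtInfinity.pd {F : Pt 3 → ℝ} (hF : SmoothAtInfinity F) (i : Fin 3) :
    SmoothAtInfinity (pd i F) :=
  hF.mono fun _ h => h.pd i

theorem SmoothAtInfinity.add {F G : Pt 3 → ℝ} (hF : SmoothAtInfinity F)
    (hG : SmoothAtInfinity G) : SmoothAtInfinity (fun x => F x + G x) := by
  filter_upwards [hF, hG] with x h h' using h.add h'

theorem SmoothAtInfinity.mul {F G : Pt 3 → ℝ} (hF : SmoothAtInfinity F)
    (hG : SmoothAtInfinity G) : SmoothAtInfinity (fun x => F x * G x) := by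
  filter_upwards [hF, hG] with x h h' using h.mul h'

/-- `F = O_n(r^a)`. -/
def SymbolBound : ℕ → ℝ → (Pt 3 → ℝ) → Prop
  | 0, a, F => IsBigOPow F a
  | n + 1, a, F => IsBigOPow F a ∧ ∀ i, SymbolBound n (a - 1) (pd i F)

namespace SymbolBound

variable {n : ℕ} {a b : ℝ} {F G : Pt 3 → ℝ}

theorem of_succ (h : SymbolBound (n + 1) a F) : SymbolBound n a F := by
  induction n generalizing a F with
  | zero => exact h.1
  | succ n ih => exact ⟨h.1, fun i => ih (h.2 i)⟩

theorem mono (h : SymbolBound n a F) (hab : a ≤ b) : SymbolBound n b F := by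
  induction n generalizing a b F with
  | zero => exact IsBigOPow.mono h hab
  | succ n ih => exact ⟨h.1.mono hab, fun i => ih (h.2 i) (by linarith)⟩

theorem congr (h : SymbolBound n a F) (hFG : F =ᶠ[cobounded (Pt 3)] G) :
    SymbolBound n a G := by
  induction n generalizing a F G with
  | zero => exact IsBigOPow.congr h hFG
  | succ n ih => exact ⟨h.1.congr hFG, fun i => ih (h.2 i) (pd_eventuallyEq hFG i)⟩

theorem add (hF : SymbolBound n a F) (hG : SymbolBound n a G)
    (sF : SmoothAtInfinity F) (sG : SmoothAtInfinity G) :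
    SymbolBound n a (fun x => F x + G x) := by
  induction n generalizing a F G with
  | zero => exact IsBigOPow.add hF hG
  | succ n ih =>
    refine ⟨hF.1.add hG.1, fun i => (ih (hF.2 i) (hG.2 i) (sF.pd i) (sG.pd i)).congr ?_⟩
    filter_upwards [sF, sG] with x h h'
    exact (pd_add h.differentiableAt_infty h'.differentiableAt_infty).symm

theorem mul (hF : SymbolBound n a F) (hG : SymbolBound n b G)
    (sF : SmoothAtInfinity F) (sG : SmoothAtInfinity G) :
    SymbolBound n (a + b) (fun x => F x * G x) := by
  induction n generalizing a b F G with
  | zero => exact IsBigOPow.mul hF hG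
  | succ n ih =>
    refine ⟨hF.1.mul hG.1, fun i => ?_⟩
    -- In each term of the product rule one factor stays undifferentiated and is needed only to
    -- order n.
    have h₁ := ih hF.of_succ (hG.2 i) sF (sG.pd i)
    have h₂ := ih hG.of_succ (hF.2 i) sG (sF.pd i)
    have h := add (h₁.mono (b := a + b - 1) (by linarith)) (h₂.mono (by linarith))
      (sF.mul (sG.pd i)) (sG.mul (sF.pd i))
    refine h.congr ?_
    filter_upwards [sF, sG] with x h h'
    exact (pd_mul h.differentiableAt_infty h'.differentiableAt_infty).symm

end SymbolBound

/-- `F` is smooth near infinity, and each derivative of `F = O(r^a)` gains a power of `r⁻¹`. -/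
structure IsSymbol (a : ℝ) (F : Pt 3 → ℝ) : Prop where
  smooth : SmoothAtInfinity F
  bound : ∀ n, SymbolBound n a F

namespace IsSymbol

variable {a b : ℝ} {F G : Pt 3 → ℝ}

theorem isBigOPow (h : IsSymbol a F) : IsBigOPow F a := h.bound 0

theorem pd (h : IsSymbol a F) (i : Fin 3) : IsSymbol (a - 1) (pd i F) :=
  ⟨h.smooth.pd i, fun n => (h.bound (n + 1)).2 i⟩

theorem of_pd (hs : SmoothAtInfinity F) (hF : IsBigOPow F a)
    (h : ∀ i, IsSymbol (a - 1) (SchwarzschildGraph.pd i F)) : IsSymbol a F :=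
  ⟨hs, fun n => n.casesOn hF fun n => ⟨hF, fun i => (h i).bound n⟩⟩

theorem isBigOPow₁ (h : IsSymbol a F) : IsBigOPow₁ F a :=
  ⟨h.isBigOPow, fun i => (h.pd i).isBigOPow⟩

theorem isBigOPow₂ (h : IsSymbol a F) : IsBigOPow₂ F a := by
  refine ⟨h.isBigOPow, fun i => (h.pd i).isBigOPow, fun i j => ?_⟩
  have := ((h.pd j).pd i).isBigOPow
  rwa [sub_sub, one_add_one_eq_two] at this

theorem mono (h : IsSymbol a F) (hab : a ≤ b) : IsSymbol b F :=
  ⟨h.smooth, fun n => (h.bound n).mono hab⟩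

theorem congr (h : IsSymbol a F) (hFG : F =ᶠ[cobounded (Pt 3)] G) : IsSymbol a G :=
  ⟨h.smooth.congr hFG, fun n => (h.bound n).congr hFG⟩

theorem add (hF : IsSymbol a F) (hG : IsSymbol a G) : IsSymbol a (fun x => F x + G x) :=
  ⟨hF.smooth.add hG.smooth, fun n => (hF.bound n).add (hG.bound n) hF.smooth hG.smooth⟩

theorem mul (hF : IsSymbol a F) (hG : IsSymbol b G) : IsSymbol (a + b) (fun x => F x * G x) :=
  ⟨hF.smooth.mul hG.smooth, fun n => (hF.bound n).mul (hG.bound n) hF.smooth hG.smooth⟩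

theorem zero : IsSymbol a (fun _ => 0) := by
  refine ⟨Eventually.of_forall fun _ => contDiffAt_const, fun n => ?_⟩
  induction n generalizing a with
  | zero => exact isBigO_zero _ _
  | succ n ih =>
    refine ⟨isBigO_zero _ _, fun i => ?_⟩
    have : SchwarzschildGraph.pd i (fun _ : Pt 3 => (0 : ℝ)) = fun _ => 0 :=
      funext fun _ => pd_const 0
    rw [this]
    exact ih

theorem const (c : ℝ) : IsSymbol 0 (fun _ => c) := by
  refine of_pd (Eventually.of_forall fun _ => contDiffAt_const) ?_ fun i => ?_
  · simpa [IsBigOPow] using isBigO_const_const c (one_ne_zero (α := ℝ)) (cobounded (Pt 3))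
  · have : SchwarzschildGraph.pd i (fun _ : Pt 3 => c) = fun _ => 0 := funext fun _ => pd_const c
    exact this ▸ zero

theorem const_mul (c : ℝ) (hF : IsSymbol a F) : IsSymbol a (fun x => c * F x) := by
  simpa using (const c).mul hF

theorem neg (hF : IsSymbol a F) : IsSymbol a (fun x => -F x) := by
  simpa using hF.const_mul (-1)

theorem sub (hF : IsSymbol a F) (hG : IsSymbol a G) : IsSymbol a (fun x => F x - G x) := by
  simpa [sub_eq_add_neg] using hF.add hG.neg

theorem sum {ι : Type*} {s : Finset ι} {F : ι → Pt 3 → ℝ} (h : ∀ l ∈ s, IsSymbol a (F l)) :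
    IsSymbol a (fun x => ∑ l ∈ s, F l x) := by
  classical
  induction s using Finset.induction_on with
  | empty => simpa using zero
  | insert l s hl ih =>
    simp only [Finset.sum_insert hl]
    exact (h l (by simp)).add (ih fun l' hl' => h l' (by simp [hl']))

end IsSymbol

/-- Near infinity, `F = c + O(r^{-q})` in the sense of symbols. -/
def IsNear (q : ℝ) (F : Pt 3 → ℝ) (c : ℝ) : Prop :=
  IsSymbol (-q) (fun x => F x - c)

namespace IsNear

variable {q c d : ℝ} {F G : Pt 3 → ℝ}

theorem isSymbol (h : IsNear q F c) (hq : 0 ≤ q) : IsSymbol 0 F := by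
  simpa using (IsSymbol.mono h (neg_nonpos.2 hq)).add (IsSymbol.const c)

theorem const (q c : ℝ) : IsNear q (fun _ => c) c := by
  simpa [IsNear] using IsSymbol.zero

theorem add (hF : IsNear q F c) (hG : IsNear q G d) : IsNear q (fun x => F x + G x) (c + d) := by
  refine (IsSymbol.add hF hG).congr (Eventually.of_forall fun x => ?_)
  simp only
  ring

theorem mul (hq : 0 ≤ q) (hF : IsNear q F c) (hG : IsNear q G d) :
    IsNear q (fun x => F x * G x) (c * d) := by
  have h := (IsSymbol.mul (hF.isSymbol hq) hG).add (by simpa using IsSymbol.const_mul d hF)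
  rw [zero_add] at h
  refine h.congr (Eventually.of_forall fun x => ?_)
  simp only
  ring

theorem sum {ι : Type*} {s : Finset ι} {F : ι → Pt 3 → ℝ} {c : ι → ℝ}
    (h : ∀ l ∈ s, IsNear q (F l) (c l)) :
    IsNear q (fun x => ∑ l ∈ s, F l x) (∑ l ∈ s, c l) := by
  refine (IsSymbol.sum (F := fun l x => F l x - c l) h).congr (Eventually.of_forall fun x => ?_)
  simp

theorem prod (hq : 0 ≤ q) {ι : Type*} {s : Finset ι} {F : ι → Pt 3 → ℝ} {c : ι → ℝ}
    (h : ∀ l ∈ s, IsNear q (F l) (c l)) :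
    IsNear q (fun x => ∏ l ∈ s, F l x) (∏ l ∈ s, c l) := by
  classical
  induction s using Finset.induction_on with
  | empty => simpa using const q 1
  | insert l s hl ih =>
    simp only [Finset.prod_insert hl]
    exact (h l (by simp)).mul hq (ih fun l' hl' => h l' (by simp [hl']))

theorem tendsto (h : IsNear q F c) (hq : 0 < q) : Tendsto F (cobounded (Pt 3)) (𝓝 c) := by
  simpa using ((IsSymbol.isBigOPow h).tendsto_zero (by linarith)).add_const c

/-- The derivative s F^(s-1) ∂F is again a power of F times a symbol, so all powers are bounded
simultaneously, order by order. The rate q then comes from F^s - 1 = O(F - 1) and from ∂F. -/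
theorem rpow (hF : IsNear q F 1) (hq : 0 < q) (s : ℝ) : IsNear q (fun x => F x ^ s) 1 := by
  have hpos : ∀ᶠ x in cobounded (Pt 3), 0 < F x :=
    (hF.tendsto hq).eventually (lt_mem_nhds one_pos)
  have hsF : SmoothAtInfinity F := (hF.isSymbol hq.le).smooth
  have hsm : ∀ s : ℝ, SmoothAtInfinity (fun x => F x ^ s) := by
    intro s
    filter_upwards [hpos, hsF] with x hx hx'
    exact hx'.rpow_const_of_ne hx.ne'
  have hder : ∀ (s : ℝ) (i : Fin 3), (fun x => s * F x ^ (s - 1) * pd i F x)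
      =ᶠ[cobounded (Pt 3)] pd i (fun x => F x ^ s) := by
    intro s i
    filter_upwards [hpos, hsF] with x hx hx'
    exact (pd_comp (Real.hasDerivAt_rpow_const (Or.inl hx.ne')) hx'.differentiableAt_infty).symm
  have hdF : ∀ i, IsSymbol (-q - 1) (pd i F) := by
    intro i
    refine (IsSymbol.pd hF i).congr (Eventually.of_forall fun x => pd_sub_const 1)
  -- The exponent is quantified inside the induction on n because each derivative lowers it by one.
  have hbound : ∀ (n : ℕ) (s : ℝ), SymbolBound n 0 (fun x => F x ^ s) := by
    have h0 : ∀ s : ℝ, IsBigOPow (fun x => F x ^ s) 0 := by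
      intro s
      have : Tendsto (fun x => F x ^ s) (cobounded (Pt 3)) (𝓝 (1 ^ s)) :=
        (hF.tendsto hq).rpow_const (Or.inl one_ne_zero)
      simpa [IsBigOPow] using this.isBigO_one ℝ
    intro n
    induction n with
    | zero => exact h0
    | succ n ih =>
      intro s
      refine ⟨h0 s, fun i => ?_⟩
      have h := (SymbolBound.mul (ih (s - 1)) ((hdF i).bound n) (hsm _) (hdF i).smooth)
      have h' := SymbolBound.mul ((IsSymbol.const s).bound n) h (IsSymbol.const s).smooth
        ((hsm _).mul (hdF i).smooth)
      refine (h'.mono (by linarith)).congr (EventuallyEq.trans (Eventually.of_forall ?_) (hder s i))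
      intro x
      simp only
      ring
  have hsym : ∀ s : ℝ, IsSymbol 0 (fun x => F x ^ s) := fun s => ⟨hsm s, fun n => hbound n s⟩
  refine IsSymbol.of_pd ?_ ?_ fun i => ?_
  · filter_upwards [hsm s] with x hx using hx.sub contDiffAt_const
  · have h1 : (fun y : ℝ => y ^ s - 1) =O[𝓝 1] fun y => y - 1 := by
      have := (Real.hasDerivAt_rpow_const (x := 1) (p := s)
        (Or.inl one_ne_zero)).differentiableAt.isBigO_sub
      simpa using this
    exact (h1.comp_tendsto (hF.tendsto hq)).trans hF.isBigOPow
  · have h := ((hsym (s - 1)).mul (hdF i)).const_mul s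
    rw [zero_add] at h
    refine h.congr ?_
    filter_upwards [hder s i] with x hx
    rw [pd_sub_const, ← hx]
    ring

theorem inv (hF : IsNear q F 1) (hq : 0 < q) : IsNear q (fun x => (F x)⁻¹) 1 := by
  simpa [Real.rpow_neg_one] using hF.rpow hq (-1)

end IsNear

/-! ### Homogeneous functions -/

/-- `F` is smooth and homogeneous of degree `a` away from the origin. -/
structure IsHomogeneous (a : ℝ) (F : Pt 3 → ℝ) : Prop where
  smooth : ContDiffOn ℝ ∞ F {0}ᶜ
  scale : ∀ t : ℝ, 0 < t → ∀ x : Pt 3, x ≠ 0 → F (t • x) = t ^ a * F x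

namespace IsHomogeneous

variable {a b : ℝ} {F G : Pt 3 → ℝ}

theorem contDiffAt (hF : IsHomogeneous a F) {x : Pt 3} (hx : x ≠ 0) : ContDiffAt ℝ ∞ F x :=
  hF.smooth.contDiffAt (isOpen_compl_singleton.mem_nhds hx)

theorem differentiableAt (hF : IsHomogeneous a F) {x : Pt 3} (hx : x ≠ 0) :
    DifferentiableAt ℝ F x :=
  (hF.contDiffAt hx).differentiableAt_infty

theorem congr (hF : IsHomogeneous a F) (h : ∀ x : Pt 3, x ≠ 0 → F x = G x) :
    IsHomogeneous a G where
  smooth := hF.smooth.congr fun x hx => (h x hx).symm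
  scale t ht x hx := by rw [← h x hx, ← h _ (smul_ne_zero ht.ne' hx), hF.scale t ht x hx]

theorem add (hF : IsHomogeneous a F) (hG : IsHomogeneous a G) :
    IsHomogeneous a (fun x => F x + G x) where
  smooth := hF.smooth.add hG.smooth
  scale t ht x hx := by rw [hF.scale t ht x hx, hG.scale t ht x hx]; ring

theorem mul (hF : IsHomogeneous a F) (hG : IsHomogeneous b G) :
    IsHomogeneous (a + b) (fun x => F x * G x) where
  smooth := hF.smooth.mul hG.smooth
  scale t ht x hx := by
    rw [hF.scale t ht x hx, hG.scale t ht x hx, Real.rpow_add ht]; ring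

theorem const (c : ℝ) : IsHomogeneous 0 (fun _ => c) where
  smooth := contDiffOn_const
  scale t ht x hx := by simp

theorem const_mul (c : ℝ) (hF : IsHomogeneous a F) : IsHomogeneous a (fun x => c * F x) := by
  simpa using (const c).mul hF

theorem sum {ι : Type*} {s : Finset ι} {F : ι → Pt 3 → ℝ} (h : ∀ l ∈ s, IsHomogeneous a (F l)) :
    IsHomogeneous a (fun x => ∑ l ∈ s, F l x) where
  smooth := ContDiffOn.sum fun l hl => (h l hl).smooth
  scale t ht x hx := by
    rw [Finset.mul_sum]
    exact Finset.sum_congr rfl fun l hl => (h l hl).scale t ht x hx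

theorem coord (i : Fin 3) : IsHomogeneous 1 (fun x => x i) where
  smooth := by
    have : ContDiff ℝ ∞ fun x : Pt 3 => x i :=
      (EuclideanSpace.proj (𝕜 := ℝ) i).contDiff
    exact this.contDiffOn
  scale t ht x hx := by simp

theorem norm_rpow (b : ℝ) : IsHomogeneous b (fun x => ‖x‖ ^ b) where
  smooth := by
    intro x hx
    exact (((contDiffAt_norm ℝ hx).rpow_const_of_ne (norm_ne_zero_iff.2 hx))).contDiffWithinAt
  scale t ht x hx := by
    rw [norm_smul, Real.norm_of_nonneg ht.le, Real.mul_rpow ht.le (norm_nonneg x)]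

/-- Differentiate F(ty) = t^a F(y) in y. -/
theorem pd (hF : IsHomogeneous a F) (i : Fin 3) : IsHomogeneous (a - 1) (pd i F) where
  smooth x hx := ((hF.contDiffAt hx).pd i).contDiffWithinAt
  scale t ht x hx := by
    have h1 : (fun y : Pt 3 => F (t • y)) =ᶠ[𝓝 x] fun y => t ^ a * F y := by
      filter_upwards [isOpen_compl_singleton.mem_nhds hx] with y hy using hF.scale t ht y hy
    have h2 : SchwarzschildGraph.pd i (fun y : Pt 3 => F (t • y)) x
        = t * SchwarzschildGraph.pd i F (t • x) := by
      simp only [SchwarzschildGraph.pd]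
      rw [fderiv_comp_smul]
      simp
    rw [pd_congr h1, pd_const_mul] at h2
    rw [Real.rpow_sub ht, Real.rpow_one]
    field_simp
    linarith

/-- Differentiate F(tx) = t^a F(x) in t at t = 1. -/
theorem euler (hF : IsHomogeneous a F) {x : Pt 3} (hx : x ≠ 0) :
    ∑ j, x j * SchwarzschildGraph.pd j F x = a * F x := by
  rw [← fderiv_eq_sum_pd]
  have h1 : HasDerivAt (fun t : ℝ => F (t • x)) (fderiv ℝ F x x) 1 := by
    have hd : HasFDerivAt F (fderiv ℝ F x) ((1 : ℝ) • x) := by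
      simpa using (hF.differentiableAt hx).hasFDerivAt
    have := hd.comp_hasDerivAt (1 : ℝ) ((hasDerivAt_id (1 : ℝ)).smul_const x)
    simpa [Function.comp_def] using this
  have h2 : HasDerivAt (fun t : ℝ => t ^ a * F x) (a * F x) 1 := by
    simpa using (Real.hasDerivAt_rpow_const (x := 1) (p := a)
      (Or.inl one_ne_zero)).mul_const (F x)
  refine h1.unique (h2.congr_of_eventuallyEq ?_)
  filter_upwards [lt_mem_nhds (one_pos : (0 : ℝ) < 1)] with t ht using hF.scale t ht x hx

theorem isBigOPow (hF : IsHomogeneous a F) : IsBigOPow F a := by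
  have hc : ContinuousOn F (Metric.sphere 0 1) :=
    hF.smooth.continuousOn.mono fun x hx h => by simp [show x = 0 from h] at hx
  obtain ⟨C, hC⟩ := (isCompact_sphere (0 : Pt 3) 1).exists_bound_of_continuousOn hc
  refine IsBigO.of_bound C ?_
  filter_upwards [eventually_cobounded_ne_zero] with x hx
  have hpos : 0 < ‖x‖ := norm_pos_iff.2 hx
  have h := hF.scale ‖x‖ hpos (‖x‖⁻¹ • x) (smul_ne_zero (inv_ne_zero hpos.ne') hx)
  rw [smul_inv_smul₀ hpos.ne'] at h
  rw [h, norm_mul, mul_comm]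
  refine mul_le_mul_of_nonneg_right (hC _ ?_) (norm_nonneg _)
  simp [norm_smul, hpos.ne']

/-- A homogeneous function is bounded by its maximum on the compact unit sphere times r^a, and its
derivatives are homogeneous of one degree less. -/
theorem isSymbol (hF : IsHomogeneous a F) : IsSymbol a F := by
  refine ⟨?_, fun n => ?_⟩
  · filter_upwards [eventually_cobounded_ne_zero] with x hx using hF.contDiffAt hx
  · induction n generalizing a F with
    | zero => exact hF.isBigOPow
    | succ n ih => exact ⟨hF.isBigOPow, fun i => ih (hF.pd i)⟩

end IsHomogeneous

theorem sum_coord_sq (x : Pt 3) : ∑ j, x j ^ 2 = ‖x‖ ^ 2 :=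
  (EuclideanSpace.real_norm_sq_eq x).symm

theorem pd_norm_rpow (b : ℝ) (i : Fin 3) {x : Pt 3} (hx : x ≠ 0) :
    pd i (fun y => ‖y‖ ^ b) x = b * x i * ‖x‖ ^ (b - 2) := by
  have hpos : 0 < ‖x‖ := norm_pos_iff.2 hx
  have hr : ∀ y : Pt 3, ∑ j, y j * y j = ‖y‖ ^ (2 : ℝ) := by
    intro y
    rw [Real.rpow_two, ← sum_coord_sq]
    simp only [sq]
  -- As a power of the polynomial |y|², the function is accessible to the chain rule in coordinates.
  have h2 : (fun y : Pt 3 => ‖y‖ ^ b) = fun y => (∑ j, y j * y j) ^ (b / 2) := by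
    funext y
    rw [hr, ← Real.rpow_mul (norm_nonneg y)]
    congr 1
    ring
  have hc : ∀ j, DifferentiableAt ℝ (fun y : Pt 3 => y j) x := fun j =>
    (IsHomogeneous.coord j).differentiableAt hx
  have hcc : ∀ j, DifferentiableAt ℝ (fun y : Pt 3 => y j * y j) x := fun j => (hc j).mul (hc j)
  rw [h2, pd_comp (F := fun y : Pt 3 => ∑ j, y j * y j)
    (Real.hasDerivAt_rpow_const (Or.inl (by rw [hr]; positivity)))
    (DifferentiableAt.fun_sum fun j _ => hcc j),
    pd_sum (F := fun j (y : Pt 3) => y j * y j) fun j _ => hcc j]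
  simp only [pd_mul (hc _) (hc _), pd_coord, hr, ← Real.rpow_mul (norm_nonneg x)]
  simp only [mul_ite, mul_one, mul_zero]
  rw [Finset.sum_add_distrib]
  simp only [Finset.sum_ite_eq', Finset.mem_univ, if_true]
  rw [show 2 * (b / 2 - 1) = b - 2 by ring]
  ring

/-! ### Integration over the unit sphere -/

theorem integrable_sphere_of_continuousAt {F : Pt 3 → ℝ} {r : ℝ} (hr : 0 ≤ r)
    (hF : ∀ x : Pt 3, ‖x‖ = r → ContinuousAt F x) :
    Integrable (fun u : Metric.sphere (0 : Pt 3) 1 => F (r • (u : Pt 3)))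
      (volume : Measure (Pt 3)).toSphere := by
  have hc : Continuous fun u : Metric.sphere (0 : Pt 3) 1 => F (r • (u : Pt 3)) := by
    rw [continuous_iff_continuousAt]
    intro u
    refine ContinuousAt.comp (g := F) (hF _ ?_) (by fun_prop)
    simp [norm_smul, abs_of_nonneg hr]
  exact hc.integrable_of_hasCompactSupport (HasCompactSupport.of_compactSpace _)

theorem integrable_unitSphere {F : Pt 3 → ℝ} (hF : ContinuousOn F {0}ᶜ) :
    Integrable (fun u : Metric.sphere (0 : Pt 3) 1 => F u)
      (volume : Measure (Pt 3)).toSphere := by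
  have := integrable_sphere_of_continuousAt (F := F) (r := 1) zero_le_one fun x hx =>
    hF.continuousAt (isOpen_compl_singleton.mem_nhds fun h => by
      simp [show x = 0 from h] at hx)
  simpa using this

theorem unitSphere_ne_zero (u : Metric.sphere (0 : Pt 3) 1) : (u : Pt 3) ≠ 0 :=
  ne_zero_of_mem_unit_sphere u

/-- The action of a linear isometry on the unit sphere. -/
noncomputable def sphereMap (e : Pt 3 ≃ₗᵢ[ℝ] Pt 3) (u : Metric.sphere (0 : Pt 3) 1) :
    Metric.sphere (0 : Pt 3) 1 :=
  ⟨e u, by simp⟩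

-- The sphere measure of s is a multiple of the volume of the cone (0,1)·s, and a linear isometry
-- maps cones to cones and preserves volume.
open scoped Pointwise in
theorem measurePreserving_sphereMap (e : Pt 3 ≃ₗᵢ[ℝ] Pt 3) :
    MeasurePreserving (sphereMap e) (volume : Measure (Pt 3)).toSphere
      (volume : Measure (Pt 3)).toSphere := by
  have hc : Continuous (sphereMap e) :=
    (e.continuous.comp continuous_subtype_val).subtype_mk _
  refine ⟨hc.measurable, ?_⟩
  ext s hs
  rw [Measure.map_apply hc.measurable hs, Measure.toSphere_apply' _ (hc.measurable hs),
    Measure.toSphere_apply' _ hs]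
  congr 1
  have himg : Set.Ioo (0 : ℝ) 1 • ((↑) '' (sphereMap e ⁻¹' s) : Set (Pt 3))
      = e ⁻¹' (Set.Ioo (0 : ℝ) 1 • ((↑) '' s : Set (Pt 3))) := by
    ext x
    simp only [Set.mem_smul, Set.mem_image, Set.mem_preimage]
    constructor
    · rintro ⟨t, ht, _, ⟨u, hu, rfl⟩, rfl⟩
      exact ⟨t, ht, _, ⟨sphereMap e u, hu, rfl⟩, by simp [sphereMap]⟩
    · rintro ⟨t, ht, _, ⟨u, hu, rfl⟩, hx⟩
      refine ⟨t, ht, e.symm u, ⟨⟨e.symm u, by simp⟩, ?_, rfl⟩, ?_⟩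
      · simpa [sphereMap] using hu
      · rw [← map_smul, hx, e.symm_apply_apply]
  rw [himg]
  exact e.measurePreserving.measure_preimage_emb e.toHomeomorph.measurableEmbedding _

theorem integral_sphereMap (e : Pt 3 ≃ₗᵢ[ℝ] Pt 3) (F : Pt 3 → ℝ) :
    ∫ u : Metric.sphere (0 : Pt 3) 1, F (e u) ∂(volume : Measure (Pt 3)).toSphere
      = ∫ u : Metric.sphere (0 : Pt 3) 1, F u ∂(volume : Measure (Pt 3)).toSphere := by
  have hinv : Function.LeftInverse (sphereMap e.symm) (sphereMap e) := fun u =>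
    Subtype.ext (e.symm_apply_apply u)
  have hinv' : Function.RightInverse (sphereMap e.symm) (sphereMap e) := fun u =>
    Subtype.ext (e.apply_symm_apply u)
  have hc : ∀ e : Pt 3 ≃ₗᵢ[ℝ] Pt 3, Continuous (sphereMap e) := fun e =>
    (e.continuous.comp continuous_subtype_val).subtype_mk _
  let φ : Metric.sphere (0 : Pt 3) 1 ≃ₜ Metric.sphere (0 : Pt 3) 1 :=
    ⟨⟨sphereMap e, sphereMap e.symm, hinv, hinv'⟩, hc e, hc e.symm⟩
  exact (measurePreserving_sphereMap e).integral_comp φ.measurableEmbedding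
    fun u : Metric.sphere (0 : Pt 3) 1 => F u

theorem integral_sphere_of_odd {F : Pt 3 → ℝ} {r : ℝ} (hF : ∀ x : Pt 3, ‖x‖ = r → F (-x) = -F x)
    (hr : 0 ≤ r) :
    ∫ u : Metric.sphere (0 : Pt 3) 1, F (r • (u : Pt 3)) ∂(volume : Measure (Pt 3)).toSphere
      = 0 := by
  have h := integral_sphereMap (LinearIsometryEquiv.neg ℝ) fun x => F (r • x)
  have h' : ∀ u : Metric.sphere (0 : Pt 3) 1,
      F (r • (LinearIsometryEquiv.neg ℝ (u : Pt 3))) = -F (r • (u : Pt 3)) := by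
    intro u
    have := hF (r • (u : Pt 3)) (by simp [norm_smul, abs_of_nonneg hr])
    simpa using this
  simp only [h', integral_neg] at h
  linarith

/-! ### Rotations -/

theorem rotationField_zero (x : Pt 3) : rotationField 0 x = ![0, -x 2, x 1] := by
  ext j
  fin_cases j <;> simp [rotationField, crossProduct]

theorem rotationField_one (x : Pt 3) : rotationField 1 x = ![x 2, 0, -x 0] := by
  ext j
  fin_cases j <;> simp [rotationField, crossProduct]

theorem rotationField_two (x : Pt 3) : rotationField 2 x = ![-x 1, x 0, 0] := by
  ext j
  fin_cases j <;> simp [rotationField, crossProduct]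

theorem sum_rotationField_mul_coord (i : Fin 3) (x : Pt 3) :
    ∑ j, rotationField i x j * x j = 0 := by
  fin_cases i <;> simp [rotationField_zero, rotationField_one, rotationField_two,
    Fin.sum_univ_three] <;> ring

theorem rotationField_smul (i : Fin 3) (t : ℝ) (x : Pt 3) (j : Fin 3) :
    rotationField i (t • x) j = t * rotationField i x j := by
  fin_cases i <;> fin_cases j <;>
    simp [rotationField_zero, rotationField_one, rotationField_two]

theorem isHomogeneous_rotationField (i j : Fin 3) :
    IsHomogeneous 1 (fun x => rotationField i x j) where
  smooth := by
    have h : ∀ c : Fin 3, ContDiffOn ℝ ∞ (fun x : Pt 3 => x c) {0}ᶜ := fun c =>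
      (IsHomogeneous.coord c).smooth
    fin_cases i <;> fin_cases j <;>
      simp [rotationField_zero, rotationField_one, rotationField_two, contDiffOn_const, h,
        (h _).neg]
  scale t ht x hx := by rw [rotationField_smul, Real.rpow_one]

/-- The rotation by the angle `θ` about the `i`-th coordinate axis. -/
noncomputable def rotation (i : Fin 3) (θ : ℝ) (x : Pt 3) : Pt 3 :=
  WithLp.toLp 2 fun c =>
    if c = i then x i
    else if c = i + 1 then Real.cos θ * x (i + 1) - Real.sin θ * x (i + 2)
    else Real.sin θ * x (i + 1) + Real.cos θ * x (i + 2)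

theorem norm_rotation (i : Fin 3) (θ : ℝ) (x : Pt 3) : ‖rotation i θ x‖ = ‖x‖ := by
  have h : ‖rotation i θ x‖ ^ 2 = ‖x‖ ^ 2 := by
    rw [← sum_coord_sq, ← sum_coord_sq, Fin.sum_univ_three, Fin.sum_univ_three]
    have hcs := Real.sin_sq_add_cos_sq θ
    fin_cases i <;> simp [rotation] <;>
      first
      | linear_combination (x 1 ^ 2 + x 2 ^ 2) * hcs
      | linear_combination (x 0 ^ 2 + x 2 ^ 2) * hcs
      | linear_combination (x 0 ^ 2 + x 1 ^ 2) * hcs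
  exact (pow_left_inj₀ (norm_nonneg _) (norm_nonneg _) two_ne_zero).1 h

/-- The rotation about a coordinate axis as a linear isometry. -/
noncomputable def rotationIsometry (i : Fin 3) (θ : ℝ) : Pt 3 ≃ₗᵢ[ℝ] Pt 3 :=
  LinearIsometry.toLinearIsometryEquiv
    { toFun := rotation i θ
      map_add' := fun x y => by
        ext c
        simp only [rotation, PiLp.add_apply]
        split_ifs <;> ring
      map_smul' := fun t x => by
        ext c
        simp only [rotation, PiLp.smul_apply, smul_eq_mul, RingHom.id_apply]
        split_ifs <;> ring
      norm_map' := norm_rotation i θ } rfl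

theorem hasDerivAt_rotation (i : Fin 3) (x : Pt 3) (θ : ℝ) :
    HasDerivAt (fun θ => rotation i θ x)
      (WithLp.toLp 2 (rotationField i (rotation i θ x))) θ := by
  have hd : HasDerivAt (fun θ c => (rotation i θ x) c) (rotationField i (rotation i θ x)) θ := by
    rw [hasDerivAt_pi]
    intro c
    have hs := Real.hasDerivAt_sin θ
    have hc := Real.hasDerivAt_cos θ
    have h0 := hasDerivAt_const θ (x i)
    have h1 := (hc.mul_const (x (i + 1))).sub (hs.mul_const (x (i + 2)))
    have h2 := (hs.mul_const (x (i + 1))).add (hc.mul_const (x (i + 2)))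
    fin_cases i <;> fin_cases c <;>
      simp [rotation, rotationField_zero, rotationField_one, rotationField_two] at h1 h2 ⊢ <;>
      first
      | exact hasDerivAt_const _ _
      | (refine h1.congr_deriv ?_; ring)
      | (refine h2.congr_deriv ?_; ring)
  exact (PiLp.continuousLinearEquiv 2 ℝ (fun _ : Fin 3 => ℝ)).symm.hasFDerivAt.comp_hasDerivAt θ hd

theorem rotation_zero (i : Fin 3) (x : Pt 3) : rotation i 0 x = x := by
  ext c
  fin_cases i <;> fin_cases c <;> simp [rotation]

theorem continuousOn_pd {F : Pt 3 → ℝ} (hF : ContDiffOn ℝ ∞ F {0}ᶜ) (j : Fin 3) :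
    ContinuousOn (pd j F) {0}ᶜ := fun _ hx =>
  ((hF.contDiffAt (isOpen_compl_singleton.mem_nhds hx)).pd j).continuousAt.continuousWithinAt

/-- Rotation fields are divergence free on the sphere. -/
theorem integral_rotationField_deriv {F : Pt 3 → ℝ} (hF : ContDiffOn ℝ ∞ F {0}ᶜ) (i : Fin 3) :
    ∫ u : Metric.sphere (0 : Pt 3) 1, ∑ j, rotationField i u j * pd j F u
      ∂(volume : Measure (Pt 3)).toSphere = 0 := by
  set D : Pt 3 → ℝ := fun x => ∑ j, rotationField i x j * pd j F x with hD
  have hDc : ContinuousOn D {0}ᶜ := continuousOn_finsetSum _ fun j _ =>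
    (isHomogeneous_rotationField i j).smooth.continuousOn.mul (continuousOn_pd hF j)
  have hsub : Metric.sphere (0 : Pt 3) 1 ⊆ {0}ᶜ := fun x hx h => by
    simp [show x = 0 from h] at hx
  obtain ⟨C, hC⟩ := (isCompact_sphere (0 : Pt 3) 1).exists_bound_of_continuousOn (hDc.mono hsub)
  have hmem : ∀ (θ : ℝ) (u : Metric.sphere (0 : Pt 3) 1),
      rotation i θ u ∈ Metric.sphere (0 : Pt 3) 1 := fun θ u => by
    rw [mem_sphere_zero_iff_norm, norm_rotation]
    exact norm_eq_of_mem_sphere u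
  have hcont : ∀ θ : ℝ, ContinuousOn (fun x => F (rotation i θ x)) {0}ᶜ := fun θ =>
    hF.continuousOn.comp (rotationIsometry i θ).continuous.continuousOn fun x hx h =>
      hx ((rotationIsometry i θ).map_eq_zero_iff.1 h)
  -- The integral of F over the rotated sphere does not depend on θ, so its derivative at θ = 0,
  -- taken under the integral sign, vanishes. The bound C is uniform in θ because rotated points
  -- stay on the compact sphere.
  have hderiv := hasDerivAt_integral_of_dominated_loc_of_deriv_le
    (μ := (volume : Measure (Pt 3)).toSphere) (s := Set.univ) (x₀ := (0 : ℝ))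
    (F := fun θ (u : Metric.sphere (0 : Pt 3) 1) => F (rotation i θ u))
    (F' := fun θ (u : Metric.sphere (0 : Pt 3) 1) => D (rotation i θ u)) (bound := fun _ => C)
    univ_mem
    (Eventually.of_forall fun θ => (integrable_unitSphere (hcont θ)).aestronglyMeasurable)
    (integrable_unitSphere (hcont 0))
    (by simpa [rotation_zero] using (integrable_unitSphere hDc).aestronglyMeasurable)
    (Eventually.of_forall fun u θ _ => hC _ (hmem θ u))
    (integrable_const C)
    (Eventually.of_forall fun u θ _ => by
      have hFd : HasFDerivAt F (fderiv ℝ F (rotation i θ u)) (rotation i θ u) :=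
        (hF.contDiffAt (isOpen_compl_singleton.mem_nhds
          (hsub (hmem θ u)))).differentiableAt_infty.hasFDerivAt
      have := hFd.comp_hasDerivAt θ (hasDerivAt_rotation i u θ)
      rw [fderiv_eq_sum_pd] at this
      exact this)
  have hconst : (fun θ : ℝ => ∫ u : Metric.sphere (0 : Pt 3) 1, F (rotation i θ u)
      ∂(volume : Measure (Pt 3)).toSphere) = fun _ => ∫ u : Metric.sphere (0 : Pt 3) 1, F u
      ∂(volume : Measure (Pt 3)).toSphere :=
    funext fun θ => integral_sphereMap (rotationIsometry i θ) F
  have h2 := hderiv.2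
  rw [hconst] at h2
  simpa [rotation_zero] using h2.unique (hasDerivAt_const _ _)

/-! ### Moments -/

theorem toSphere_univ : (volume : Measure (Pt 3)).toSphere.real Set.univ = 4 * Real.pi := by
  rw [Measure.toSphere_real_apply_univ, Measure.real, EuclideanSpace.volume_ball_fin_three]
  have h : (0 : ℝ) ≤ Real.pi * 4 / 3 := by positivity
  simp only [finrank_euclideanSpace, Fintype.card_fin, ENNReal.ofReal_one, one_pow, one_mul,
    ENNReal.toReal_ofReal h]
  push_cast
  ring

theorem pd_pow {n : ℕ} (i : Fin n) (k : ℕ) {F : Pt n → ℝ} {x : Pt n}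
    (hF : DifferentiableAt ℝ F x) : pd i (fun y => F y ^ k) x = k * F x ^ (k - 1) * pd i F x :=
  pd_comp (hasDerivAt_pow k (F x)) hF

theorem contDiff_coord (i : Fin 3) : ContDiff ℝ ∞ fun x : Pt 3 => x i :=
  (EuclideanSpace.proj (𝕜 := ℝ) i).contDiff

theorem pd_monomial (i a b : Fin 3) (k l : ℕ) (x : Pt 3) :
    pd i (fun y : Pt 3 => y a ^ k * y b ^ l) x =
      x a ^ k * (l * x b ^ (l - 1) * if b = i then 1 else 0)
        + x b ^ l * (k * x a ^ (k - 1) * if a = i then 1 else 0) := by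
  have h : ∀ c, DifferentiableAt ℝ (fun y : Pt 3 => y c) x := fun c =>
    ((contDiff_coord c).contDiffAt).differentiableAt_infty
  rw [pd_mul ((h a).fun_pow k) ((h b).fun_pow l), pd_pow i k (h a), pd_pow i l (h b), pd_coord,
    pd_coord]

theorem integrable_monomial (a b : Fin 3) (k l : ℕ) :
    Integrable (fun u : Metric.sphere (0 : Pt 3) 1 => (u : Pt 3) a ^ k * (u : Pt 3) b ^ l)
      (volume : Measure (Pt 3)).toSphere :=
  integrable_unitSphere (F := fun x => x a ^ k * x b ^ l)
    (((contDiff_coord a).pow k).mul ((contDiff_coord b).pow l)).continuous.continuousOn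

/-- The derivative of x₀^(k+1) x₁^(l+1) along x₀∂₁ - x₁∂₀ has mean zero. This trades two powers of
one coordinate for two of the other. -/
theorem integral_rotation_two_monomial (k l : ℕ) :
    (l + 1) * ∫ u : Metric.sphere (0 : Pt 3) 1, (u : Pt 3) 0 ^ (k + 2) * (u : Pt 3) 1 ^ l
        ∂(volume : Measure (Pt 3)).toSphere
      = (k + 1) * ∫ u : Metric.sphere (0 : Pt 3) 1, (u : Pt 3) 0 ^ k * (u : Pt 3) 1 ^ (l + 2)
        ∂(volume : Measure (Pt 3)).toSphere := by
  have h := integral_rotationField_deriv (F := fun x => x 0 ^ (k + 1) * x 1 ^ (l + 1))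
    (((contDiff_coord 0).pow _).mul ((contDiff_coord 1).pow _)).contDiffOn 2
  have h' : ∀ u : Metric.sphere (0 : Pt 3) 1, ∑ j, rotationField 2 (u : Pt 3) j *
      pd j (fun x => x 0 ^ (k + 1) * x 1 ^ (l + 1)) (u : Pt 3)
      = (l + 1) * ((u : Pt 3) 0 ^ (k + 2) * (u : Pt 3) 1 ^ l)
        - (k + 1) * ((u : Pt 3) 0 ^ k * (u : Pt 3) 1 ^ (l + 2)) := by
    intro u
    simp [Fin.sum_univ_three, rotationField_two, pd_monomial]
    ring
  simp only [h'] at h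
  rw [integral_sub ((integrable_monomial _ _ _ _).const_mul _)
    ((integrable_monomial _ _ _ _).const_mul _), integral_const_mul, integral_const_mul] at h
  linarith

/-- The same mechanism for rotations about the first axis, applied to x₂ x₁^(l+1). -/
theorem integral_rotation_zero_monomial (l : ℕ) :
    (l + 1) * ∫ u : Metric.sphere (0 : Pt 3) 1, (u : Pt 3) 2 ^ 2 * (u : Pt 3) 1 ^ l
        ∂(volume : Measure (Pt 3)).toSphere
      = ∫ u : Metric.sphere (0 : Pt 3) 1, (u : Pt 3) 2 ^ 0 * (u : Pt 3) 1 ^ (l + 2)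
        ∂(volume : Measure (Pt 3)).toSphere := by
  have h := integral_rotationField_deriv (F := fun x => x 2 ^ 1 * x 1 ^ (l + 1))
    (((contDiff_coord 2).pow _).mul ((contDiff_coord 1).pow _)).contDiffOn 0
  have h' : ∀ u : Metric.sphere (0 : Pt 3) 1, ∑ j, rotationField 0 (u : Pt 3) j *
      pd j (fun x => x 2 ^ 1 * x 1 ^ (l + 1)) (u : Pt 3)
      = (u : Pt 3) 2 ^ 0 * (u : Pt 3) 1 ^ (l + 2)
        - (l + 1) * ((u : Pt 3) 2 ^ 2 * (u : Pt 3) 1 ^ l) := by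
    intro u
    simp only [Fin.sum_univ_three, rotationField_zero, pd_monomial]
    simp
    ring
  simp only [h'] at h
  rw [integral_sub (integrable_monomial _ _ _ _)
    ((integrable_monomial _ _ _ _).const_mul _), integral_const_mul] at h
  linarith

/-- The even moments of a coordinate on the unit sphere. -/
theorem integral_coord_pow_even (k : ℕ) :
    ∫ u : Metric.sphere (0 : Pt 3) 1, (u : Pt 3) 0 ^ 0 * (u : Pt 3) 1 ^ (2 * k)
      ∂(volume : Measure (Pt 3)).toSphere = 4 * Real.pi / (2 * k + 1) := by
  induction k with
  | zero =>
    simp only [mul_zero, pow_zero, mul_one, integral_const, toSphere_univ]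
    simp
  | succ k ih =>
    have h0 := integral_rotation_two_monomial 0 (2 * k)
    have h2 := integral_rotation_zero_monomial (2 * k)
    -- Multiply by 1 = x₀² + x₁² + x₂². By the two recursions the x₀² and x₂² terms each equal
    -- 1/(2k+1) times the moment of order 2k+2.
    have hsum : ∀ u : Metric.sphere (0 : Pt 3) 1, (u : Pt 3) 0 ^ 0 * (u : Pt 3) 1 ^ (2 * k)
        = (u : Pt 3) 0 ^ (0 + 2) * (u : Pt 3) 1 ^ (2 * k)
          + (u : Pt 3) 2 ^ 2 * (u : Pt 3) 1 ^ (2 * k)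
          + (u : Pt 3) 0 ^ 0 * (u : Pt 3) 1 ^ (2 * k + 2) := by
      intro u
      have h := sum_coord_sq (u : Pt 3)
      rw [norm_eq_of_mem_sphere u, Fin.sum_univ_three] at h
      linear_combination (-(u : Pt 3) 1 ^ (2 * k)) * h
    simp only [hsum] at ih
    rw [integral_add (by exact (integrable_monomial _ _ _ _).add (integrable_monomial _ _ _ _))
      (integrable_monomial _ _ _ _), integral_add (integrable_monomial _ _ _ _)
      (integrable_monomial _ _ _ _)] at ih
    simp only [pow_zero, one_mul] at *
    rw [show 2 * (k + 1) = 2 * k + 2 by ring]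
    push_cast at *
    have hk : (0 : ℝ) < 2 * k + 1 := by positivity
    rw [eq_div_iff (by positivity)] at ih ⊢
    linarith

/-- Two recursion steps down to the tenth moment: 3/7 · 1/9 · 4π/11. -/
theorem integral_coord_four_six :
    ∫ u : Metric.sphere (0 : Pt 3) 1, (u : Pt 3) 0 ^ 4 * (u : Pt 3) 1 ^ 6
      ∂(volume : Measure (Pt 3)).toSphere = 4 * Real.pi / 231 := by
  have h1 := integral_rotation_two_monomial 2 6
  have h2 := integral_rotation_two_monomial 0 8
  have h3 := integral_coord_pow_even 5
  norm_num at h1 h2 h3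
  linarith

/-! ### Limits of integrals over large spheres -/

theorem HasSphereLimit.add {F G : Pt 3 → ℝ} {L M : ℝ} (hF : HasSphereLimit F L)
    (hG : HasSphereLimit G M) : HasSphereLimit (fun x => F x + G x) (L + M) := by
  refine ⟨by filter_upwards [hF.1, hG.1] with r h h' using h.add h', ?_⟩
  refine (hF.2.add hG.2).congr' ?_
  filter_upwards [hF.1, hG.1] with r h h'
  rw [sphereIntegral, sphereIntegral, sphereIntegral, integral_add h h', mul_add]

theorem eventually_sphere {p : Pt 3 → Prop} (h : ∀ᶠ x in cobounded (Pt 3), p x) :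
    ∀ᶠ r : ℝ in atTop, 0 < r ∧ ∀ x : Pt 3, ‖x‖ = r → p x := by
  obtain ⟨R, hR⟩ := eventually_cobounded_iff.1 h
  filter_upwards [eventually_gt_atTop (max R 0)] with r hr
  exact ⟨(le_max_right _ _).trans_lt hr, fun x hx => hR x
    (((le_max_left _ _).trans_lt hr).trans_eq hx.symm)⟩

theorem norm_smul_unitSphere {r : ℝ} (hr : 0 < r) (u : Metric.sphere (0 : Pt 3) 1) :
    ‖r • (u : Pt 3)‖ = r := by
  simp [norm_smul, abs_of_pos hr]

theorem HasSphereLimit.congr {F G : Pt 3 → ℝ} {L : ℝ} (hF : HasSphereLimit F L)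
    (h : F =ᶠ[cobounded (Pt 3)] G) : HasSphereLimit G L := by
  have hev := eventually_sphere h
  refine ⟨?_, hF.2.congr' ?_⟩
  · filter_upwards [hF.1, hev] with r hr hr'
    refine hr.congr (Eventually.of_forall fun u => hr'.2 _ (norm_smul_unitSphere hr'.1 u))
  · filter_upwards [hev] with r hr'
    simp only [sphereIntegral, hr'.2 _ (norm_smul_unitSphere hr'.1 _)]

theorem SmoothAtInfinity.eventually_integrable {F : Pt 3 → ℝ} (hF : SmoothAtInfinity F) :
    ∀ᶠ r : ℝ in atTop, Integrable (fun u : Metric.sphere (0 : Pt 3) 1 => F (r • (u : Pt 3)))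
      (volume : Measure (Pt 3)).toSphere := by
  filter_upwards [eventually_sphere hF] with r hr
  exact integrable_sphere_of_continuousAt hr.1.le fun x hx => (hr.2 x hx).continuousAt

theorem hasSphereLimit_of_odd {F : Pt 3 → ℝ} (hF : SmoothAtInfinity F)
    (hodd : ∀ᶠ x in cobounded (Pt 3), F (-x) = -F x) : HasSphereLimit F 0 := by
  refine ⟨hF.eventually_integrable, tendsto_const_nhds.congr' ?_⟩
  filter_upwards [eventually_sphere hodd] with r hr
  rw [sphereIntegral, integral_sphere_of_odd hr.2 hr.1.le, mul_zero]

/-- The area grows like r², which decay faster than r^{-2} outweighs. -/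
theorem hasSphereLimit_of_isSymbol {F : Pt 3 → ℝ} {a : ℝ} (hF : IsSymbol a F) (ha : a < -2) :
    HasSphereLimit F 0 := by
  refine ⟨hF.smooth.eventually_integrable, ?_⟩
  obtain ⟨C, hC⟩ := IsBigO.bound hF.isBigOPow
  have hlim : Tendsto (fun r : ℝ => C * (4 * Real.pi) * r ^ (a + 2)) atTop (𝓝 0) := by
    have := (tendsto_rpow_neg_atTop (y := -(a + 2)) (by linarith)).const_mul (C * (4 * Real.pi))
    simpa using this
  refine squeeze_zero_norm' ?_ hlim
  filter_upwards [eventually_sphere hC] with r hr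
  have hr0 := hr.1
  have hb := norm_integral_le_of_norm_le_const (μ := (volume : Measure (Pt 3)).toSphere)
    (f := fun u : Metric.sphere (0 : Pt 3) 1 => F (r • (u : Pt 3))) (C := C * r ^ a)
    (Eventually.of_forall fun u => by
      have := hr.2 (r • (u : Pt 3)) (norm_smul_unitSphere hr0 u)
      rwa [norm_smul_unitSphere hr0 u, Real.norm_of_nonneg (Real.rpow_nonneg hr0.le a)] at this)
  rw [toSphere_univ] at hb
  rw [sphereIntegral, norm_mul, Real.norm_of_nonneg (by positivity), Real.rpow_add hr0,
    Real.rpow_two]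
  calc r ^ 2 * _ ≤ r ^ 2 * (C * r ^ a * (4 * Real.pi)) := by gcongr
    _ = _ := by ring

/-- Degree -2 exactly cancels the area factor r², so the sphere integrals are constant in r. -/
theorem hasSphereLimit_of_isHomogeneous {F : Pt 3 → ℝ} (hF : IsHomogeneous (-2) F) :
    HasSphereLimit F (∫ u : Metric.sphere (0 : Pt 3) 1, F u
      ∂(volume : Measure (Pt 3)).toSphere) := by
  refine ⟨hF.isSymbol.smooth.eventually_integrable, tendsto_const_nhds.congr' ?_⟩
  filter_upwards [eventually_gt_atTop 0] with r hr
  simp only [sphereIntegral, hF.scale r hr _ (unitSphere_ne_zero _)]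
  rw [integral_const_mul, ← mul_assoc, ← Real.rpow_two, ← Real.rpow_add hr]
  simp

/-- A radial multiple of the derivative of a homogeneous function along a rotation field has
vanishing integral over all spheres. -/
theorem hasSphereLimit_radial_mul_rotation {f α : Pt 3 → ℝ} {a : ℝ} (hf : IsHomogeneous a f)
    (hα : SmoothAtInfinity α) (hrad : ∀ x y : Pt 3, ‖x‖ = ‖y‖ → α x = α y) (i : Fin 3) :
    HasSphereLimit (fun x => α x * ∑ j, rotationField i x j * pd j f x) 0 := by
  have hh : IsHomogeneous a fun x => ∑ j, rotationField i x j * pd j f x := by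
    have := IsHomogeneous.sum (s := Finset.univ) fun j _ =>
      (isHomogeneous_rotationField i j).mul (hf.pd j)
    simpa using this
  refine ⟨(hα.mul hh.isSymbol.smooth).eventually_integrable, tendsto_const_nhds.congr' ?_⟩
  filter_upwards [eventually_gt_atTop 0] with r hr
  -- On the sphere of radius r the radial factor is the constant α(r u₀) and leaves the integral.
  obtain ⟨u₀⟩ : Nonempty (Metric.sphere (0 : Pt 3) 1) :=
    (NormedSpace.sphere_nonempty.2 zero_le_one).to_subtype
  have h : ∀ u : Metric.sphere (0 : Pt 3) 1, α (r • (u : Pt 3)) = α (r • (u₀ : Pt 3)) := fun u =>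
    hrad _ _ (by rw [norm_smul_unitSphere hr, norm_smul_unitSphere hr])
  simp only [sphereIntegral, h, hh.scale r hr _ (unitSphere_ne_zero _)]
  rw [integral_const_mul, integral_const_mul, integral_rotationField_deriv hf.smooth]
  simp

/-! ### Static spacetimes -/

/-- The static metric `-V dt² + γ`. -/
def staticMetric (V : Pt 3 → ℝ) (γ : TensorField 3) : TensorField 4 := fun p =>
  Matrix.of (Fin.cons (Fin.cons (-V (spatial p)) 0)
    fun i => Fin.cons 0 fun j => γ (spatial p) i j)

section StaticMetric

variable {V : Pt 3 → ℝ} {γ : TensorField 3} {p : Pt 4} {f : Pt 3 → ℝ} {x : Pt 3}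

theorem sum_univ_four {M : Type*} [AddCommMonoid M] (F : Fin 4 → M) :
    ∑ α, F α = F 0 + ∑ i : Fin 3, F i.succ :=
  Fin.sum_univ_succ F

@[simp]
theorem staticMetric_zero_zero : staticMetric V γ p 0 0 = -V (spatial p) := rfl

@[simp]
theorem staticMetric_zero_succ (i : Fin 3) : staticMetric V γ p 0 i.succ = 0 := rfl

@[simp]
theorem staticMetric_succ_zero (i : Fin 3) : staticMetric V γ p i.succ 0 = 0 := rfl

@[simp]
theorem staticMetric_succ_succ (i j : Fin 3) :
    staticMetric V γ p i.succ j.succ = γ (spatial p) i j := rfl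

theorem staticMetric_transpose (hγ : (γ (spatial p)).IsSymm) :
    (staticMetric V γ p)ᵀ = staticMetric V γ p := by
  ext α β
  refine Fin.cases ?_ (fun i => ?_) α <;> refine Fin.cases ?_ (fun j => ?_) β <;>
    simp [Matrix.transpose_apply, hγ.apply]

theorem staticMetric_mul_inverse (hV : V (spatial p) ≠ 0) (hγ : IsUnit (γ (spatial p)).det) :
    staticMetric V γ p * staticMetric (fun x => (V x)⁻¹) (fun x => (γ x)⁻¹) p = 1 := by
  have h1 := Matrix.mul_nonsing_inv _ hγ
  ext α β
  rw [Matrix.mul_apply, sum_univ_four]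
  refine Fin.cases ?_ (fun i => ?_) α <;> refine Fin.cases ?_ (fun j => ?_) β
  · simp [hV]
  · simp [(Fin.succ_ne_zero j).symm]
  · simp [Fin.succ_ne_zero i]
  · have := congrFun (congrFun h1 i) j
    rw [Matrix.mul_apply] at this
    simp [this, Matrix.one_apply]

theorem staticMetric_inv (hV : V (spatial p) ≠ 0) (hγ : IsUnit (γ (spatial p)).det) :
    (staticMetric V γ p)⁻¹ = staticMetric (fun x => (V x)⁻¹) (fun x => (γ x)⁻¹) p :=
  Matrix.inv_eq_right_inv (staticMetric_mul_inverse hV hγ)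

/-- The projection to the spatial coordinates as a continuous linear map. -/
noncomputable def spatialCLM : Pt 4 →L[ℝ] Pt 3 :=
  LinearMap.toContinuousLinearMap
    { toFun := spatial
      map_add' := fun _ _ => rfl
      map_smul' := fun _ _ => rfl }

theorem fderiv_comp_spatial {F : Pt 3 → ℝ} (hF : DifferentiableAt ℝ F (spatial p)) (v : Pt 4) :
    fderiv ℝ (fun q => F (spatial q)) p v = fderiv ℝ F (spatial p) (spatial v) := by
  have : HasFDerivAt (fun q => F (spatial q)) ((fderiv ℝ F (spatial p)).comp spatialCLM) p :=
    HasFDerivAt.comp (f := spatialCLM) p (hF.hasFDerivAt) spatialCLM.hasFDerivAt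
  rw [this.fderiv]
  rfl

theorem pd_zero_comp_spatial {F : Pt 3 → ℝ} (hF : DifferentiableAt ℝ F (spatial p)) :
    pd 0 (fun q => F (spatial q)) p = 0 := by
  rw [pd, fderiv_comp_spatial hF,
    show spatial (EuclideanSpace.single 0 1) = 0 by ext j; simp [spatial], map_zero]

theorem pd_succ_comp_spatial {F : Pt 3 → ℝ} (hF : DifferentiableAt ℝ F (spatial p)) (i : Fin 3) :
    pd i.succ (fun q => F (spatial q)) p = pd i F (spatial p) := by
  rw [pd, fderiv_comp_spatial hF, pd]
  congr 1
  ext j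
  simp [spatial]

/-- The metric `-V dt² + γ` is symmetric, nondegenerate and differentiable at `x`. -/
structure IsStaticRegularAt (V : Pt 3 → ℝ) (γ : TensorField 3) (x : Pt 3) : Prop where
  ne_zero : V x ≠ 0
  isUnit_det : IsUnit (γ x).det
  isSymm : (γ x).IsSymm
  diff_lapse : DifferentiableAt ℝ V x
  diff_slice : ∀ i j, DifferentiableAt ℝ (fun y => γ y i j) x

/-- Time independence and the block form leave only Γ⁰₀ⱼ, Γᵏ₀₀ and the spatial symbols. This lemma
and the next seven list all cases. -/
theorem christoffel_static_zero_zero_zero (h : IsStaticRegularAt V γ (spatial p)) :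
    christoffel (staticMetric V γ) 0 0 0 p = 0 := by
  simp [christoffel, staticMetric_inv h.ne_zero h.isUnit_det, sum_univ_four, pd_neg, pd_zero_comp_spatial h.diff_lapse]

theorem christoffel_static_zero_zero_succ (h : IsStaticRegularAt V γ (spatial p))
    (j : Fin 3) :
    christoffel (staticMetric V γ) 0 0 j.succ p = pd j V (spatial p) / (2 * V (spatial p)) := by
  simp [christoffel, staticMetric_inv h.ne_zero h.isUnit_det, sum_univ_four, pd_neg, pd_const,
    pd_succ_comp_spatial h.diff_lapse]
  have := h.ne_zero
  field_simp

theorem christoffel_static_zero_succ_zero (h : IsStaticRegularAt V γ (spatial p))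
    (j : Fin 3) :
    christoffel (staticMetric V γ) 0 j.succ 0 p = pd j V (spatial p) / (2 * V (spatial p)) := by
  simp [christoffel, staticMetric_inv h.ne_zero h.isUnit_det, sum_univ_four, pd_neg, pd_const,
    pd_succ_comp_spatial h.diff_lapse]
  have := h.ne_zero
  field_simp

theorem christoffel_static_zero_succ_succ (h : IsStaticRegularAt V γ (spatial p))
    (i j : Fin 3) :
    christoffel (staticMetric V γ) 0 i.succ j.succ p = 0 := by
  simp [christoffel, staticMetric_inv h.ne_zero h.isUnit_det, sum_univ_four, pd_const,
    pd_zero_comp_spatial (h.diff_slice _ _)]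

theorem christoffel_static_succ_zero_zero (h : IsStaticRegularAt V γ (spatial p))
    (k : Fin 3) :
    christoffel (staticMetric V γ) k.succ 0 0 p
      = 1 / 2 * ∑ l, (γ (spatial p))⁻¹ k l * pd l V (spatial p) := by
  simp [christoffel, staticMetric_inv h.ne_zero h.isUnit_det, sum_univ_four, pd_neg, pd_const,
    pd_succ_comp_spatial h.diff_lapse]

theorem christoffel_static_succ_zero_succ (h : IsStaticRegularAt V γ (spatial p))
    (k j : Fin 3) :
    christoffel (staticMetric V γ) k.succ 0 j.succ p = 0 := by
  simp [christoffel, staticMetric_inv h.ne_zero h.isUnit_det, sum_univ_four, pd_const,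
    pd_zero_comp_spatial (h.diff_slice _ _)]

theorem christoffel_static_succ_succ_zero (h : IsStaticRegularAt V γ (spatial p))
    (k i : Fin 3) :
    christoffel (staticMetric V γ) k.succ i.succ 0 p = 0 := by
  simp [christoffel, staticMetric_inv h.ne_zero h.isUnit_det, sum_univ_four, pd_const,
    pd_zero_comp_spatial (h.diff_slice _ _)]

theorem christoffel_static_succ_succ_succ (h : IsStaticRegularAt V γ (spatial p))
    (k i j : Fin 3) :
    christoffel (staticMetric V γ) k.succ i.succ j.succ p = christoffel γ k i j (spatial p) := by
  simp [christoffel, staticMetric_inv h.ne_zero h.isUnit_det, sum_univ_four, pd_succ_comp_spatial (h.diff_slice _ _)]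

/-! ### Graphs in static spacetimes -/

theorem spatial_graphMap : spatial (graphMap f x) = x := rfl

theorem graphTangent_zero (i : Fin 3) : graphTangent f i x 0 = pd i f x := rfl

theorem graphTangent_succ (i j : Fin 3) :
    graphTangent f i x j.succ = if j = i then 1 else 0 :=
  pd_coord j

theorem graphConormal_zero : graphConormal f x 0 = 1 := rfl

theorem graphConormal_succ (i : Fin 3) : graphConormal f x i.succ = -pd i f x := rfl

theorem inducedMetric_static (i j : Fin 3) :
    inducedMetric (staticMetric V γ) f x i j = γ x i j - V x * pd i f x * pd j f x := by
  simp [inducedMetric, dotProduct, Matrix.mulVec, sum_univ_four, graphTangent_zero,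
    graphTangent_succ, spatial_graphMap]
  ring

theorem graphAccel_static_zero (h : IsStaticRegularAt V γ x)
    (i j : Fin 3) : graphAccel (staticMetric V γ) f i j x 0
      = pd i (pd j f) x + (pd i V x * pd j f x + pd j V x * pd i f x) / (2 * V x) := by
  have hp : spatial (graphMap f x) = x := rfl
  rw [← hp] at h
  simp only [graphAccel, sum_univ_four, christoffel_static_zero_zero_zero h,
    christoffel_static_zero_zero_succ h, christoffel_static_zero_succ_zero h,
    christoffel_static_zero_succ_succ h, graphTangent_zero, graphTangent_succ, hp]
  simp
  ring

theorem graphAccel_static_succ (h : IsStaticRegularAt V γ x)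
    (i j k : Fin 3) : graphAccel (staticMetric V γ) f i j x k.succ
      = christoffel γ k i j x
        + 1 / 2 * (∑ l, (γ x)⁻¹ k l * pd l V x) * pd i f x * pd j f x := by
  have hp : spatial (graphMap f x) = x := rfl
  rw [← hp] at h
  simp only [graphAccel, sum_univ_four, christoffel_static_succ_zero_zero h,
    christoffel_static_succ_zero_succ h, christoffel_static_succ_succ_zero h,
    christoffel_static_succ_succ_succ h, graphTangent_zero, graphTangent_succ, hp,
    pd_const]
  simp
  ring

/-- `-⟨dτ, dτ⟩` for `τ = t - f(x)`: this is `V⁻¹ - |df|²_γ`. -/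
noncomputable def conormalSq (V : Pt 3 → ℝ) (γ : TensorField 3) (f : Pt 3 → ℝ) (x : Pt 3) : ℝ :=
  (V x)⁻¹ - ∑ i, ∑ j, (γ x)⁻¹ i j * pd i f x * pd j f x

/-- The normal ν is a normalized multiple of the raised conormal dτ, τ = t - f, so lowering its
index returns dτ. Thus kᵢⱼ is dτ(∇_{eᵢ}eⱼ) divided by the length of dτ, and only the components of
the acceleration are needed. -/
theorem secondFundamentalForm_static (h : IsStaticRegularAt V γ x)
    (i j : Fin 3) : secondFundamentalForm (staticMetric V γ) f x i j
      = (√(conormalSq V γ f x))⁻¹ *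
        (pd i (pd j f) x + (pd i V x * pd j f x + pd j V x * pd i f x) / (2 * V x)
          - ∑ k, pd k f x * (christoffel γ k i j x
            + 1 / 2 * (∑ l, (γ x)⁻¹ k l * pd l V x) * pd i f x * pd j f x)) := by
  set G := staticMetric V γ (graphMap f x) with hG
  have hinv : G⁻¹ = staticMetric (fun x => (V x)⁻¹) (fun x => (γ x)⁻¹) (graphMap f x) :=
    staticMetric_inv h.ne_zero h.isUnit_det
  have hmul : G * G⁻¹ = 1 := hinv ▸ staticMetric_mul_inverse h.ne_zero h.isUnit_det
  have hsym : Gᵀ = G := staticMetric_transpose h.isSymm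
  have hcontr : ∀ c a : Fin 4 → ℝ, (G⁻¹ *ᵥ c) ⬝ᵥ (G *ᵥ a) = c ⬝ᵥ a := by
    intro c a
    rw [Matrix.dotProduct_mulVec, ← Matrix.mulVec_transpose, hsym, Matrix.mulVec_mulVec, hmul,
      Matrix.one_mulVec]
  have hsq : -(graphConormal f x ⬝ᵥ (G⁻¹ *ᵥ graphConormal f x)) = conormalSq V γ f x := by
    rw [hinv, conormalSq]
    simp only [dotProduct, Matrix.mulVec, sum_univ_four, graphConormal_zero, graphConormal_succ,
      staticMetric_zero_zero, staticMetric_zero_succ, staticMetric_succ_zero,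
      staticMetric_succ_succ, spatial_graphMap]
    simp only [one_mul, mul_one, zero_mul, zero_add, Finset.sum_const_zero, add_zero,
      Finset.mul_sum, neg_add, neg_neg, ← Finset.sum_neg_distrib, sub_eq_add_neg]
    congr 1
    refine Finset.sum_congr rfl fun i _ => Finset.sum_congr rfl fun j _ => ?_
    ring
  simp only [secondFundamentalForm, unitNormal, Matrix.of_apply, ← hG]
  rw [smul_dotProduct, hcontr, hsq, dotProduct, sum_univ_four,
    graphAccel_static_zero h]
  simp only [graphAccel_static_succ h, graphConormal_zero, graphConormal_succ,
    neg_mul, Finset.sum_neg_distrib, smul_eq_mul]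
  ring

end StaticMetric

/-! ### The Schwarzschild metric as a static metric -/

/-- The square `1 - 2m/r` of the lapse function of the Schwarzschild metric. -/
noncomputable def schwLapseSq (m : ℝ) (x : Pt 3) : ℝ := 1 - 2 * m / ‖x‖

/-- The metric on the slices of constant time. -/
noncomputable def schwSlice (m : ℝ) : TensorField 3 := fun x => Matrix.of fun i j =>
  (if i = j then 1 else 0) + ((schwLapseSq m x)⁻¹ - 1) * (x i / ‖x‖) * (x j / ‖x‖)

theorem schwarzschild_eq_static (m : ℝ) :
    schwarzschild m = staticMetric (schwLapseSq m) (schwSlice m) := by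
  funext p
  ext α β
  refine Fin.cases ?_ (fun i => ?_) α <;> refine Fin.cases ?_ (fun j => ?_) β
  · simp [schwarzschild, Matrix.vecMulVec_apply, schwLapseSq]
  · simp [schwarzschild, Matrix.vecMulVec_apply, (Fin.succ_ne_zero j).symm]
  · simp [schwarzschild, Matrix.vecMulVec_apply]
  · simp [schwarzschild, Matrix.vecMulVec_apply, Matrix.diagonal_apply, schwSlice, schwLapseSq]
    ring

section Schwarzschild

variable {m : ℝ} {f : Pt 3 → ℝ} {x : Pt 3}

theorem ne_zero_of_mem_exterior {R : ℝ} (hR : 0 ≤ R) (hx : x ∈ exterior R) : x ≠ 0 :=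
  norm_pos_iff.1 (hR.trans_lt hx)

theorem schwLapseSq_pos (hm : 0 < m) (hx : x ∈ exterior (2 * m)) : 0 < schwLapseSq m x := by
  have hx : 2 * m < ‖x‖ := hx
  have : 0 < ‖x‖ := by linarith
  rw [schwLapseSq, sub_pos, div_lt_one this]
  exact hx

theorem contDiffAt_schwLapseSq (hx : x ≠ 0) : ContDiffAt ℝ ∞ (schwLapseSq m) x :=
  contDiffAt_const.sub (contDiffAt_const.div (contDiffAt_norm ℝ hx) (norm_ne_zero_iff.2 hx))

theorem contDiffAt_schwSlice (hx : x ≠ 0) (hV : schwLapseSq m x ≠ 0) (i j : Fin 3) :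
    ContDiffAt ℝ ∞ (fun y => schwSlice m y i j) x := by
  have hc : ∀ i, ContDiffAt ℝ ∞ (fun y : Pt 3 => y i / ‖y‖) x := fun i =>
    (contDiff_coord i).contDiffAt.div (contDiffAt_norm ℝ hx) (norm_ne_zero_iff.2 hx)
  exact contDiffAt_const.add
    (((((contDiffAt_schwLapseSq hx).inv hV).sub contDiffAt_const).mul (hc i)).mul (hc j))

theorem schwSlice_isSymm (m : ℝ) (x : Pt 3) : (schwSlice m x).IsSymm := by
  ext i j
  simp [schwSlice, Matrix.transpose_apply, eq_comm]
  ring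

theorem sum_div_norm_sq (hx : x ≠ 0) : ∑ i, (x i / ‖x‖) ^ 2 = 1 := by
  have : ‖x‖ ≠ 0 := norm_ne_zero_iff.2 hx
  simp only [div_pow, ← Finset.sum_div, sum_coord_sq]
  field_simp

/-- With n = x/r of length one, the slice metric is 1 + (V⁻¹ - 1) n⊗n: it multiplies n by V⁻¹ and
fixes the orthogonal plane. The inverse multiplies n by V instead. -/
theorem schwSlice_mul_inverse (hx : x ≠ 0) (hV : schwLapseSq m x ≠ 0) :
    schwSlice m x * Matrix.of (fun i j : Fin 3 => (if i = j then (1 : ℝ) else 0)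
      - (1 - schwLapseSq m x) * (x i / ‖x‖) * (x j / ‖x‖)) = 1 := by
  set V := schwLapseSq m x
  set n : Fin 3 → ℝ := fun i => x i / ‖x‖ with hndef
  have hn : ∑ i, n i ^ 2 = 1 := sum_div_norm_sq hx
  have hVV : V⁻¹ * V = 1 := inv_mul_cancel₀ hV
  ext i j
  have hterm : ∀ k, schwSlice m x i k * ((if k = j then (1 : ℝ) else 0) - (1 - V) * n k * n j)
      = (if i = k then (1 : ℝ) else 0) * (if k = j then 1 else 0)
        + (if k = j then (V⁻¹ - 1) * n i * n k else 0)
        - (if i = k then (1 - V) * n k * n j else 0)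
        - (V⁻¹ - 1) * (1 - V) * n i * n j * n k ^ 2 := by
    intro k
    simp only [schwSlice, Matrix.of_apply, hndef]
    split_ifs <;> ring
  rw [Matrix.mul_apply]
  refine (Finset.sum_congr rfl fun k _ => hterm k).trans ?_
  simp only [Finset.sum_sub_distrib, Finset.sum_add_distrib, ← Finset.mul_sum, hn]
  simp [Matrix.one_apply]
  linear_combination (n i * n j) * hVV

theorem schwSlice_inv (hx : x ≠ 0) (hV : schwLapseSq m x ≠ 0) (i j : Fin 3) :
    (schwSlice m x)⁻¹ i j = (if i = j then 1 else 0)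
      - (1 - schwLapseSq m x) * (x i / ‖x‖) * (x j / ‖x‖) := by
  rw [Matrix.inv_eq_right_inv (schwSlice_mul_inverse hx hV)]
  rfl

theorem isUnit_det_schwSlice (hx : x ≠ 0) (hV : schwLapseSq m x ≠ 0) :
    IsUnit (schwSlice m x).det :=
  Matrix.isUnit_det_of_right_inverse (schwSlice_mul_inverse hx hV)

/-! ### Induced metric and second fundamental form of a Schwarzschild graph -/

theorem schwMetric_apply (m : ℝ) (f : Pt 3 → ℝ) (x : Pt 3) (i j : Fin 3) :
    schwMetric m f x i j = schwSlice m x i j - schwLapseSq m x * pd i f x * pd j f x := by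
  rw [schwMetric, schwarzschild_eq_static, inducedMetric_static]

/-- `-⟨dτ, dτ⟩` for `τ = t - f(x)` in the Schwarzschild spacetime. -/
noncomputable def schwConormalSq (m : ℝ) (f : Pt 3 → ℝ) (x : Pt 3) : ℝ :=
  conormalSq (schwLapseSq m) (schwSlice m) f x

/-- The component along the unit normal of the acceleration, up to normalization. -/
noncomputable def schwNormalAccel (m : ℝ) (f : Pt 3 → ℝ) (i j : Fin 3) (x : Pt 3) : ℝ :=
  pd i (pd j f) x + (pd i (schwLapseSq m) x * pd j f x + pd j (schwLapseSq m) x * pd i f x)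
      / (2 * schwLapseSq m x)
    - ∑ k, pd k f x * (christoffel (schwSlice m) k i j x
      + 1 / 2 * (∑ l, (schwSlice m x)⁻¹ k l * pd l (schwLapseSq m) x) * pd i f x * pd j f x)

theorem schwSFF_apply (hx : x ≠ 0) (hV : schwLapseSq m x ≠ 0) (i j : Fin 3) :
    schwSFF m f x i j = (√(schwConormalSq m f x))⁻¹ * schwNormalAccel m f i j x := by
  rw [schwSFF, schwarzschild_eq_static, secondFundamentalForm_static
    ⟨hV, isUnit_det_schwSlice hx hV, schwSlice_isSymm m x,
      (contDiffAt_schwLapseSq hx).differentiableAt_infty,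
      fun i j => (contDiffAt_schwSlice hx hV i j).differentiableAt_infty⟩]
  rfl

/-- The conormal of a spacelike graph is timelike. -/
theorem schwConormalSq_pos (hm : 0 < m) (hx : x ∈ exterior (2 * m))
    (hpos : (schwMetric m f x).PosDef) : 0 < schwConormalSq m f x := by
  have hV := schwLapseSq_pos hm hx
  have hx0 : x ≠ 0 := ne_zero_of_mem_exterior (by positivity) hx
  set γ := schwSlice m x with hγ
  set d : Fin 3 → ℝ := fun i => pd i f x with hd
  -- The gradient of f is the test vector: with Q = |df|²_γ one has g(v,v) = Q - V Q², and its
  -- positivity forces Q < 1/V when Q > 0.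
  set v : Fin 3 → ℝ := γ⁻¹ *ᵥ d with hv
  set Q : ℝ := d ⬝ᵥ v with hQ
  have hQ' : schwConormalSq m f x = (schwLapseSq m x)⁻¹ - Q := by
    simp only [schwConormalSq, conormalSq, hQ, hv, dotProduct, Matrix.mulVec, Finset.mul_sum, hd]
    congr 1
    refine Finset.sum_congr rfl fun i _ => Finset.sum_congr rfl fun j _ => ?_
    ring
  rw [hQ', sub_pos]
  by_cases hQ0 : Q ≤ 0
  · exact hQ0.trans_lt (inv_pos.2 hV)
  have hv0 : v ≠ 0 := by
    rintro h
    rw [hQ, h, dotProduct_zero] at hQ0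
    exact hQ0 le_rfl
  have hγv : γ *ᵥ v = d := by
    rw [hv, Matrix.mulVec_mulVec,
      Matrix.mul_nonsing_inv _ (isUnit_det_schwSlice hx0 hV.ne'), Matrix.one_mulVec]
  have hg : schwMetric m f x = γ - schwLapseSq m x • Matrix.vecMulVec d d := by
    ext i j
    rw [schwMetric_apply]
    simp [Matrix.vecMulVec_apply, hd, mul_assoc, hγ]
  have h := hpos.dotProduct_mulVec_pos hv0
  rw [hg, Matrix.sub_mulVec, hγv, Matrix.smul_mulVec, Matrix.vecMulVec_mulVec] at h
  simp only [star_trivial, dotProduct_sub, dotProduct_smul, ← hQ, smul_eq_mul,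
    dotProduct_comm v d, MulOpposite.smul_eq_mul_unop, MulOpposite.unop_op] at h
  push Not at hQ0
  rw [← one_div, lt_div_iff₀ hV]
  nlinarith

end Schwarzschild

/-! ### Metrics close to the Euclidean metric -/

theorem IsNear.pd {q c : ℝ} {F : Pt 3 → ℝ} (hF : IsNear q F c) (i : Fin 3) :
    IsSymbol (-q - 1) (pd i F) :=
  (IsSymbol.pd hF i).congr (Eventually.of_forall fun _ => pd_sub_const c)

theorem IsNear.det {q : ℝ} (hq : 0 ≤ q) {A : TensorField 3} {C : Matrix (Fin 3) (Fin 3) ℝ}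
    (hA : ∀ i j, IsNear q (fun x => A x i j) (C i j)) :
    IsNear q (fun x => (A x).det) C.det := by
  simp only [Matrix.det_apply']
  exact IsNear.sum fun σ _ => (IsNear.const q _).mul hq (IsNear.prod hq fun i _ => hA _ _)

/-- Cramer's rule: determinant and cofactors are polynomials in the entries, and the determinant is
near 1. -/
theorem IsNear.matrix_inv {q : ℝ} (hq : 0 < q) {A : TensorField 3}
    (hA : ∀ i j, IsNear q (fun x => A x i j) ((1 : Matrix (Fin 3) (Fin 3) ℝ) i j))
    (i j : Fin 3) :
    IsNear q (fun x => (A x)⁻¹ i j) ((1 : Matrix (Fin 3) (Fin 3) ℝ) i j) := by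
  have hdet : IsNear q (fun x => ((A x).det)⁻¹) 1 := by
    have := IsNear.det hq.le hA
    rw [Matrix.det_one] at this
    exact this.inv hq
  have hadj : IsNear q (fun x => (A x).adjugate i j)
      ((1 : Matrix (Fin 3) (Fin 3) ℝ).adjugate i j) := by
    simp only [Matrix.adjugate_apply]
    refine IsNear.det (A := fun x => (A x).updateRow j (Pi.single i 1)) hq.le fun k l => ?_
    simp only [Matrix.updateRow_apply]
    split_ifs
    · exact IsNear.const q _
    · exact hA k l
  have := hdet.mul hq.le hadj
  simpa [Matrix.inv_def, Ring.inverse_eq_inv', Matrix.adjugate_one] using this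

theorem sum_one_mul (B : Fin 3 → Fin 3 → ℝ) :
    ∑ i, ∑ j, (1 : Matrix (Fin 3) (Fin 3) ℝ) i j * B i j = ∑ i, B i i := by
  simp [Matrix.one_apply]

theorem sum_mul_eq_sum_sub_one_mul_add (A : Matrix (Fin 3) (Fin 3) ℝ) (B : Fin 3 → Fin 3 → ℝ) :
    ∑ i, ∑ j, A i j * B i j
      = (∑ i, ∑ j, (A i j - (1 : Matrix (Fin 3) (Fin 3) ℝ) i j) * B i j) + ∑ i, B i i := by
  rw [← sum_one_mul, ← Finset.sum_add_distrib]
  refine Finset.sum_congr rfl fun i _ => ?_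
  rw [← Finset.sum_add_distrib]
  exact Finset.sum_congr rfl fun j _ => by ring

section NearEuclidean

variable {g : TensorField 3}

/-- Contracting with the inverse metric is contracting with `δ` up to one order. -/
theorem isSymbol_contract_sub
    (hg : ∀ i j, IsNear 1 (fun x => g x i j) ((1 : Matrix (Fin 3) (Fin 3) ℝ) i j))
    {a : ℝ} {B : Fin 3 → Fin 3 → Pt 3 → ℝ} (hB : ∀ i j, IsSymbol a (B i j)) :
    IsSymbol (a - 1) (fun x => ∑ i, ∑ j, (g x)⁻¹ i j * B i j x - ∑ i, B i i x) := by
  have h : IsSymbol (a - 1) (fun x => ∑ i, ∑ j,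
      ((g x)⁻¹ i j - (1 : Matrix (Fin 3) (Fin 3) ℝ) i j) * B i j x) :=
    IsSymbol.sum fun i _ => IsSymbol.sum fun j _ =>
      (IsSymbol.mul (IsNear.matrix_inv one_pos hg i j) (hB i j)).mono (by linarith)
  refine h.congr (Eventually.of_forall fun x => ?_)
  simp only
  rw [sum_mul_eq_sum_sub_one_mul_add _ fun i j => B i j x]
  ring

theorem isSymbol_contract
    (hg : ∀ i j, IsNear 1 (fun x => g x i j) ((1 : Matrix (Fin 3) (Fin 3) ℝ) i j))
    {a : ℝ} {B : Fin 3 → Fin 3 → Pt 3 → ℝ} (hB : ∀ i j, IsSymbol a (B i j)) :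
    IsSymbol a (fun x => ∑ i, ∑ j, (g x)⁻¹ i j * B i j x) :=
  IsSymbol.sum fun i _ => IsSymbol.sum fun j _ => by
    simpa using ((IsNear.matrix_inv one_pos hg i j).isSymbol zero_le_one).mul (hB i j)

theorem isSymbol_christoffel
    (hg : ∀ i j, IsNear 1 (fun x => g x i j) ((1 : Matrix (Fin 3) (Fin 3) ℝ) i j))
    (k i j : Fin 3) : IsSymbol (-2) (christoffel g k i j) := by
  have h : IsSymbol (0 + (-1 - 1)) (fun x => ∑ l, (g x)⁻¹ k l *
      (pd i (fun y => g y j l) x + pd j (fun y => g y i l) x - pd l (fun y => g y i j) x)) :=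
    IsSymbol.sum fun l _ => ((IsNear.matrix_inv one_pos hg k l).isSymbol zero_le_one).mul
      ((((hg j l).pd i).add ((hg i l).pd j)).sub ((hg i j).pd l))
  exact (h.const_mul (1 / 2)).mono (by norm_num)

/-- The ΓΓ terms are O(r^{-4}), hence negligible for b ≥ -4, and any approximation C of Γ may
replace it in the derivative terms. -/
theorem isSymbol_ricci_sub
    (hg : ∀ i j, IsNear 1 (fun x => g x i j) ((1 : Matrix (Fin 3) (Fin 3) ℝ) i j))
    {b : ℝ} (hb : -4 ≤ b) {C : Fin 3 → Fin 3 → Fin 3 → Pt 3 → ℝ}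
    (hC : ∀ k i j, SmoothAtInfinity (C k i j))
    (hΓ : ∀ k i j, IsSymbol (b + 1) (fun x => christoffel g k i j x - C k i j x))
    (i j : Fin 3) :
    IsSymbol b (fun x => ricci g i j x - ∑ k, (pd k (C k i j) x - pd j (C k i k) x)) := by
  have hquad : ∀ k l, IsSymbol b (fun x => christoffel g k k l x * christoffel g l i j x
      - christoffel g k j l x * christoffel g l i k x) := fun k l =>
    (((isSymbol_christoffel hg k k l).mul (isSymbol_christoffel hg l i j)).sub
      ((isSymbol_christoffel hg k j l).mul (isSymbol_christoffel hg l i k))).mono (by linarith)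
  have hlin : ∀ l k i j, IsSymbol b (fun x => pd l (christoffel g k i j) x - pd l (C k i j) x) := by
    intro l k i j
    refine (((hΓ k i j).pd l).mono (b := b) (by linarith)).congr ?_
    filter_upwards [(isSymbol_christoffel hg k i j).smooth, hC k i j] with x h h'
    exact pd_sub h.differentiableAt_infty h'.differentiableAt_infty
  have h : IsSymbol b (fun x => ∑ k, ((pd k (christoffel g k i j) x - pd k (C k i j) x)
      - (pd j (christoffel g k i k) x - pd j (C k i k) x)
      + ∑ l, (christoffel g k k l x * christoffel g l i j x
      - christoffel g k j l x * christoffel g l i k x))) :=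
    IsSymbol.sum fun k _ => ((hlin k k i j).sub (hlin j k i k)).add
      (IsSymbol.sum fun l _ => hquad k l)
  refine h.congr (Eventually.of_forall fun x => ?_)
  simp only [ricci]
  rw [← Finset.sum_sub_distrib]
  exact Finset.sum_congr rfl fun k _ => by ring

theorem isSymbol_ricci
    (hg : ∀ i j, IsNear 1 (fun x => g x i j) ((1 : Matrix (Fin 3) (Fin 3) ℝ) i j))
    (i j : Fin 3) : IsSymbol (-3) (ricci g i j) := by
  have h := isSymbol_ricci_sub hg (b := -3) (by norm_num) (C := fun _ _ _ _ => 0)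
    (fun _ _ _ => IsSymbol.zero (a := 0) |>.smooth)
    (fun k i j => by
      simp only [sub_zero]
      exact (isSymbol_christoffel hg k i j).mono (by norm_num)) i j
  simpa [pd_const] using h

theorem isSymbol_trace_sub
    (hg : ∀ i j, IsNear 1 (fun x => g x i j) ((1 : Matrix (Fin 3) (Fin 3) ℝ) i j))
    {k : TensorField 3} {a : ℝ} (hk : ∀ i j, IsSymbol a (fun x => k x i j)) :
    IsSymbol (a - 1) (fun x => trace g k x - ∑ i, k x i i) :=
  isSymbol_contract_sub hg hk

theorem isSymbol_trace
    (hg : ∀ i j, IsNear 1 (fun x => g x i j) ((1 : Matrix (Fin 3) (Fin 3) ℝ) i j))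
    {k : TensorField 3} {a : ℝ} (hk : ∀ i j, IsSymbol a (fun x => k x i j)) :
    IsSymbol a (trace g k) :=
  isSymbol_contract hg hk

theorem isSymbol_normSq
    (hg : ∀ i j, IsNear 1 (fun x => g x i j) ((1 : Matrix (Fin 3) (Fin 3) ℝ) i j))
    {k : TensorField 3} {a : ℝ} (hk : ∀ i j, IsSymbol a (fun x => k x i j)) :
    IsSymbol (a + a) (normSq g k) := by
  have hinv := fun i j => (IsNear.matrix_inv one_pos hg i j).isSymbol zero_le_one
  exact IsSymbol.sum fun i _ => IsSymbol.sum fun j _ => IsSymbol.sum fun c _ => IsSymbol.sum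
    fun d _ => ((((hinv i c).mul (hinv j d)).mul (hk i j)).mul (hk c d)).mono (by linarith)

theorem isSymbol_covDeriv_sub
    (hg : ∀ i j, IsNear 1 (fun x => g x i j) ((1 : Matrix (Fin 3) (Fin 3) ℝ) i j))
    {k : TensorField 3} {a : ℝ} (hk : ∀ i j, IsSymbol a (fun x => k x i j)) (l i j : Fin 3) :
    IsSymbol (a - 2) (fun x => covDeriv g k l i j x - pd l (fun y => k y i j) x) := by
  have h : IsSymbol (a - 2) (fun x => -∑ c, (christoffel g c l i x * k x c j
      + christoffel g c l j x * k x i c)) :=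
    (IsSymbol.sum fun c _ => (((isSymbol_christoffel hg c l i).mul (hk c j)).add
      ((isSymbol_christoffel hg c l j).mul (hk i c))).mono (by linarith)).neg
  refine h.congr (Eventually.of_forall fun x => ?_)
  simp only [covDeriv]
  ring

/-- The current density agrees with its Euclidean value up to one order. -/
theorem isSymbol_currentDensity_sub
    (hg : ∀ i j, IsNear 1 (fun x => g x i j) ((1 : Matrix (Fin 3) (Fin 3) ℝ) i j))
    {k : TensorField 3} {a : ℝ} (hk : ∀ i j, IsSymbol a (fun x => k x i j)) (j : Fin 3) :
    IsSymbol (a - 2) (fun x => currentDensity g k j x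
      - ∑ l, (pd l (fun y => k y l j) x - pd j (fun y => k y l l) x)) := by
  have hcov : ∀ l i, IsSymbol (a - 1) (covDeriv g k l i j) := fun l i => by
    have := ((isSymbol_covDeriv_sub hg hk l i j).mono (b := a - 1) (by linarith)).add
      ((hk i j).pd l)
    simpa using this
  have hdiv := (isSymbol_contract_sub hg hcov).mono (b := a - 2) (by linarith)
  have hdiag : IsSymbol (a - 2)
      (fun x => ∑ l, (covDeriv g k l l j x - pd l (fun y => k y l j) x)) :=
    IsSymbol.sum fun l _ => isSymbol_covDeriv_sub hg hk l l j
  have htr := ((isSymbol_trace_sub hg hk).pd j).mono (b := a - 2) (by linarith)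
  refine ((hdiv.add hdiag).sub htr).congr ?_
  have hkd : ∀ᶠ x in cobounded (Pt 3), ∀ l : Fin 3, ContDiffAt ℝ ∞ (fun y => k y l l) x :=
    eventually_all.2 fun l => (hk l l).smooth
  filter_upwards [(isSymbol_trace hg hk).smooth, hkd] with x ht hx
  rw [pd_sub ht.differentiableAt_infty (DifferentiableAt.fun_sum fun l _ =>
    (hx l).differentiableAt_infty), pd_sum fun l _ => (hx l).differentiableAt_infty]
  simp only [currentDensity, divergence, Finset.sum_sub_distrib]
  ring

theorem isBigOPow_currentNorm
    (hg : ∀ i j, IsNear 1 (fun x => g x i j) ((1 : Matrix (Fin 3) (Fin 3) ℝ) i j))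
    {k : TensorField 3} {a : ℝ} (hJ : ∀ i, IsSymbol a (currentDensity g k i)) :
    IsBigOPow (currentNorm g k) a := by
  have h := (isSymbol_contract hg fun i j => (hJ i).mul (hJ j)).isBigOPow
  obtain ⟨C, hC⟩ := IsBigO.bound h
  -- The bound C r^{2a} for |J|² becomes √C r^a for |J|.
  refine IsBigO.of_bound (√C) ?_
  filter_upwards [hC, eventually_mem_exterior 0] with x hx hpos
  have hpos : 0 < ‖x‖ := hpos
  have ha : 0 ≤ ‖x‖ ^ a := by positivity
  rw [currentNorm, Real.norm_of_nonneg (Real.sqrt_nonneg _), Real.norm_of_nonneg ha,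
    Real.sqrt_le_iff]
  have hC0 : 0 ≤ C := by
    have h1 := (norm_nonneg _).trans hx
    have h2 : 0 < ‖‖x‖ ^ (a + a)‖ := norm_pos_iff.2 (by positivity)
    exact nonneg_of_mul_nonneg_left h1 h2
  refine ⟨by positivity, ?_⟩
  rw [Real.rpow_add hpos, Real.norm_of_nonneg (mul_nonneg ha ha)] at hx
  rw [mul_pow, Real.sq_sqrt hC0, sq]
  refine le_trans (le_of_eq ?_) ((le_abs_self _).trans hx)
  exact Finset.sum_congr rfl fun i _ => Finset.sum_congr rfl fun j _ => by ring

end NearEuclidean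

/-! ### The leading part of the Schwarzschild metric -/

/-- The term of order `r⁻¹` of the spatial Schwarzschild metric. -/
noncomputable def schwLead (m : ℝ) (i j : Fin 3) (x : Pt 3) : ℝ :=
  2 * m * (x i * x j * ‖x‖ ^ (-3 : ℝ))

/-- The Christoffel symbols of `δ + schwLead m` to first order. -/
noncomputable def schwLeadChristoffel (m : ℝ) (k i j : Fin 3) (x : Pt 3) : ℝ :=
  1 / 2 * (pd i (schwLead m j k) x + pd j (schwLead m i k) x - pd k (schwLead m i j) x)

theorem isHomogeneous_coord_mul_coord (i j : Fin 3) (b : ℝ) :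
    IsHomogeneous (2 + b) (fun x => x i * x j * ‖x‖ ^ b) := by
  have := ((IsHomogeneous.coord i).mul (IsHomogeneous.coord j)).mul (IsHomogeneous.norm_rpow b)
  rwa [one_add_one_eq_two] at this

theorem isHomogeneous_schwLead (m : ℝ) (i j : Fin 3) : IsHomogeneous (-1) (schwLead m i j) := by
  have := (isHomogeneous_coord_mul_coord i j (-3)).const_mul (2 * m)
  rwa [show (2 : ℝ) + -3 = -1 by norm_num] at this

theorem isHomogeneous_schwLeadChristoffel (m : ℝ) (k i j : Fin 3) :
    IsHomogeneous (-1 - 1) (schwLeadChristoffel m k i j) :=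
  ((((isHomogeneous_schwLead m j k).pd i).add ((isHomogeneous_schwLead m i k).pd j)).add
    (((isHomogeneous_schwLead m i j).pd k).const_mul (-1))).const_mul (1 / 2) |>.congr
      fun x _ => by rw [schwLeadChristoffel]; ring

theorem pd_coord_mul_coord_mul_rpow (i j l : Fin 3) (b : ℝ) {x : Pt 3} (hx : x ≠ 0) :
    pd l (fun y : Pt 3 => y i * y j * ‖y‖ ^ b) x =
      x i * x j * (b * x l * ‖x‖ ^ (b - 2))
        + ‖x‖ ^ b * ((if i = l then 1 else 0) * x j + x i * if j = l then 1 else 0) := by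
  have hc : ∀ c : Fin 3, DifferentiableAt ℝ (fun y : Pt 3 => y c) x := fun c =>
    (IsHomogeneous.coord c).differentiableAt hx
  rw [pd_mul ((hc i).fun_mul (hc j)) ((IsHomogeneous.norm_rpow b).differentiableAt hx),
    pd_mul (hc i) (hc j), pd_coord, pd_coord, pd_norm_rpow b l hx]
  ring

theorem pd_schwLead (m : ℝ) (i j l : Fin 3) {x : Pt 3} (hx : x ≠ 0) :
    pd l (schwLead m i j) x = 2 * m * (x i * x j * (-3 * x l * ‖x‖ ^ (-5 : ℝ))
        + ‖x‖ ^ (-3 : ℝ) * ((if i = l then 1 else 0) * x j + x i * if j = l then 1 else 0)) := by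
  have h : schwLead m i j = fun x : Pt 3 => 2 * m * (x i * x j * ‖x‖ ^ (-3 : ℝ)) := rfl
  rw [h, pd_const_mul, pd_coord_mul_coord_mul_rpow i j l _ hx]
  norm_num

theorem norm_sq_mul_rpow {x : Pt 3} (hx : x ≠ 0) (b : ℝ) :
    ‖x‖ ^ b = (x 0 ^ 2 + x 1 ^ 2 + x 2 ^ 2) * ‖x‖ ^ (b - 2) := by
  have hpos : 0 < ‖x‖ := norm_pos_iff.2 hx
  have h := sum_coord_sq x
  rw [Fin.sum_univ_three] at h
  rw [h, ← Real.rpow_two, ← Real.rpow_add hpos]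
  congr 1
  ring

theorem sum_pd_coord_mul_rpow_neg_three {x : Pt 3} (hx : x ≠ 0) :
    ∑ k, pd k (fun y : Pt 3 => y k * ‖y‖ ^ (-3 : ℝ)) x = 0 := by
  have h : ∀ k, pd k (fun y : Pt 3 => y k * ‖y‖ ^ (-3 : ℝ)) x
      = ‖x‖ ^ (-3 : ℝ) - 3 * x k ^ 2 * ‖x‖ ^ (-5 : ℝ) := by
    intro k
    rw [pd_mul ((IsHomogeneous.coord k).differentiableAt hx)
      ((IsHomogeneous.norm_rpow _).differentiableAt hx), pd_coord, pd_norm_rpow _ _ hx]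
    norm_num
    ring
  have hr := norm_sq_mul_rpow hx (-3)
  rw [show (-3 : ℝ) - 2 = -5 by norm_num] at hr
  simp only [h, Fin.sum_univ_three]
  linear_combination 3 * hr

/-- This trace and the next are multiples of x/r³, a divergence-free field, which is why the
linearized scalar curvature of the 1/r term vanishes. -/
theorem sum_schwLeadChristoffel_diag (m : ℝ) (k : Fin 3) {x : Pt 3} (hx : x ≠ 0) :
    ∑ i, schwLeadChristoffel m k i i x = 3 * m * (x k * ‖x‖ ^ (-3 : ℝ)) := by
  have hr := norm_sq_mul_rpow hx (-3)
  norm_num at hr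
  simp only [schwLeadChristoffel, pd_schwLead _ _ _ _ hx, Fin.sum_univ_three]
  fin_cases k <;> simp
  · linear_combination (3 * m * x 0) * hr
  · linear_combination (3 * m * x 1) * hr
  · linear_combination (3 * m * x 2) * hr

theorem sum_schwLeadChristoffel_trace (m : ℝ) (i : Fin 3) {x : Pt 3} (hx : x ≠ 0) :
    ∑ k, schwLeadChristoffel m k i k x = -m * (x i * ‖x‖ ^ (-3 : ℝ)) := by
  have hr := norm_sq_mul_rpow hx (-3)
  norm_num at hr
  simp only [schwLeadChristoffel, pd_schwLead _ _ _ _ hx, Fin.sum_univ_three]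
  fin_cases i <;> simp
  · linear_combination (3 * m * x 0) * hr
  · linear_combination (3 * m * x 1) * hr
  · linear_combination (3 * m * x 2) * hr

/-- The leading part of the Schwarzschild metric is scalar flat to first order. -/
theorem sum_pd_schwLeadChristoffel (m : ℝ) {x : Pt 3} (hx : x ≠ 0) :
    ∑ i, ∑ k, (pd k (schwLeadChristoffel m k i i) x - pd i (schwLeadChristoffel m k i k) x)
      = 0 := by
  have hd : ∀ k i j, DifferentiableAt ℝ (schwLeadChristoffel m k i j) x := fun k i j =>
    (isHomogeneous_schwLeadChristoffel m k i j).differentiableAt hx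
  have hnhds : ∀ᶠ y : Pt 3 in 𝓝 x, y ≠ 0 := isOpen_compl_singleton.mem_nhds hx
  have h1 : ∀ k, ∑ i, pd k (schwLeadChristoffel m k i i) x
      = 3 * m * pd k (fun y : Pt 3 => y k * ‖y‖ ^ (-3 : ℝ)) x := by
    intro k
    rw [← pd_sum (F := fun i => schwLeadChristoffel m k i i) fun i _ => hd k i i, ← pd_const_mul]
    exact pd_congr (hnhds.mono fun y hy => sum_schwLeadChristoffel_diag m k hy)
  have h2 : ∀ i, ∑ k, pd i (schwLeadChristoffel m k i k) x
      = -m * pd i (fun y : Pt 3 => y i * ‖y‖ ^ (-3 : ℝ)) x := by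
    intro i
    rw [← pd_sum (F := fun k => schwLeadChristoffel m k i k) fun k _ => hd k i k, ← pd_const_mul]
    exact pd_congr (hnhds.mono fun y hy => sum_schwLeadChristoffel_trace m i hy)
  simp only [Finset.sum_sub_distrib]
  rw [Finset.sum_comm]
  simp only [h1, h2, ← Finset.mul_sum, sum_pd_coord_mul_rpow_neg_three hx]
  ring

theorem isSymbol_pd_sub_schwLead {g : TensorField 3} {m : ℝ}
    (hg : ∀ i j, IsNear 1 (fun x => g x i j) ((1 : Matrix (Fin 3) (Fin 3) ℝ) i j))
    (he : ∀ i j, IsSymbol (-4 / 3) (fun x => g x i j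
      - ((1 : Matrix (Fin 3) (Fin 3) ℝ) i j + schwLead m i j x))) (l i j : Fin 3) :
    IsSymbol (-7 / 3) (fun x => pd l (fun y => g y i j) x - pd l (schwLead m i j) x) := by
  refine (((he i j).pd l).mono (b := -7 / 3) (by norm_num)).congr ?_
  filter_upwards [((hg i j).isSymbol zero_le_one).smooth,
    (isHomogeneous_schwLead m i j).isSymbol.smooth] with x h h'
  rw [pd_sub h.differentiableAt_infty (h'.differentiableAt_infty.const_add _), pd_const_add]

/-- A metric with the leading part of the Schwarzschild metric has scalar curvature
`O(r^{-10/3})`. -/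
theorem isSymbol_scalarCurvature {g : TensorField 3} {m : ℝ}
    (hg : ∀ i j, IsNear 1 (fun x => g x i j) ((1 : Matrix (Fin 3) (Fin 3) ℝ) i j))
    (he : ∀ i j, IsSymbol (-4 / 3) (fun x => g x i j
      - ((1 : Matrix (Fin 3) (Fin 3) ℝ) i j + schwLead m i j x))) :
    IsSymbol (-10 / 3) (scalarCurvature g) := by
  have hpd := isSymbol_pd_sub_schwLead hg he
  -- The exponent is -7/3, the order of the error in ∂g. Replacing g⁻¹ by δ costs only O(r^{-3}).
  have hΓ : ∀ k i j, IsSymbol (-10 / 3 + 1)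
      (fun x => christoffel g k i j x - schwLeadChristoffel m k i j x) := by
    intro k i j
    have h1 : IsSymbol (-7 / 3) (fun x => ∑ l, ((g x)⁻¹ k l
        - (1 : Matrix (Fin 3) (Fin 3) ℝ) k l) *
      (pd i (fun y => g y j l) x + pd j (fun y => g y i l) x - pd l (fun y => g y i j) x)) :=
      IsSymbol.sum fun l _ => (IsSymbol.mul (IsNear.matrix_inv one_pos hg k l)
        ((((hg j l).pd i).add ((hg i l).pd j)).sub ((hg i j).pd l))).mono (by norm_num)
    have h2 := ((hpd i j k).add (hpd j i k)).sub (hpd k i j)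
    refine (((h1.add h2).const_mul (1 / 2)).mono (b := -10 / 3 + 1) (by norm_num)).congr
      (Eventually.of_forall fun x => ?_)
    simp only [christoffel, schwLeadChristoffel, sub_mul, Finset.sum_sub_distrib]
    simp only [Matrix.one_apply, ite_mul, one_mul, zero_mul, Finset.sum_ite_eq, Finset.mem_univ,
      if_true]
    ring
  have hRic := isSymbol_ricci_sub hg (b := -10 / 3) (by norm_num)
    (fun k i j => (isHomogeneous_schwLeadChristoffel m k i j).isSymbol.smooth) hΓ
  have h1 := (isSymbol_contract_sub hg (isSymbol_ricci hg)).mono (b := -10 / 3) (by norm_num)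
  have h2 := IsSymbol.sum (s := Finset.univ) fun i _ => hRic i i
  refine (h1.add h2).congr ?_
  filter_upwards [eventually_cobounded_ne_zero] with x hx
  rw [Finset.sum_sub_distrib, sum_pd_schwLeadChristoffel m hx]
  simp only [scalarCurvature]
  ring

/-! ### Asymptotics of the data of a graph -/

theorem IsNear.add_isSymbol {q c : ℝ} {F G : Pt 3 → ℝ} (hF : IsNear q F c)
    (hG : IsSymbol (-q) G) : IsNear q (fun x => F x + G x) c := by
  refine (IsSymbol.add hF hG).congr (Eventually.of_forall fun x => ?_)
  simp only
  ring

section Asymptotics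

variable {m : ℝ} {f : Pt 3 → ℝ}

theorem isNear_schwLapseSq (m : ℝ) : IsNear 1 (schwLapseSq m) 1 := by
  refine ((IsHomogeneous.norm_rpow (-1)).isSymbol.const_mul (-2 * m)).congr
    (Eventually.of_forall fun x => ?_)
  simp only [schwLapseSq, Real.rpow_neg_one]
  ring

theorem eventually_schwLapseSq_pos (m : ℝ) :
    ∀ᶠ x in cobounded (Pt 3), 0 < schwLapseSq m x :=
  ((isNear_schwLapseSq m).tendsto one_pos).eventually (lt_mem_nhds one_pos)

theorem isNear_schwLapseSq_inv (m : ℝ) : IsNear 1 (fun x => (schwLapseSq m x)⁻¹) 1 :=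
  (isNear_schwLapseSq m).inv one_pos

theorem isSymbol_schwSlice_sub (m : ℝ) (i j : Fin 3) :
    IsSymbol (-2) (fun x => schwSlice m x i j
      - ((1 : Matrix (Fin 3) (Fin 3) ℝ) i j + schwLead m i j x)) := by
  -- Since V⁻¹ - 1 = (2m/r) V⁻¹, the remainder beyond 2m/r is (2m/r)(V⁻¹ - 1), of order r^{-2}.
  have h := (((IsHomogeneous.norm_rpow (-1)).isSymbol.const_mul (2 * m)).mul
    (isNear_schwLapseSq_inv m)).mul (isHomogeneous_coord_mul_coord i j (-2)).isSymbol
  refine (h.mono (by norm_num)).congr ?_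
  filter_upwards [eventually_schwLapseSq_pos m, eventually_cobounded_ne_zero] with x hV hx
  have hr : ‖x‖ ≠ 0 := norm_ne_zero_iff.2 hx
  have h3 : ‖x‖ ^ (-3 : ℝ) = (‖x‖ ^ 3)⁻¹ := by
    rw [Real.rpow_neg (norm_nonneg x)]
    norm_cast
  have h2 : ‖x‖ ^ (-2 : ℝ) = (‖x‖ ^ 2)⁻¹ := by
    rw [Real.rpow_neg (norm_nonneg x)]
    norm_cast
  have hm : 2 * m * ‖x‖⁻¹ = 1 - schwLapseSq m x := by
    rw [schwLapseSq]
    ring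
  have hVV : (schwLapseSq m x)⁻¹ * schwLapseSq m x = 1 := inv_mul_cancel₀ hV.ne'
  simp only [schwSlice, Matrix.of_apply, Matrix.one_apply, schwLead, h3, h2, Real.rpow_neg_one]
  have hl : 2 * m * (x i * x j * (‖x‖ ^ 3)⁻¹)
      = (1 - schwLapseSq m x) * (x i * x j * (‖x‖ ^ 2)⁻¹) := by
    rw [← hm]
    field_simp
  rw [hl, hm]
  field_simp
  ring

theorem isNear_schwSlice (m : ℝ) (i j : Fin 3) :
    IsNear 1 (fun x => schwSlice m x i j) ((1 : Matrix (Fin 3) (Fin 3) ℝ) i j) := by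
  have h := ((isSymbol_schwSlice_sub m i j).mono (b := -1) (by norm_num)).add
    (isHomogeneous_schwLead m i j).isSymbol
  refine h.congr (Eventually.of_forall fun x => ?_)
  simp only
  ring

theorem isSymbol_pd_mul_pd (hf : IsHomogeneous (1 / 3) f) (i j : Fin 3) :
    IsSymbol (-4 / 3) (fun x => pd i f x * pd j f x) :=
  ((hf.pd i).isSymbol.mul (hf.pd j).isSymbol).mono (by norm_num)

/-- The graph enters only through V df⊗df, of order 2(1/3 - 1) = -4/3. This lies below the 1/r term,
so the graph does not affect the energy. -/
theorem isSymbol_schwMetric_sub (m : ℝ) (hf : IsHomogeneous (1 / 3) f) (i j : Fin 3) :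
    IsSymbol (-4 / 3) (fun x => schwMetric m f x i j
      - ((1 : Matrix (Fin 3) (Fin 3) ℝ) i j + schwLead m i j x)) := by
  have h := ((isNear_schwLapseSq m).isSymbol zero_le_one).mul (isSymbol_pd_mul_pd hf i j)
  refine (((isSymbol_schwSlice_sub m i j).mono (b := -4 / 3) (by norm_num)).sub
    (h.mono (b := -4 / 3) (by norm_num))).congr (Eventually.of_forall fun x => ?_)
  simp only [schwMetric_apply]
  ring

theorem isNear_schwMetric (m : ℝ) (hf : IsHomogeneous (1 / 3) f) (i j : Fin 3) :
    IsNear 1 (fun x => schwMetric m f x i j) ((1 : Matrix (Fin 3) (Fin 3) ℝ) i j) := by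
  have h := ((isSymbol_schwMetric_sub m hf i j).mono (b := -1) (by norm_num)).add
    (isHomogeneous_schwLead m i j).isSymbol
  refine h.congr (Eventually.of_forall fun x => ?_)
  simp only
  ring

theorem isSymbol_gradSq (m : ℝ) (hf : IsHomogeneous (1 / 3) f) :
    IsSymbol (-4 / 3)
      (fun x => ∑ i, ∑ j, (schwSlice m x)⁻¹ i j * (pd i f x * pd j f x)) :=
  isSymbol_contract (isNear_schwSlice m) fun i j => isSymbol_pd_mul_pd hf i j

theorem isNear_schwConormalSq (m : ℝ) (hf : IsHomogeneous (1 / 3) f) :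
    IsNear 1 (schwConormalSq m f) 1 := by
  refine (IsNear.add_isSymbol (isNear_schwLapseSq_inv m)
    ((isSymbol_gradSq m hf).neg.mono (by norm_num))).congr (Eventually.of_forall fun x => ?_)
  simp only [schwConormalSq, conormalSq, mul_assoc, sub_eq_add_neg]

theorem isNear_inv_sqrt {F : Pt 3 → ℝ} {q : ℝ} (hF : IsNear q F 1) (hq : 0 < q) :
    IsNear q (fun x => (√(F x))⁻¹) 1 := by
  refine (hF.rpow hq (-(1 / 2))).congr ?_
  filter_upwards [(hF.tendsto hq).eventually (lt_mem_nhds one_pos)] with x hx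
  rw [Real.sqrt_eq_rpow, Real.rpow_neg hx.le]

/-- All corrections to the Hessian contain dV or Γ, of order r^{-2}, and at least one factor df, of
order r^{-2/3}. -/
theorem isSymbol_schwNormalAccel_sub (m : ℝ) (hf : IsHomogeneous (1 / 3) f) (i j : Fin 3) :
    IsSymbol (-8 / 3) (fun x => schwNormalAccel m f i j x - pd i (pd j f) x) := by
  have hV := fun i => (isNear_schwLapseSq m).pd i
  have hf' := fun i => (hf.pd i).isSymbol
  have h1 : IsSymbol (-8 / 3) (fun x => (pd i (schwLapseSq m) x * pd j f x
      + pd j (schwLapseSq m) x * pd i f x) * ((schwLapseSq m x)⁻¹ * (1 / 2))) :=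
    ((((hV i).mul (hf' j)).add ((hV j).mul (hf' i))).mul
      (((isNear_schwLapseSq_inv m).isSymbol zero_le_one).mul (IsSymbol.const (1 / 2)))).mono
      (by norm_num)
  have hgrad : ∀ k, IsSymbol (-2)
      (fun x => ∑ l, (schwSlice m x)⁻¹ k l * pd l (schwLapseSq m) x) := fun k =>
    IsSymbol.sum fun l _ =>
      (((IsNear.matrix_inv one_pos (isNear_schwSlice m) k l).isSymbol zero_le_one).mul
        (hV l)).mono (by norm_num)
  have h2 : ∀ k, IsSymbol (-2) (fun x => christoffel (schwSlice m) k i j x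
      + 1 / 2 * (∑ l, (schwSlice m x)⁻¹ k l * pd l (schwLapseSq m) x) * pd i f x * pd j f x) :=
    fun k => (isSymbol_christoffel (isNear_schwSlice m) k i j).add
      (((((hgrad k).const_mul (1 / 2)).mul (hf' i)).mul (hf' j)).mono (by norm_num))
  have h3 := IsSymbol.sum (s := Finset.univ) fun k _ =>
    ((hf' k).mul (h2 k)).mono (b := -8 / 3) (by norm_num)
  refine (h1.sub h3).congr (Eventually.of_forall fun x => ?_)
  simp only [schwNormalAccel]
  ring

theorem isSymbol_hessian (hf : IsHomogeneous (1 / 3) f) (i j : Fin 3) :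
    IsSymbol (-5 / 3) (pd i (pd j f)) :=
  ((hf.pd j).pd i).isSymbol.mono (by norm_num)

theorem eventually_schwSFF_apply (m : ℝ) (f : Pt 3 → ℝ) (i j : Fin 3) :
    (fun x => (√(schwConormalSq m f x))⁻¹ * schwNormalAccel m f i j x)
      =ᶠ[cobounded (Pt 3)] fun x => schwSFF m f x i j := by
  filter_upwards [eventually_schwLapseSq_pos m, eventually_cobounded_ne_zero] with x hV hx
  rw [schwSFF_apply hx hV.ne']

theorem isSymbol_schwSFF_sub (m : ℝ) (hf : IsHomogeneous (1 / 3) f) (i j : Fin 3) :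
    IsSymbol (-8 / 3) (fun x => schwSFF m f x i j - pd i (pd j f) x) := by
  have hW := isNear_inv_sqrt (isNear_schwConormalSq m hf) one_pos
  have h1 := ((hW.isSymbol zero_le_one).mul (isSymbol_schwNormalAccel_sub m hf i j)).mono
    (b := -8 / 3) (by norm_num)
  have h2 := (IsSymbol.mul hW (isSymbol_hessian hf i j)).mono (b := -8 / 3) (by norm_num)
  refine (h1.add h2).congr ?_
  filter_upwards [eventually_schwSFF_apply m f i j] with x hx
  rw [← hx]
  ring

theorem isSymbol_schwSFF (m : ℝ) (hf : IsHomogeneous (1 / 3) f) (i j : Fin 3) :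
    IsSymbol (-5 / 3) (fun x => schwSFF m f x i j) := by
  simpa using ((isSymbol_schwSFF_sub m hf i j).mono (b := -5 / 3) (by norm_num)).add
    (isSymbol_hessian hf i j)

/-- The k² terms have order 2·(-5/3) = -10/3, the same as the scalar curvature. -/
theorem isSymbol_massDensity (m : ℝ) (hf : IsHomogeneous (1 / 3) f) :
    IsSymbol (-10 / 3) (massDensity (schwMetric m f) (schwSFF m f)) := by
  have hg := isNear_schwMetric m hf
  have hk := isSymbol_schwSFF m hf
  have h1 := isSymbol_scalarCurvature hg (isSymbol_schwMetric_sub m hf)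
  have h2 := (isSymbol_normSq hg hk).mono (b := -10 / 3) (by norm_num)
  have h3 := ((isSymbol_trace hg hk).mul (isSymbol_trace hg hk)).mono (b := -10 / 3) (by norm_num)
  refine (((h1.sub h2).add h3).const_mul (1 / 2)).congr (Eventually.of_forall fun x => ?_)
  simp only [massDensity, sq]

/-- The derivative of k is only O(r^{-8/3}), which would be too slow. For the Euclidean Hessian the
leading terms ∂ₗ∂ₗ∂ⱼf - ∂ⱼ∂ₗ∂ₗf cancel, and one power of r⁻¹ is gained. -/
theorem isSymbol_currentDensity (m : ℝ) (hf : IsHomogeneous (1 / 3) f) (j : Fin 3) :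
    IsSymbol (-11 / 3) (currentDensity (schwMetric m f) (schwSFF m f) j) := by
  have hk := isSymbol_schwSFF m hf
  have hpd : ∀ l i j, IsSymbol (-11 / 3)
      (fun x => pd l (fun y => schwSFF m f y i j) x - pd l (pd i (pd j f)) x) := by
    intro l i j
    refine (((isSymbol_schwSFF_sub m hf i j).pd l).mono (b := -11 / 3) (by norm_num)).congr ?_
    filter_upwards [(hk i j).smooth, (isSymbol_hessian hf i j).smooth] with x h h'
    exact pd_sub h.differentiableAt_infty h'.differentiableAt_infty
  have h1 := (isSymbol_currentDensity_sub (isNear_schwMetric m hf) hk j).mono (b := -11 / 3)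
    (by norm_num)
  have h2 := IsSymbol.sum (s := Finset.univ) fun l _ => (hpd l l j).sub (hpd j l l)
  refine (h1.add h2).congr ?_
  filter_upwards [eventually_cobounded_ne_zero] with x hx
  have hcomm : ∀ l, pd l (pd l (pd j f)) x = pd j (pd l (pd l f)) x := by
    intro l
    rw [pd_comm (((hf.pd l).contDiffAt hx).of_le ENat.LEInfty.out) j l]
    refine pd_congr ?_
    filter_upwards [isOpen_compl_singleton.mem_nhds hx] with y hy
    exact pd_comm ((hf.contDiffAt hy).of_le ENat.LEInfty.out) l j
  rw [← eq_sub_iff_add_eq']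
  simp only [hcomm, Finset.sum_sub_distrib]
  ring

/-! ### Smoothness and asymptotic flatness -/

theorem contDiffAt_schwMetric (hf : IsHomogeneous (1 / 3) f) {x : Pt 3} (hx : x ≠ 0)
    (hV : schwLapseSq m x ≠ 0) (i j : Fin 3) :
    ContDiffAt ℝ ∞ (fun y => schwMetric m f y i j) x := by
  simp only [schwMetric_apply]
  exact (contDiffAt_schwSlice hx hV i j).sub
    (((contDiffAt_schwLapseSq hx).mul ((hf.pd i).contDiffAt hx)).mul ((hf.pd j).contDiffAt hx))

theorem eventually_nhds_schwLapseSq_ne_zero {x : Pt 3} (hx : x ≠ 0) (hV : schwLapseSq m x ≠ 0) :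
    ∀ᶠ y in 𝓝 x, y ≠ 0 ∧ schwLapseSq m y ≠ 0 :=
  (eventually_ne_nhds hx).and
    ((contDiffAt_schwLapseSq hx).continuousAt.eventually_ne hV)

theorem contDiffAt_schwSlice_inv {x : Pt 3} (hx : x ≠ 0) (hV : schwLapseSq m x ≠ 0)
    (i j : Fin 3) : ContDiffAt ℝ ∞ (fun y => (schwSlice m y)⁻¹ i j) x := by
  have hc : ∀ i, ContDiffAt ℝ ∞ (fun y : Pt 3 => y i / ‖y‖) x := fun i =>
    (contDiff_coord i).contDiffAt.div (contDiffAt_norm ℝ hx) (norm_ne_zero_iff.2 hx)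
  have h : ContDiffAt ℝ ∞ (fun y : Pt 3 => (if i = j then (1 : ℝ) else 0)
      - (1 - schwLapseSq m y) * (y i / ‖y‖) * (y j / ‖y‖)) x :=
    contDiffAt_const.sub
      (((contDiffAt_const.sub (contDiffAt_schwLapseSq hx)).mul (hc i)).mul (hc j))
  refine h.congr_of_eventuallyEq ?_
  filter_upwards [eventually_nhds_schwLapseSq_ne_zero hx hV] with y hy
  exact schwSlice_inv hy.1 hy.2 i j

theorem contDiffAt_christoffel_schwSlice {x : Pt 3} (hx : x ≠ 0) (hV : schwLapseSq m x ≠ 0)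
    (k i j : Fin 3) : ContDiffAt ℝ ∞ (christoffel (schwSlice m) k i j) x :=
  contDiffAt_const.mul (ContDiffAt.sum fun l _ => (contDiffAt_schwSlice_inv hx hV k l).mul
    ((((contDiffAt_schwSlice hx hV j l).pd i).add ((contDiffAt_schwSlice hx hV i l).pd j)).sub
      ((contDiffAt_schwSlice hx hV i j).pd l)))

theorem contDiffAt_schwSFF (hf : IsHomogeneous (1 / 3) f) {x : Pt 3} (hx : x ≠ 0)
    (hV : schwLapseSq m x ≠ 0) (hpos : 0 < schwConormalSq m f x) (i j : Fin 3) :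
    ContDiffAt ℝ ∞ (fun y => schwSFF m f y i j) x := by
  have hf' : ∀ i, ContDiffAt ℝ ∞ (pd i f) x := fun i => (hf.pd i).contDiffAt hx
  have hV' : ∀ i, ContDiffAt ℝ ∞ (pd i (schwLapseSq m)) x := fun i =>
    (contDiffAt_schwLapseSq hx).pd i
  have hN : ContDiffAt ℝ ∞ (schwConormalSq m f) x :=
    ((contDiffAt_schwLapseSq hx).inv hV).sub (ContDiffAt.sum fun i _ => ContDiffAt.sum fun j _ =>
      ((contDiffAt_schwSlice_inv hx hV i j).mul (hf' i)).mul (hf' j))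
  have hA : ContDiffAt ℝ ∞ (schwNormalAccel m f i j) x := by
    refine ((((hf' j).pd i).add ((((hV' i).mul (hf' j)).add ((hV' j).mul (hf' i))).div
      (contDiffAt_const.mul (contDiffAt_schwLapseSq hx)) (mul_ne_zero two_ne_zero hV)))).sub
      (ContDiffAt.sum fun k _ => (hf' k).mul
        ((contDiffAt_christoffel_schwSlice hx hV k i j).add (((contDiffAt_const.mul
          (ContDiffAt.sum fun l _ => (contDiffAt_schwSlice_inv hx hV k l).mul (hV' l))).mul
            (hf' i)).mul (hf' j))))
  refine (((hN.sqrt hpos.ne').inv (Real.sqrt_pos.2 hpos).ne').mul hA).congr_of_eventuallyEq ?_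
  filter_upwards [eventually_nhds_schwLapseSq_ne_zero hx hV] with y hy
  exact schwSFF_apply hy.1 hy.2 i j

theorem christoffel_schwSlice_symm (m : ℝ) (k i j : Fin 3) (x : Pt 3) :
    christoffel (schwSlice m) k i j x = christoffel (schwSlice m) k j i x := by
  have hs : ∀ i j, (fun y => schwSlice m y i j) = fun y => schwSlice m y j i := fun i j =>
    funext fun y => (schwSlice_isSymm m y).apply j i
  simp only [christoffel, hs i j]
  congr 1
  exact Finset.sum_congr rfl fun l _ => by ring

theorem schwSFF_isSymm (hf : IsHomogeneous (1 / 3) f) {x : Pt 3} (hx : x ≠ 0)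
    (hV : schwLapseSq m x ≠ 0) : (schwSFF m f x).IsSymm := by
  ext i j
  rw [Matrix.transpose_apply, schwSFF_apply hx hV, schwSFF_apply hx hV]
  congr 1
  rw [schwNormalAccel, schwNormalAccel,
    pd_comm ((hf.contDiffAt hx).of_le ENat.LEInfty.out) i j]
  congr 1
  · ring
  · refine Finset.sum_congr rfl fun k _ => ?_
    rw [christoffel_schwSlice_symm m k i j]
    ring

theorem schwMetric_isSymm (m : ℝ) (f : Pt 3 → ℝ) (x : Pt 3) : (schwMetric m f x).IsSymm := by
  ext i j
  rw [Matrix.transpose_apply, schwMetric_apply, schwMetric_apply, (schwSlice_isSymm m x).apply]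
  ring

theorem posDef_of_near_one {A : Matrix (Fin 3) (Fin 3) ℝ} (hs : A.IsSymm)
    (hA : ∀ i j, |A i j - (1 : Matrix (Fin 3) (Fin 3) ℝ) i j| < 1 / 6) : A.PosDef := by
  refine Matrix.PosDef.of_dotProduct_mulVec_pos (by simpa [Matrix.IsHermitian] using hs.eq)
    fun v hv => ?_
  have hvv : 0 < v ⬝ᵥ v := lt_of_le_of_ne (Finset.sum_nonneg fun i _ => mul_self_nonneg _)
    (Ne.symm (dotProduct_self_eq_zero.not.2 hv))
  -- An entry error below 1/6 costs at most (vᵢ² + vⱼ²)/12. The nine terms together cost |v|²/2,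
  -- leaving v·Av ≥ |v|²/2 > 0.
  have hterm : ∀ i j, (1 : Matrix (Fin 3) (Fin 3) ℝ) i j * (v i * v j)
      - 1 / 12 * (v i * v i) - 1 / 12 * (v j * v j) ≤ v i * (A i j * v j) := by
    intro i j
    have h := abs_lt.1 (hA i j)
    nlinarith [sq_nonneg (v i + v j), sq_nonneg (v i - v j), h.1, h.2]
  have hsum := Finset.sum_le_sum fun i (_ : i ∈ Finset.univ) =>
    Finset.sum_le_sum fun j (_ : j ∈ Finset.univ) => hterm i j
  simp only [Finset.sum_sub_distrib, sum_one_mul, Finset.sum_const, ← Finset.mul_sum,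
    Finset.card_univ, Fintype.card_fin] at hsum
  simp only [dotProduct] at hvv
  simp only [star_trivial, dotProduct, Matrix.mulVec]
  refine lt_of_lt_of_le ?_ hsum
  simp only [nsmul_eq_mul, ← Finset.mul_sum]
  push_cast
  linarith

theorem exists_isSpacelikeGraph (m : ℝ) (hf : IsHomogeneous (1 / 3) f) :
    ∃ R : ℝ, 2 * m ≤ R ∧ IsSpacelikeGraph m f R := by
  have hev : ∀ᶠ x in cobounded (Pt 3), ∀ i j,
      |schwMetric m f x i j - (1 : Matrix (Fin 3) (Fin 3) ℝ) i j| < 1 / 6 := by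
    refine eventually_all.2 fun i => eventually_all.2 fun j => ?_
    have h := (IsSymbol.isBigOPow (isNear_schwMetric m hf i j)).tendsto_zero (by norm_num)
    have h' := h.abs
    rw [abs_zero] at h'
    exact h'.eventually (gt_mem_nhds (by norm_num))
  obtain ⟨R, hR⟩ := eventually_cobounded_iff.1 hev
  exact ⟨max (2 * m) R, le_max_left _ _, fun x hx =>
    posDef_of_near_one (schwMetric_isSymm m f x) (hR x ((le_max_right (2 * m) R).trans_lt hx))⟩

theorem isAsymptoticallyFlatEnd (hm : 0 < m) (hf : IsHomogeneous (1 / 3) f) {R : ℝ}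
    (hR : 2 * m ≤ R) (hs : IsSpacelikeGraph m f R) :
    IsAsymptoticallyFlatEnd R (schwMetric m f) (schwSFF m f) := by
  have hmem : ∀ x ∈ exterior R, x ∈ exterior (2 * m) := fun x hx => hR.trans_lt hx
  have hx0 : ∀ x ∈ exterior R, x ≠ 0 := fun x hx =>
    ne_zero_of_mem_exterior (by positivity) (hmem x hx)
  have hV : ∀ x ∈ exterior R, schwLapseSq m x ≠ 0 := fun x hx =>
    (schwLapseSq_pos hm (hmem x hx)).ne'
  refine ⟨fun i j x hx => (contDiffAt_schwMetric hf (hx0 x hx) (hV x hx) i j).contDiffWithinAt,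
    fun i j x hx => (contDiffAt_schwSFF hf (hx0 x hx) (hV x hx)
      (schwConormalSq_pos hm (hmem x hx) (hs x hx)) i j).contDiffWithinAt,
    hs, fun x hx => schwSFF_isSymm hf (hx0 x hx) (hV x hx),
    -- Here q, p and ε: p is the order of the Hessian, and ε = 1/3 is dictated by μ = O(r^{-10/3}).
    1, 5 / 3, 1 / 3, by norm_num, by norm_num, by norm_num,
    fun i j => (isNear_schwMetric m hf i j).isBigOPow₂,
    fun i j => ((isSymbol_schwSFF m hf i j).mono (by norm_num)).isBigOPow₁,
    ((isSymbol_massDensity m hf).mono (by norm_num)).isBigOPow, ?_⟩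
  exact (isBigOPow_currentNorm (isNear_schwMetric m hf) (isSymbol_currentDensity m hf)).mono
    (by norm_num)

end Asymptotics

/-! ### Energy -/

section Charges

variable {m : ℝ} {f : Pt 3 → ℝ}

theorem isHomogeneous_coord_div_norm (i : Fin 3) : IsHomogeneous 0 (fun x => x i / ‖x‖) := by
  have h := (IsHomogeneous.coord i).mul (IsHomogeneous.norm_rpow (-1))
  rw [show (1 : ℝ) + -1 = 0 by norm_num] at h
  exact h.congr fun x _ => by rw [Real.rpow_neg_one, div_eq_mul_inv]

theorem sum_pd_schwLead (m : ℝ) {x : Pt 3} (hx : x ≠ 0) :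
    ∑ j, ∑ k, (pd k (schwLead m j k) x - pd j (schwLead m k k) x) * (x j / ‖x‖)
      = 4 * m * ‖x‖ ^ (-2 : ℝ) := by
  have hr1 := norm_sq_mul_rpow hx (-1)
  have hr3 := norm_sq_mul_rpow hx (-3)
  rw [show (-1 : ℝ) - 2 = -3 by norm_num] at hr1
  rw [show (-3 : ℝ) - 2 = -5 by norm_num] at hr3
  have h2 : ‖x‖ ^ (-2 : ℝ) = ‖x‖ ^ (-1 : ℝ) * ‖x‖ ^ (-1 : ℝ) := by
    rw [← Real.rpow_add (norm_pos_iff.2 hx)]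
    norm_num
  simp only [pd_schwLead _ _ _ _ hx, div_eq_mul_inv, ← Real.rpow_neg_one, h2]
  generalize ‖x‖ ^ (-1 : ℝ) = a at *
  generalize ‖x‖ ^ (-3 : ℝ) = b at *
  simp [Fin.sum_univ_three]
  linear_combination (-4 * m * a) * hr1

/-- The 1/r term has flux density 4m/r², whose integral is 16πm. The remaining first derivatives are
O(r^{-7/3}) and drop out. -/
theorem hasADMEnergy_schwMetric (m : ℝ) (hf : IsHomogeneous (1 / 3) f) :
    HasADMEnergy (schwMetric m f) m := by
  have hmain : IsHomogeneous (-2) (fun x : Pt 3 => 4 * m * ‖x‖ ^ (-2 : ℝ)) :=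
    (IsHomogeneous.norm_rpow (-2)).const_mul (4 * m)
  have h1 := hasSphereLimit_of_isHomogeneous hmain
  have hint : ∫ u : Metric.sphere (0 : Pt 3) 1, 4 * m * ‖(u : Pt 3)‖ ^ (-2 : ℝ)
      ∂(volume : Measure (Pt 3)).toSphere = 16 * Real.pi * m := by
    simp only [norm_eq_of_mem_sphere, Real.one_rpow, integral_const, toSphere_univ, smul_eq_mul]
    ring
  rw [hint] at h1
  have hpd := isSymbol_pd_sub_schwLead (isNear_schwMetric m hf) (isSymbol_schwMetric_sub m hf)
  have herr : IsSymbol (-7 / 3) (fun x => ∑ j, ∑ k,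
      ((pd k (fun y => schwMetric m f y j k) x - pd k (schwLead m j k) x)
        - (pd j (fun y => schwMetric m f y k k) x - pd j (schwLead m k k) x)) * (x j / ‖x‖)) :=
    IsSymbol.sum fun j _ => IsSymbol.sum fun k _ =>
      (((hpd k j k).sub (hpd j k k)).mul (isHomogeneous_coord_div_norm j).isSymbol).mono
        (by norm_num)
  have h := h1.add (hasSphereLimit_of_isSymbol herr (by norm_num))
  rw [add_zero] at h
  refine HasSphereLimit.congr h ?_
  filter_upwards [eventually_cobounded_ne_zero] with x hx
  rw [← sum_pd_schwLead m hx, ← Finset.sum_add_distrib]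
  refine Finset.sum_congr rfl fun j _ => ?_
  rw [← Finset.sum_add_distrib]
  exact Finset.sum_congr rfl fun k _ => by ring

/-! ### Parity, linear momentum and centre of mass -/

theorem pd_of_odd {n : ℕ} {F : Pt n → ℝ} (hF : ∀ y, F (-y) = -F y) (i : Fin n) (x : Pt n) :
    pd i F (-x) = pd i F x := by
  have h := fderiv_comp_smul (𝕜 := ℝ) (f := F) (x := x) (-1)
  simp only [neg_smul, one_smul, hF, fderiv_fun_neg] at h
  simp only [pd]
  have h' := congrArg (fun L : Pt n →L[ℝ] ℝ => L (EuclideanSpace.single i 1)) h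
  simpa using h'.symm

theorem schwLapseSq_neg (m : ℝ) (x : Pt 3) : schwLapseSq m (-x) = schwLapseSq m x := by
  simp [schwLapseSq]

theorem schwSlice_neg (m : ℝ) (x : Pt 3) : schwSlice m (-x) = schwSlice m x := by
  ext i j
  simp [schwSlice, schwLapseSq_neg]
  ring

theorem christoffel_schwSlice_neg (m : ℝ) (k i j : Fin 3) (x : Pt 3) :
    christoffel (schwSlice m) k i j (-x) = -christoffel (schwSlice m) k i j x := by
  have h : ∀ l i j, pd l (fun y => schwSlice m y i j) (-x)
      = -pd l (fun y => schwSlice m y i j) x := fun l i j =>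
    pd_of_even (fun y => by rw [schwSlice_neg]) x
  simp only [christoffel, schwSlice_neg, h, ← mul_neg, ← Finset.sum_neg_distrib]
  congr 1
  exact Finset.sum_congr rfl fun l _ => by ring

theorem schwMetric_neg (m : ℝ) (he : ∀ x, f (-x) = f x) (x : Pt 3) :
    schwMetric m f (-x) = schwMetric m f x := by
  ext i j
  rw [schwMetric_apply, schwMetric_apply, schwSlice_neg, schwLapseSq_neg, pd_of_even he,
    pd_of_even he]
  ring

/-- With f, V and γ even, first derivatives and Christoffel symbols are odd and Hessians even. Every
term of the formula for k then contains an even number of odd factors. -/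
theorem schwSFF_neg (he : ∀ x, f (-x) = f x) {x : Pt 3} (hx : x ≠ 0)
    (hV : schwLapseSq m x ≠ 0) : schwSFF m f (-x) = schwSFF m f x := by
  ext i j
  have hd : ∀ l, pd l f (-x) = -pd l f x := fun l => pd_of_even he x
  have hV' : ∀ l, pd l (schwLapseSq m) (-x) = -pd l (schwLapseSq m) x := fun l =>
    pd_of_even (schwLapseSq_neg m) x
  rw [schwSFF_apply hx hV, schwSFF_apply (neg_ne_zero.2 hx) (by rwa [schwLapseSq_neg])]
  simp only [schwConormalSq, conormalSq, schwNormalAccel, schwLapseSq_neg, schwSlice_neg, hd, hV',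
    pd_of_odd (F := pd j f) (fun y => pd_of_even he y), christoffel_schwSlice_neg,
    mul_neg, neg_mul, neg_neg, Finset.sum_neg_distrib]
  congr 3
  rw [← Finset.sum_neg_distrib]
  refine Finset.sum_congr rfl fun k _ => ?_
  ring

theorem eventually_conjMomentum_neg (m : ℝ) (he : ∀ x, f (-x) = f x) :
    ∀ᶠ x in cobounded (Pt 3), conjMomentum (schwMetric m f) (schwSFF m f) (-x)
      = conjMomentum (schwMetric m f) (schwSFF m f) x := by
  filter_upwards [eventually_schwLapseSq_pos m, eventually_cobounded_ne_zero] with x hV hx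
  simp only [conjMomentum, trace, schwMetric_neg m he, schwSFF_neg he hx hV.ne']

theorem isSymbol_conjMomentum (m : ℝ) (hf : IsHomogeneous (1 / 3) f) (i j : Fin 3) :
    IsSymbol (-5 / 3) (fun x => conjMomentum (schwMetric m f) (schwSFF m f) x i j) := by
  have hk := isSymbol_schwSFF m hf
  have h := (isSymbol_trace (isNear_schwMetric m hf) hk).mul
    ((isNear_schwMetric m hf i j).isSymbol zero_le_one)
  rw [add_zero] at h
  exact (hk i j).sub h

theorem hasADMMomentum_zero (m : ℝ) (hf : IsHomogeneous (1 / 3) f) (he : ∀ x, f (-x) = f x)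
    (i : Fin 3) : HasADMMomentum (schwMetric m f) (schwSFF m f) i 0 := by
  rw [HasADMMomentum, mul_zero]
  refine hasSphereLimit_of_odd (IsSymbol.sum fun l _ => (isSymbol_conjMomentum m hf i l).mul
    (isHomogeneous_coord_div_norm l).isSymbol).smooth ?_
  filter_upwards [eventually_conjMomentum_neg m he] with x hx
  simp only [hx, norm_neg, PiLp.neg_apply, neg_div, mul_neg, Finset.sum_neg_distrib]

/-- The integrand is only O(r^{-1}), far from summable by size; exact oddness makes every large
sphere contribute zero. The symbol bounds serve only to provide smoothness. -/
theorem hasCenterOfMass_zero (m : ℝ) (hf : IsHomogeneous (1 / 3) f) (he : ∀ x, f (-x) = f x)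
    (i : Fin 3) : HasCenterOfMass (schwMetric m f) i 0 := by
  rw [HasCenterOfMass, mul_zero]
  have hn := fun i => (isHomogeneous_coord_div_norm i).isSymbol
  have hg := isNear_schwMetric m hf
  have h1 : IsSymbol (-1) (fun x => x i * ∑ j, ∑ k, (pd k (fun y => schwMetric m f y j k) x
      - pd j (fun y => schwMetric m f y k k) x) * (x j / ‖x‖)) :=
    ((IsHomogeneous.coord i).isSymbol.mul (IsSymbol.sum fun j _ => IsSymbol.sum fun k _ =>
      (((hg j k).pd k).sub ((hg k k).pd j)).mul (hn j))).mono (by norm_num)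
  have h2 : IsSymbol (-1) (fun x => ∑ k,
      ((schwMetric m f x k i - (1 : Matrix (Fin 3) (Fin 3) ℝ) k i) * (x k / ‖x‖)
        - (schwMetric m f x k k - (1 : Matrix (Fin 3) (Fin 3) ℝ) k k) * (x i / ‖x‖))) :=
    IsSymbol.sum fun k _ => ((IsSymbol.mul (hg k i) (hn k)).sub
      (IsSymbol.mul (hg k k) (hn i))).mono (by norm_num)
  refine hasSphereLimit_of_odd (h1.sub h2).smooth (Eventually.of_forall fun x => ?_)
  have hp : ∀ l a b, pd l (fun y => schwMetric m f y a b) (-x)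
      = -pd l (fun y => schwMetric m f y a b) x := fun l a b =>
    pd_of_even (fun y => by rw [schwMetric_neg m he]) x
  simp only [hp, schwMetric_neg m he, norm_neg, PiLp.neg_apply, neg_div, mul_neg, neg_mul,
    Finset.sum_neg_distrib, Finset.sum_sub_distrib, sub_neg_eq_add, ← sub_eq_neg_add]
  simp only [sub_mul, Finset.sum_sub_distrib]
  ring

/-! ### Angular momentum -/

theorem pd_schwLapseSq (m : ℝ) (l : Fin 3) {x : Pt 3} (hx : x ≠ 0) :
    pd l (schwLapseSq m) x = 2 * m * x l * ‖x‖ ^ (-3 : ℝ) := by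
  have h : schwLapseSq m = fun y : Pt 3 => 1 + -(2 * m) * ‖y‖ ^ (-1 : ℝ) := by
    funext y
    rw [schwLapseSq, Real.rpow_neg_one]
    ring
  rw [h, pd_const_add, pd_const_mul, pd_norm_rpow _ _ hx]
  norm_num
  ring

/-- Only this shape matters: the values of κ and χ disappear once contracted with Y and x, because Y
⊥ x. -/
theorem exists_pd_schwSlice {x : Pt 3} (hx : x ≠ 0) (hV : schwLapseSq m x ≠ 0) :
    ∃ κ χ : ℝ, ∀ l i j, pd l (fun y => schwSlice m y i j) x = κ * x l * x i * x j
      + χ * ((if i = l then 1 else 0) * x j + x i * if j = l then 1 else 0) := by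
  refine ⟨((schwLapseSq m x)⁻¹ - 1) * (-2 * ‖x‖ ^ (-2 - 2 : ℝ))
      + ‖x‖ ^ (-2 : ℝ) * (-(schwLapseSq m x ^ 2)⁻¹ * (2 * m * ‖x‖ ^ (-3 : ℝ))),
    ((schwLapseSq m x)⁻¹ - 1) * ‖x‖ ^ (-2 : ℝ), fun l i j => ?_⟩
  have hform : (fun y => schwSlice m y i j) = fun y : Pt 3 => (if i = j then 1 else 0)
      + ((schwLapseSq m y)⁻¹ - 1) * (y i * y j * ‖y‖ ^ (-2 : ℝ)) := by
    funext y
    have h2 : ‖y‖ ^ (-2 : ℝ) = ‖y‖⁻¹ * ‖y‖⁻¹ := by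
      rw [Real.rpow_neg (norm_nonneg y), Real.rpow_two, sq, mul_inv]
    rw [h2]
    simp only [schwSlice, Matrix.of_apply]
    ring
  have hd : DifferentiableAt ℝ (schwLapseSq m) x :=
    (contDiffAt_schwLapseSq hx).differentiableAt_infty
  rw [hform, pd_const_add, pd_mul ((hd.fun_inv hV).sub_const 1)
    ((isHomogeneous_coord_mul_coord i j (-2)).differentiableAt hx), pd_sub_const,
    pd_comp (hasDerivAt_inv hV) hd, pd_coord_mul_coord_mul_rpow i j l _ hx, pd_schwLapseSq m l hx]
  ring

/-- In the warped product V⁻¹dr² + r²σ̃ one has ∇_Y(r∂ᵣ) = Y, which is also the flat derivative, so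
Γ(Y, x) = 0. In coordinates every component comes out as a multiple of Y·x. -/
theorem sum_christoffel_rotationField {x : Pt 3} (hx : x ≠ 0) (hV : schwLapseSq m x ≠ 0)
    (i k : Fin 3) :
    ∑ j, ∑ l, christoffel (schwSlice m) k j l x * rotationField i x j * x l = 0 := by
  obtain ⟨κ, χ, h⟩ := exists_pd_schwSlice hx hV
  have hY := sum_rotationField_mul_coord i x
  set Y := rotationField i x
  have hq : ∀ q, ∑ j, ∑ l, (pd j (fun y => schwSlice m y l q) x + pd l (fun y => schwSlice m y j q) x
      - pd q (fun y => schwSlice m y j l) x) * Y j * x l = 0 := by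
    intro q
    simp only [h, Fin.sum_univ_three] at hY ⊢
    fin_cases q <;> simp
    · linear_combination (x 0 * (κ * (x 0 ^ 2 + x 1 ^ 2 + x 2 ^ 2) + 2 * χ)) * hY
    · linear_combination (x 1 * (κ * (x 0 ^ 2 + x 1 ^ 2 + x 2 ^ 2) + 2 * χ)) * hY
    · linear_combination (x 2 * (κ * (x 0 ^ 2 + x 1 ^ 2 + x 2 ^ 2) + 2 * χ)) * hY
  have hexp : ∀ j l, christoffel (schwSlice m) k j l x * Y j * x l
      = ∑ q, 1 / 2 * (schwSlice m x)⁻¹ k q * ((pd j (fun y => schwSlice m y l q) x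
        + pd l (fun y => schwSlice m y j q) x
        - pd q (fun y => schwSlice m y j l) x) * Y j * x l) := by
    intro j l
    simp only [christoffel, Finset.mul_sum, Finset.sum_mul]
    exact Finset.sum_congr rfl fun q _ => by ring
  simp only [hexp]
  rw [Finset.sum_congr rfl fun j _ => Finset.sum_comm, Finset.sum_comm]
  refine Finset.sum_eq_zero fun q _ => ?_
  simp only [← Finset.mul_sum, hq, mul_zero]

theorem contraction_expand (H : Fin 3 → Fin 3 → ℝ) (Y x v d e : Fin 3 → ℝ)
    (Γ : Fin 3 → Fin 3 → Fin 3 → ℝ) (w : ℝ) :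
    ∑ j, ∑ l, (H j l + (v j * d l + v l * d j) * w
        - ∑ k, d k * (Γ k j l + e k * d j * d l)) * Y j * x l
      = ∑ j, Y j * ∑ l, x l * H j l
        + ((∑ j, Y j * v j) * (∑ l, x l * d l) + (∑ l, x l * v l) * ∑ j, Y j * d j) * w
        - ∑ k, d k * (∑ j, ∑ l, Γ k j l * Y j * x l)
        - (∑ k, d k * e k) * (∑ j, Y j * d j) * ∑ l, x l * d l := by
  simp only [Fin.sum_univ_three]
  ring

/-- The derivative of `f` along a rotation field. -/
noncomputable def rotDeriv (i : Fin 3) (f : Pt 3 → ℝ) (x : Pt 3) : ℝ :=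
  ∑ j, rotationField i x j * pd j f x

theorem isHomogeneous_rotDeriv {a : ℝ} (hf : IsHomogeneous a f) (i : Fin 3) :
    IsHomogeneous a (rotDeriv i f) := by
  have h : IsHomogeneous (1 + (a - 1)) (rotDeriv i f) := IsHomogeneous.sum fun j _ =>
    (isHomogeneous_rotationField i j).mul (hf.pd j)
  rwa [add_sub_cancel] at h

/-- Half the inner product of `df` and `dV`. -/
noncomputable def gradLapse (m : ℝ) (f : Pt 3 → ℝ) (x : Pt 3) : ℝ :=
  ∑ k, pd k f x * (1 / 2 * ∑ l, (schwSlice m x)⁻¹ k l * pd l (schwLapseSq m) x)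

/-- Euler's relation for df, of degree -2/3, turns the Hessian at (Y, x) into -(2/3) Yf. The radial
function V satisfies YV = 0, and Γ(Y, x) = 0. Every surviving term carries the factor Yf. -/
theorem sum_schwNormalAccel_rotationField (hf : IsHomogeneous (1 / 3) f) {x : Pt 3} (hx : x ≠ 0)
    (hV : schwLapseSq m x ≠ 0) (i : Fin 3) :
    ∑ j, ∑ l, schwNormalAccel m f j l x * rotationField i x j * x l
      = rotDeriv i f x * (-2 / 3 + m * ‖x‖⁻¹ * (schwLapseSq m x)⁻¹
        - gradLapse m f x * (1 / 3 * f x)) := by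
  have hr : ‖x‖ ≠ 0 := norm_ne_zero_iff.2 hx
  have hE : ∀ j, ∑ l, x l * pd j (pd l f) x = (1 / 3 - 1) * pd j f x := by
    intro j
    rw [← (hf.pd j).euler hx]
    exact Finset.sum_congr rfl fun l _ => by
      rw [pd_comm ((hf.contDiffAt hx).of_le ENat.LEInfty.out) j l]
  have hVY : ∑ j, rotationField i x j * pd j (schwLapseSq m) x = 0 := by
    have h := sum_rotationField_mul_coord i x
    simp only [pd_schwLapseSq m _ hx]
    rw [← mul_zero (2 * m * ‖x‖ ^ (-3 : ℝ)), ← h, Finset.mul_sum]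
    exact Finset.sum_congr rfl fun j _ => by ring
  have hVx : ∑ l, x l * pd l (schwLapseSq m) x = 2 * m * ‖x‖⁻¹ := by
    simp only [pd_schwLapseSq m _ hx]
    have h : ∀ l, x l * (2 * m * x l * ‖x‖ ^ (-3 : ℝ))
        = 2 * m * ‖x‖ ^ (-3 : ℝ) * x l ^ 2 := fun l => by ring
    simp only [h, ← Finset.mul_sum, sum_coord_sq]
    rw [Real.rpow_neg (norm_nonneg x), show ‖x‖ ^ (3 : ℝ) = ‖x‖ ^ 3 by norm_cast]
    field_simp
  have hexp := contraction_expand (fun j l => pd j (pd l f) x) (rotationField i x) (fun l => x l)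
    (fun l => pd l (schwLapseSq m) x) (fun l => pd l f x)
    (fun k => 1 / 2 * ∑ l, (schwSlice m x)⁻¹ k l * pd l (schwLapseSq m) x)
    (fun k j l => christoffel (schwSlice m) k j l x) (2 * schwLapseSq m x)⁻¹
  simp only [hE, hVY, hVx, hf.euler hx, sum_christoffel_rotationField hx hV] at hexp
  simp only [schwNormalAccel, div_eq_mul_inv _ (2 * schwLapseSq m x)]
  rw [hexp]
  simp only [rotDeriv, gradLapse, mul_inv]
  have h : ∑ j, rotationField i x j * ((1 / 3 - 1) * pd j f x)
      = (1 / 3 - 1) * ∑ j, rotationField i x j * pd j f x := by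
    rw [Finset.mul_sum]
    exact Finset.sum_congr rfl fun j _ => by ring
  rw [h]
  simp only [mul_zero, Finset.sum_const_zero]
  ring

/-- The slice metric pairs Y and x to zero, so only -V df⊗df remains, and Euler's relation gives
df(x) = f/3. -/
theorem sum_schwMetric_rotationField (hf : IsHomogeneous (1 / 3) f) {x : Pt 3} (hx : x ≠ 0)
    (i : Fin 3) :
    ∑ j, ∑ l, schwMetric m f x j l * rotationField i x j * x l
      = -(schwLapseSq m x * rotDeriv i f x * (1 / 3 * f x)) := by
  have hY := sum_rotationField_mul_coord i x
  rw [rotDeriv, ← hf.euler hx]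
  simp only [schwMetric_apply, schwSlice, Matrix.of_apply, Fin.sum_univ_three] at hY ⊢
  set c := (schwLapseSq m x)⁻¹ - 1
  simp
  linear_combination (1 + c * (x 0 / ‖x‖ * (x 0 / ‖x‖) + x 1 / ‖x‖ * (x 1 / ‖x‖)
    + x 2 / ‖x‖ * (x 2 / ‖x‖))) * hY

/-- The radial factor of the part of the angular momentum density that is linear in `f`. -/
noncomputable def linearFactor (m : ℝ) (x : Pt 3) : ℝ :=
  √(schwLapseSq m x) * (-2 / 3 + m * ‖x‖⁻¹ * (schwLapseSq m x)⁻¹) * ‖x‖⁻¹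

/-- The nonlinear factor `(1 - V |df|²)^{-1/2}` of the second fundamental form. -/
noncomputable def nonlinearFactor (m : ℝ) (f : Pt 3 → ℝ) (x : Pt 3) : ℝ :=
  (√(schwLapseSq m x * schwConormalSq m f x))⁻¹

/-- The exact angular momentum density of a graph. -/
theorem sum_conjMomentum_rotationField (hf : IsHomogeneous (1 / 3) f) {x : Pt 3} (hx : x ≠ 0)
    (hV : 0 < schwLapseSq m x) (i : Fin 3) :
    ∑ j, ∑ l, conjMomentum (schwMetric m f) (schwSFF m f) x j l * rotationField i x j
        * (x l / ‖x‖)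
      = rotDeriv i f x * (nonlinearFactor m f x * linearFactor m x
        - (√(schwConormalSq m f x))⁻¹ * gradLapse m f x * (1 / 3 * f x) * ‖x‖⁻¹
        + trace (schwMetric m f) (schwSFF m f) x * schwLapseSq m x * (1 / 3 * f x) * ‖x‖⁻¹) := by
  have h1 := sum_schwNormalAccel_rotationField hf hx hV.ne' i
  have h2 := sum_schwMetric_rotationField (m := m) hf hx i
  have hterm : ∀ j l, conjMomentum (schwMetric m f) (schwSFF m f) x j l * rotationField i x j
      * (x l / ‖x‖) = (√(schwConormalSq m f x))⁻¹ * ‖x‖⁻¹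
        * (schwNormalAccel m f j l x * rotationField i x j * x l)
        - trace (schwMetric m f) (schwSFF m f) x * ‖x‖⁻¹
          * (schwMetric m f x j l * rotationField i x j * x l) := by
    intro j l
    have : conjMomentum (schwMetric m f) (schwSFF m f) x j l = schwSFF m f x j l
      - trace (schwMetric m f) (schwSFF m f) x * schwMetric m f x j l := rfl
    rw [this, schwSFF_apply hx hV.ne']
    ring
  simp only [hterm, Finset.sum_sub_distrib, ← Finset.mul_sum, h1, h2]
  have hs : √(schwLapseSq m x) ≠ 0 := (Real.sqrt_pos.2 hV).ne'
  -- Splitting (V⁻¹ - |df|²)^{-1/2} into √V and (1 - V|df|²)^{-1/2} isolates the purely radial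
  -- factor of the linear part.
  have hW : nonlinearFactor m f x * √(schwLapseSq m x) = (√(schwConormalSq m f x))⁻¹ := by
    rw [nonlinearFactor, Real.sqrt_mul hV.le, mul_inv]
    field_simp
  rw [linearFactor]
  linear_combination (-‖x‖⁻¹ * rotDeriv i f x *
    (-2 / 3 + m * ‖x‖⁻¹ * (schwLapseSq m x)⁻¹)) * hW

/-- `|df|²` with respect to the Euclidean metric. -/
noncomputable def euclGradSq (f : Pt 3 → ℝ) (x : Pt 3) : ℝ := ∑ i, pd i f x * pd i f x

/-- The Euclidean Laplacian of `f`. -/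
noncomputable def euclLaplacian (f : Pt 3 → ℝ) (x : Pt 3) : ℝ := ∑ i, pd i (pd i f) x

theorem isHomogeneous_euclGradSq {a : ℝ} (hf : IsHomogeneous a f) :
    IsHomogeneous (a - 1 + (a - 1)) (euclGradSq f) :=
  IsHomogeneous.sum fun i _ => (hf.pd i).mul (hf.pd i)

theorem isHomogeneous_euclLaplacian {a : ℝ} (hf : IsHomogeneous a f) :
    IsHomogeneous (a - 1 - 1) (euclLaplacian f) :=
  IsHomogeneous.sum fun i _ => (hf.pd i).pd i

/-! ### Expansion of the angular momentum density up to cubic order -/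

theorem isSymbol_inv_norm : IsSymbol (-1) (fun x : Pt 3 => ‖x‖⁻¹) := by
  simpa [Real.rpow_neg_one] using (IsHomogeneous.norm_rpow (-1)).isSymbol

theorem isNear_sqrt {F : Pt 3 → ℝ} {q : ℝ} (hF : IsNear q F 1) (hq : 0 < q) :
    IsNear q (fun x => √(F x)) 1 := by
  simpa [Real.sqrt_eq_rpow] using hF.rpow hq (1 / 2)

theorem isSymbol_linearFactor_add (m : ℝ) :
    IsSymbol (-2) (fun x => linearFactor m x + 2 / 3 * ‖x‖⁻¹) := by
  have hs := isNear_sqrt (isNear_schwLapseSq m) one_pos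
  have h1 := (IsSymbol.const_mul (-2 / 3) hs).mul isSymbol_inv_norm
  have h2 := ((((hs.isSymbol zero_le_one).mul (isSymbol_inv_norm.const_mul m)).mul
    ((isNear_schwLapseSq_inv m).isSymbol zero_le_one)).mul isSymbol_inv_norm)
  refine ((h1.mono (b := -2) (by norm_num)).add (h2.mono (b := -2) (by norm_num))).congr
    (Eventually.of_forall fun x => ?_)
  simp only [linearFactor]
  ring

theorem isSymbol_linearFactor (m : ℝ) : IsSymbol (-1) (linearFactor m) := by
  refine (((isSymbol_linearFactor_add m).mono (b := -1) (by norm_num)).sub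
    (isSymbol_inv_norm.const_mul (2 / 3))).congr (Eventually.of_forall fun x => ?_)
  simp only
  ring

/-- Second order expansion of the inverse square root. -/
theorem isSymbol_inv_sqrt_sub {u : Pt 3 → ℝ} {q : ℝ} (hq : 0 < q) (hu : IsSymbol (-q) u) :
    IsSymbol (-q - q) (fun x => (√(1 - u x))⁻¹ - 1 - 1 / 2 * u x) := by
  have hF : IsNear q (fun x => 1 - u x) 1 := by
    refine hu.neg.congr (Eventually.of_forall fun x => ?_)
    simp only
    ring
  have hs := isNear_inv_sqrt hF hq
  set s : Pt 3 → ℝ := fun x => (√(1 - u x))⁻¹ with hsdef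
  have hh : IsNear q (fun x => 1 / 2 * s x + 1 / 2) 1 := by
    have := ((IsNear.const q (1 / 2)).mul hq.le hs).add (IsNear.const q (1 / 2))
    norm_num at this
    simpa using this
  -- For s = (1 - u)^{-1/2}, s²(1 - u) = 1 gives s - 1 = u s²/(1 + s), so the remainder is u (s²/(1
  -- + s) - 1/2). The denominator is written as (1 + s)/2 because `IsNear.inv` requires the limit 1.
  have hquot : IsNear q (fun x => 1 / 2 * (s x * s x * (1 / 2 * s x + 1 / 2)⁻¹)) (1 / 2) := by
    have := (IsNear.const q (1 / 2)).mul hq.le ((hs.mul hq.le hs).mul hq.le (hh.inv hq))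
    simpa using this
  refine (IsSymbol.mul hu hquot).congr ?_
  filter_upwards [(hF.tendsto hq).eventually (lt_mem_nhds one_pos)] with x hx
  have hpos : 0 < √(1 - u x) := Real.sqrt_pos.2 hx
  have hspos : 0 < s x := inv_pos.2 hpos
  have hs2 : s x * s x * (1 - u x) = 1 := by
    have := Real.mul_self_sqrt hx.le
    simp only [hsdef]
    generalize √(1 - u x) = t at *
    field_simp
    linarith
  have hne : 1 / 2 * s x + 1 / 2 ≠ 0 := by positivity
  change u x * (1 / 2 * (s x * s x * (1 / 2 * s x + 1 / 2)⁻¹) - 1 / 2) = s x - 1 - 1 / 2 * u x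
  have : s x + 1 ≠ 0 := by positivity
  field_simp
  linear_combination -2 * hs2

theorem isSymbol_nonlinearFactor_sub (m : ℝ) (hf : IsHomogeneous (1 / 3) f) :
    IsSymbol (-7 / 3) (fun x => nonlinearFactor m f x - 1 - 1 / 2 * euclGradSq f x) := by
  have hV := isNear_schwLapseSq m
  have hD := isSymbol_gradSq m hf
  have hD' := isSymbol_contract_sub (isNear_schwSlice m) fun i j => isSymbol_pd_mul_pd hf i j
  have hu := ((hV.isSymbol zero_le_one).mul hD).mono (b := -(4 / 3)) (by norm_num)
  have h1 := isSymbol_inv_sqrt_sub (by norm_num) hu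
  have h2 := (IsSymbol.mul hV hD).const_mul (1 / 2)
  have h3 := hD'.const_mul (1 / 2)
  refine (((h1.mono (b := -7 / 3) (by norm_num)).add (h2.mono (b := -7 / 3) (by norm_num))).add
    (h3.mono (b := -7 / 3) (by norm_num))).congr ?_
  filter_upwards [eventually_schwLapseSq_pos m] with x hx
  have hc : schwLapseSq m x * schwConormalSq m f x = 1 - schwLapseSq m x *
      ∑ i, ∑ j, (schwSlice m x)⁻¹ i j * (pd i f x * pd j f x) := by
    simp only [schwConormalSq, conormalSq, mul_sub, mul_inv_cancel₀ hx.ne', mul_assoc]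
  simp only [nonlinearFactor, hc, euclGradSq]
  ring

/-- The part of the angular momentum density that is cubic in `f`. -/
noncomputable def cubicDensity (i : Fin 3) (f : Pt 3 → ℝ) (x : Pt 3) : ℝ :=
  rotDeriv i f x * ((-(1 / 3) * euclGradSq f x + 1 / 3 * (euclLaplacian f x * f x)) * ‖x‖⁻¹)

theorem isHomogeneous_cubicDensity (hf : IsHomogeneous (1 / 3) f) (i : Fin 3) :
    IsHomogeneous (-2) (cubicDensity i f) := by
  have h1 := (isHomogeneous_euclGradSq hf).const_mul (-(1 / 3))
  have h2 := ((isHomogeneous_euclLaplacian hf).mul hf).const_mul (1 / 3)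
  rw [show (1 / 3 - 1 - 1 + 1 / 3 : ℝ) = 1 / 3 - 1 + (1 / 3 - 1) by norm_num] at h2
  have h := (isHomogeneous_rotDeriv hf i).mul ((h1.add h2).mul (IsHomogeneous.norm_rpow (-1)))
  rw [show (1 / 3 + (1 / 3 - 1 + (1 / 3 - 1) + -1) : ℝ) = -2 by norm_num] at h
  exact h.congr fun x _ => by rw [Real.rpow_neg_one, cubicDensity]

/-- The density splits into a radial function times Yf, with zero integral on each sphere, the
degree -2 cubic density, and an O(r^{-3}) error. In the cubic part, -1/3 is 1/2 · (-2/3), from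
|df|²/2 times the leading linear factor -2/(3r), and +1/3 is Euler's factor in tr k · f/(3r). -/
theorem hasAngularMomentum_rotationField (m : ℝ) (hf : IsHomogeneous (1 / 3) f) (i : Fin 3) :
    HasAngularMomentum (schwMetric m f) (schwSFF m f) (rotationField i)
      ((8 * Real.pi)⁻¹ * ∫ u : Metric.sphere (0 : Pt 3) 1, cubicDensity i f u
        ∂(volume : Measure (Pt 3)).toSphere) := by
  rw [HasAngularMomentum, mul_inv_cancel_left₀ (by positivity)]
  have hrad : ∀ x y : Pt 3, ‖x‖ = ‖y‖ → linearFactor m x = linearFactor m y := by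
    intro x y h
    simp only [linearFactor, schwLapseSq, h]
  have h1 := hasSphereLimit_radial_mul_rotation hf (isSymbol_linearFactor m).smooth hrad i
  have h2 := hasSphereLimit_of_isHomogeneous (isHomogeneous_cubicDensity hf i)
  have hY := (isHomogeneous_rotDeriv hf i).isSymbol
  have hG := (isHomogeneous_euclGradSq hf).isSymbol
  have hV := isNear_schwLapseSq m
  have hW := (isNear_inv_sqrt (isNear_schwConormalSq m hf) one_pos).isSymbol zero_le_one
  have hfr : IsSymbol (-2 / 3) (fun x => 1 / 3 * f x * ‖x‖⁻¹) :=
    ((hf.isSymbol.const_mul (1 / 3)).mul isSymbol_inv_norm).mono (by norm_num)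
  have hB : IsSymbol (-8 / 3) (gradLapse m f) := IsSymbol.sum fun k _ =>
    (((hf.pd k).isSymbol).mul (IsSymbol.const_mul (1 / 2) (IsSymbol.sum fun l _ =>
      ((IsNear.matrix_inv one_pos (isNear_schwSlice m) k l).isSymbol zero_le_one).mul
        (hV.pd l)))).mono (by norm_num)
  have htr : IsSymbol (-8 / 3)
      (fun x => trace (schwMetric m f) (schwSFF m f) x - euclLaplacian f x) := by
    refine (((isSymbol_trace_sub (isNear_schwMetric m hf) (isSymbol_schwSFF m hf)).mono
      (b := -8 / 3) (by norm_num)).add (IsSymbol.sum (s := Finset.univ) fun l _ =>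
        isSymbol_schwSFF_sub m hf l l)).congr (Eventually.of_forall fun x => ?_)
    simp only [euclLaplacian, Finset.sum_sub_distrib]
    ring
  have htr' := isSymbol_trace (isNear_schwMetric m hf) (isSymbol_schwSFF m hf)
  -- Five errors of order -10/3: truncating the nonlinear factor, replacing the linear factor by
  -- -2/(3r), the ⟨df, dV⟩ term, V → 1, and tr k → Δf. The common factor Yf adds 1/3 to the order.
  have e1 := ((isSymbol_nonlinearFactor_sub m hf).mul (isSymbol_linearFactor m)).mono
    (b := -10 / 3) (by norm_num)
  have e2 := ((hG.const_mul (1 / 2)).mul (isSymbol_linearFactor_add m)).mono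
    (b := -10 / 3) (by norm_num)
  have e3 := ((hW.mul hB).mul hfr).mono (b := -10 / 3) (by norm_num)
  have e4 := ((htr'.mul hV).mul hfr).mono (b := -10 / 3) (by norm_num)
  have e5 := (htr.mul hfr).mono (b := -10 / 3) (by norm_num)
  have herr := (hY.mul ((((e1.add e2).sub e3).add e4).add e5)).mono (b := -3) (by norm_num)
  have h := (h1.add h2).add (hasSphereLimit_of_isSymbol herr (by norm_num))
  rw [zero_add, add_zero] at h
  refine HasSphereLimit.congr h ?_
  filter_upwards [eventually_cobounded_ne_zero, eventually_schwLapseSq_pos m] with x hx hVx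
  rw [sum_conjMomentum_rotationField hf hx hVx, cubicDensity]
  simp only [rotDeriv]
  ring

end Charges

/-! ### The profile function -/

theorem profile_eq {x : Pt 3} (hx : x ≠ 0) :
    profile x = x 0 ^ 1 * x 1 ^ 3 * ‖x‖ ^ (-11 / 3 : ℝ) := by
  have hpos : 0 < ‖x‖ := norm_pos_iff.2 hx
  have h : ‖x‖ ^ (-11 / 3 : ℝ) = ‖x‖ ^ (1 / 3 : ℝ) * (‖x‖ ^ 4)⁻¹ := by
    rw [show (-11 / 3 : ℝ) = 1 / 3 - (4 : ℕ) by norm_num, Real.rpow_sub_natCast hpos.ne',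
      div_eq_mul_inv]
  rw [h, profile]
  field_simp

theorem isHomogeneous_profile : IsHomogeneous (1 / 3) profile := by
  have h1 : IsHomogeneous 1 fun x : Pt 3 => x 1 := IsHomogeneous.coord 1
  have h := ((IsHomogeneous.coord 0).mul ((h1.mul h1).mul h1)).mul
    (IsHomogeneous.norm_rpow (-11 / 3))
  rw [show (1 + (1 + 1 + 1) + -11 / 3 : ℝ) = 1 / 3 by norm_num] at h
  exact h.congr fun x hx => by rw [profile_eq hx]; ring

theorem profile_neg (x : Pt 3) : profile (-x) = profile x := by
  simp only [profile, norm_neg, PiLp.neg_apply]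
  ring

theorem pd_mul_norm_rpow {F : Pt 3 → ℝ} {x : Pt 3} (hx : x ≠ 0) (hF : DifferentiableAt ℝ F x)
    (b : ℝ) (i : Fin 3) : pd i (fun y => F y * ‖y‖ ^ b) x
      = pd i F x * ‖x‖ ^ b + b * (F x * x i) * ‖x‖ ^ (b - 2) := by
  rw [pd_mul hF ((IsHomogeneous.norm_rpow b).differentiableAt hx), pd_norm_rpow b i hx]
  ring

theorem pd_mul_norm_rpow_of_norm_eq_one {F : Pt 3 → ℝ} {x : Pt 3} (hx : ‖x‖ = 1)
    (hF : DifferentiableAt ℝ F x) (b : ℝ) (i : Fin 3) :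
    pd i (fun y => F y * ‖y‖ ^ b) x = pd i F x + b * (F x * x i) := by
  rw [pd_mul_norm_rpow (norm_pos_iff.1 (by rw [hx]; exact one_pos)) hF, hx]
  simp

/-- The polynomial `x¹ (x²)³`. -/
noncomputable def profilePoly (x : Pt 3) : ℝ := x 0 ^ 1 * x 1 ^ 3

theorem contDiff_profilePoly : ContDiff ℝ ∞ profilePoly :=
  ((contDiff_coord 0).pow 1).mul ((contDiff_coord 1).pow 3)

theorem pd_profile {x : Pt 3} (hx : x ≠ 0) (i : Fin 3) :
    pd i profile x = pd i profilePoly x * ‖x‖ ^ (-11 / 3 : ℝ)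
      + -11 / 3 * (profilePoly x * x i) * ‖x‖ ^ (-11 / 3 - 2 : ℝ) := by
  rw [← pd_mul_norm_rpow hx contDiff_profilePoly.contDiffAt.differentiableAt_infty]
  refine pd_congr ?_
  filter_upwards [eventually_ne_nhds hx] with y hy using profile_eq hy

/-- With p the polynomial and b = -11/3, differentiating p r^b twice at r = 1 gives 2b = -22/3 for
the cross terms and b(b - 2) = 187/9 for the last term. -/
theorem pd_pd_profile {x : Pt 3} (hx : ‖x‖ = 1) (i : Fin 3) :
    pd i (pd i profile) x = pd i (pd i profilePoly) x - 22 / 3 * (x i * pd i profilePoly x)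
      - 11 / 3 * profilePoly x + 187 / 9 * profilePoly x * x i ^ 2 := by
  have hx0 : x ≠ 0 := norm_pos_iff.1 (by rw [hx]; exact one_pos)
  have hp : DifferentiableAt ℝ profilePoly x :=
    contDiff_profilePoly.contDiffAt.differentiableAt_infty
  have hpi : DifferentiableAt ℝ (pd i profilePoly) x :=
    (contDiff_profilePoly.contDiffAt.pd i).differentiableAt_infty
  have hc : DifferentiableAt ℝ (fun y : Pt 3 => y i) x :=
    (contDiff_coord i).contDiffAt.differentiableAt_infty
  have hpc : DifferentiableAt ℝ (fun y : Pt 3 => -11 / 3 * (profilePoly y * y i)) x :=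
    (hp.mul hc).const_mul _
  have hn : ∀ b : ℝ, DifferentiableAt ℝ (fun y : Pt 3 => ‖y‖ ^ b) x := fun b =>
    (IsHomogeneous.norm_rpow b).differentiableAt hx0
  have h : pd i profile =ᶠ[𝓝 x] fun y => pd i profilePoly y * ‖y‖ ^ (-11 / 3 : ℝ)
      + -11 / 3 * (profilePoly y * y i) * ‖y‖ ^ (-11 / 3 - 2 : ℝ) := by
    filter_upwards [eventually_ne_nhds hx0] with y hy using pd_profile hy i
  rw [pd_congr h, pd_add (hpi.fun_mul (hn _)) (hpc.fun_mul (hn _)),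
    pd_mul_norm_rpow_of_norm_eq_one hx hpi, pd_mul_norm_rpow_of_norm_eq_one hx hpc, pd_const_mul,
    pd_mul hp hc, pd_coord, if_pos rfl]
  ring

theorem pd_profilePoly (i : Fin 3) (x : Pt 3) : pd i profilePoly x
    = ![x 1 ^ 3, 3 * x 0 * x 1 ^ 2, 0] i := by
  have h := pd_monomial i 0 1 1 3 x
  change pd i profilePoly x = _ at h
  rw [h]
  fin_cases i <;> simp
  ring

theorem sum_pd_pd_profilePoly (x : Pt 3) : ∑ i, pd i (pd i profilePoly) x = 6 * x 0 * x 1 := by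
  have h0 : pd 0 profilePoly = fun y => y 0 ^ 0 * y 1 ^ 3 := by
    funext y
    simp [pd_profilePoly]
  have h1 : pd 1 profilePoly = fun y => 3 * (y 0 ^ 1 * y 1 ^ 2) := by
    funext y
    simp [pd_profilePoly]
    ring
  have h2 : pd 2 profilePoly = fun _ => 0 := by
    funext y
    simp [pd_profilePoly]
  rw [Fin.sum_univ_three, h0, h1, h2, pd_const, pd_const_mul, pd_monomial, pd_monomial]
  simp
  ring

/-- The cubic density of the profile on the unit sphere. -/
theorem cubicDensity_profile (u : Metric.sphere (0 : Pt 3) 1) :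
    cubicDensity 2 profile u
      = 1 / 3 * ((u : Pt 3) 0 ^ 0 * (u : Pt 3) 1 ^ 10) - 3 * ((u : Pt 3) 0 ^ 4 * (u : Pt 3) 1 ^ 6)
        + (-(11 / 3) * ((u : Pt 3) 0 ^ 4 * (u : Pt 3) 1 ^ 8)
          + 11 / 9 * ((u : Pt 3) 0 ^ 2 * (u : Pt 3) 1 ^ 10)) := by
  have hu : ‖(u : Pt 3)‖ = 1 := norm_eq_of_mem_sphere u
  generalize (u : Pt 3) = x at hu
  have hx0 : x ≠ 0 := norm_pos_iff.1 (by rw [hu]; exact one_pos)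
  have hr := sum_coord_sq x
  rw [hu, one_pow] at hr
  -- Here x·∂p = 4p and |x| = 1, so the coefficient of p is -4·22/3 - 11 + 187/9 = -176/9.
  have hlap : euclLaplacian profile x = 6 * x 0 * x 1 - 176 / 9 * profilePoly x := by
    have hs := sum_pd_pd_profilePoly x
    rw [Fin.sum_univ_three] at hr hs
    simp only [euclLaplacian, pd_pd_profile hu, Fin.sum_univ_three]
    simp only [pd_profilePoly, profilePoly] at hs ⊢
    simp at hs ⊢
    linear_combination hs + 187 / 9 * (x 0 * x 1 ^ 3) * hr
  have hpd : ∀ i, pd i profile x = pd i profilePoly x - 11 / 3 * (profilePoly x * x i) := by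
    intro i
    rw [pd_profile hx0, hu]
    simp only [Real.one_rpow]
    ring
  have hval : profile x = profilePoly x := by
    rw [profile_eq hx0, hu, Real.one_rpow, mul_one, profilePoly]
  rw [cubicDensity, hlap, hval, hu]
  simp only [rotDeriv, euclGradSq, hpd, pd_profilePoly, rotationField_two, Fin.sum_univ_three,
    profilePoly] at hr ⊢
  simp
  -- The sphere relation enters only through the term (121/9) p²|x|² of |df|².
  linear_combination (-(1 / 3) * (3 * x 0 ^ 2 * x 1 ^ 2 - x 1 ^ 4) * (121 / 9)
    * (x 0 * x 1 ^ 3) ^ 2) * hr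

/-- The two moments of degree 12 cancel, since ∫x₀²x₁¹⁰ = 3∫x₀⁴x₁⁸. Those of degree 10 give 4π(7 -
3)/231. -/
theorem integral_cubicDensity_profile :
    ∫ u : Metric.sphere (0 : Pt 3) 1, cubicDensity 2 profile u
      ∂(volume : Measure (Pt 3)).toSphere = 16 * Real.pi / 231 := by
  have hi := fun k l => integrable_monomial 0 1 k l
  have h1 := integral_coord_pow_even 5
  have h2 := integral_coord_four_six
  have h3 := integral_rotation_two_monomial 2 8
  simp only [cubicDensity_profile]
  rw [integral_add (by exact ((hi 0 10).const_mul _).sub ((hi 4 6).const_mul _))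
      (by exact ((hi 4 8).const_mul _).add ((hi 2 10).const_mul _)),
    integral_sub ((hi 0 10).const_mul _) ((hi 4 6).const_mul _),
    integral_add ((hi 4 8).const_mul _) ((hi 2 10).const_mul _), integral_const_mul,
    integral_const_mul, integral_const_mul, integral_const_mul, h2]
  norm_num at h1 h3 ⊢
  rw [h1]
  linarith

/-- Cubic scaling makes the angular momentum unbounded in λ although the energy does not change. -/
theorem cubicDensity_smul (lam : ℝ) (f : Pt 3 → ℝ) (i : Fin 3) (x : Pt 3) :
    cubicDensity i (lam • f) x = lam ^ 3 * cubicDensity i f x := by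
  have h1 : ∀ j, pd j (lam • f) = fun y => lam * pd j f y := fun j => funext fun y =>
    pd_const_mul lam
  have h2 : ∀ j, pd j (fun y => lam * pd j f y) x = lam * pd j (pd j f) x := fun j =>
    pd_const_mul lam
  simp only [cubicDensity, rotDeriv, euclGradSq, euclLaplacian, h1, h2, Pi.smul_apply, smul_eq_mul,
    Fin.sum_univ_three]
  ring

theorem isHomogeneous_smul_profile (lam : ℝ) : IsHomogeneous (1 / 3) (lam • profile) :=
  isHomogeneous_profile.const_mul lam

theorem smul_profile_neg (lam : ℝ) (x : Pt 3) : (lam • profile) (-x) = (lam • profile) x := by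
  simp [profile_neg]

/-- The angular momentum of the graph of `λ f` about the third axis. -/
theorem hasAngularMomentum_smul_profile (m lam : ℝ) :
    HasAngularMomentum (schwMetric m (lam • profile)) (schwSFF m (lam • profile))
      (fun x => ![-x 1, x 0, 0]) (lam ^ 3 * (2 / (3 * 7 * 11))) := by
  have h := hasAngularMomentum_rotationField m (isHomogeneous_smul_profile lam) 2
  simp only [cubicDensity_smul] at h
  rw [integral_const_mul, integral_cubicDensity_profile] at h
  have hY : rotationField 2 = fun x : Pt 3 => ![-x 1, x 0, 0] := funext rotationField_two
  rw [hY] at h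
  convert h using 1
  have := Real.pi_ne_zero
  field_simp
  ring

end SchwarzschildGraph

/-! ### The main theorem -/

open SchwarzschildGraph in
theorem mainTheorem4 (m : ℝ) (hm : 0 < m) :
    -- the graph of `f` itself
    ((∃ R : ℝ, 2 * m ≤ R ∧ IsSpacelikeGraph m profile R) ∧
      (∀ R : ℝ, 2 * m ≤ R → IsSpacelikeGraph m profile R →
        IsAsymptoticallyFlatEnd R (schwMetric m profile) (schwSFF m profile)) ∧
      HasADMEnergy (schwMetric m profile) m ∧
      (∀ i, HasADMMomentum (schwMetric m profile) (schwSFF m profile) i 0) ∧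
      (∀ i, HasCenterOfMass (schwMetric m profile) i 0) ∧
      (∀ i, ∃ J : ℝ, HasAngularMomentum (schwMetric m profile) (schwSFF m profile)
        (rotationField i) J) ∧
      HasAngularMomentum (schwMetric m profile) (schwSFF m profile)
        (fun x => ![-x 1, x 0, 0]) (2 / (3 * 7 * 11))) ∧
    -- the graphs of the rescaled functions
    (∀ lam : ℝ, 0 < lam →
      (∃ R : ℝ, 2 * m ≤ R ∧ IsSpacelikeGraph m (lam • profile) R) ∧
      (∀ R : ℝ, 2 * m ≤ R → IsSpacelikeGraph m (lam • profile) R →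
        IsAsymptoticallyFlatEnd R (schwMetric m (lam • profile)) (schwSFF m (lam • profile))) ∧
      HasADMEnergy (schwMetric m (lam • profile)) m ∧
      (∀ i, HasADMMomentum (schwMetric m (lam • profile)) (schwSFF m (lam • profile)) i 0) ∧
      (∀ i, ∃ J : ℝ, HasAngularMomentum (schwMetric m (lam • profile)) (schwSFF m (lam • profile))
        (rotationField i) J)) ∧
    -- their angular momentum is arbitrarily large, in particular larger than `m`
    (∀ c : ℝ, ∃ lam : ℝ, 0 < lam ∧ ∃ J : ℝ, c < J ∧
      HasAngularMomentum (schwMetric m (lam • profile)) (schwSFF m (lam • profile))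
        (fun x => ![-x 1, x 0, 0]) J) := by
  have hp := isHomogeneous_profile
  refine ⟨⟨exists_isSpacelikeGraph m hp, fun R hR hs => isAsymptoticallyFlatEnd hm hp hR hs,
    hasADMEnergy_schwMetric m hp, hasADMMomentum_zero m hp profile_neg,
    hasCenterOfMass_zero m hp profile_neg,
    fun i => ⟨_, hasAngularMomentum_rotationField m hp i⟩, ?_⟩, fun lam _ => ?_, fun c => ?_⟩
  · simpa using hasAngularMomentum_smul_profile m 1
  · have hl := isHomogeneous_smul_profile lam
    exact ⟨exists_isSpacelikeGraph m hl, fun R hR hs => isAsymptoticallyFlatEnd hm hl hR hs,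
      hasADMEnergy_schwMetric m hl, hasADMMomentum_zero m hl (smul_profile_neg lam),
      fun i => ⟨_, hasAngularMomentum_rotationField m hl i⟩⟩
  · have hc : 1 ≤ 231 * (|c| + 1) := by linarith [abs_nonneg c]
    -- Since λ = 231(|c| + 1) ≥ 1, λ³ ≥ λ and the angular momentum 2λ³/231 is at least 2(|c| + 1) >
    -- c.
    refine ⟨231 * (|c| + 1), by linarith, _, ?_, hasAngularMomentum_smul_profile m _⟩
    have h3 : 231 * (|c| + 1) ≤ (231 * (|c| + 1)) ^ 3 := le_self_pow₀ hc (by norm_num)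
    linarith [le_abs_self c, abs_nonneg c]
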